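/- Let $n\ge 1$ and let $\mathfrak{s}_n=(\mathfrak{sl}_2\oplus\mathfrak{so}_n)\ltimes\mathfrak{h}_n$ be the complex Schrödinger Lie algebra. Here $\mathfrak{so}_n$ is the Lie algebra of skew-symmetric complex $n\times n$ matrices, $\mathfrak{h}_n=\mathbb{C}^{2n}\oplus\mathbb{C}z$ is the Heisenberg algebra with basis $x_1,\dots,x_n,y_1,\dots,y_n,z$, where $x_i=e_i$ and $y_i=e_{n+i}$ are the standard basis vectors of $\mathbb{C}^{2n}$, with $[x_i,y_j]=\delta_{ij}z$, $[x_i,x_j]=[y_i,y_j]=0$ and $z$ central in $\mathfrak{s}_n$; a matrix $\begin{pmatrix}a&b\\c&-a\end{pmatrix}\in\mathfrak{sl}_2$ acts on $\mathbb{C}^{2n}$ by $\begin{pmatrix}aI_n&bI_n\\cI_n&-aI_n\end{pmatrix}$ and $A\in\mathfrak{so}_n$ acts by $\begin{pmatrix}A&0\\0&A\end{pmatrix}$. Let $e,f,h$ be the standard basis of $\mathfrak{sl}_2$ and let $s_{ij}=E_{ij}-E_{ji}\in\mathfrak{so}_n$. An $\mathfrak{s}_n$-module is a Harish-Chandra module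 if it is the direct sum of its $h$-eigenspaces (weight spaces) and all of these are finite-dimensional. It is a highest (resp. lowest) weight module if it is generated by a nonzero $h$-eigenvector annihilated by $e,x_1,\dots,x_n$ (resp. by $f,y_1,\dots,y_n$). For $\lambda\in\mathbb{C}$ let $L_{\mathfrak{sl}_2}(\lambda)$ be the irreducible highest weight $\mathfrak{sl}_2$-module of highest weight $\lambda$, i.e. the simple quotient of the Verma module. Let $\mathcal{D}_n$ be the Weyl algebra generated by $t_1,\dots,t_n,\partial_1,\dots,\partial_n$. Let $\dot z\in\mathbb{C}$ be nonzero and let $\sqrt{\dot z}$ be either of its square roots. There is a Lie algebra homomorphism $\theta_{\dot z}:\mathfrak{s}_n\to\mathcal{D}_n$ with $$x_i\mapsto\sqrt{\dot z}\,\partial_i,\quad y_i\mapsto\sqrt{\dot z}\,t_i,\quad z\mapsto\dot z,\quad e\mapsto\tfrac12\sum_k\partial_k^2,\quad f\mapsto-\tfrac12\sum_kt_k^2,\quad h\mapsto-\tfrac12\sum_k(\partial_kt_k+t_k\partial_k),\quad s_{ij}\mapsto t_i\partial_j-t_j\partial_i.$$ For an $\mathfrak{so}_n$-module $V$, an $\mathfrak{sl}_2$-module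 $N$ and a $\mathcal{D}_n$-module $L$, let $V\otimes_{\dot z}N\otimes_{\dot z}L$ be the tensor product of the $\mathfrak{s}_n$-modules obtained from $V$, $N$, $L$ through the projections $\mathfrak{s}_n\to\mathfrak{so}_n$, $\mathfrak{s}_n\to\mathfrak{sl}_2$ and through $\theta_{\dot z}$; let $N\otimes_{\dot z}L$ be the same without the factor $V$. The polynomial algebra $\mathbb{C}[t_1,\dots,t_n]$ and, for $n=1$ and $\lambda\in\mathbb{C}$, the space $t_1^{\lambda}\mathbb{C}[t_1^{\pm1}]$ are $\mathcal{D}_n$-modules in the usual way. Let $\tau$ be the Lie algebra automorphism of $\mathfrak{s}_n$ with $\tau(e)=-f$, $\tau(h)=-h$, $\tau(x_i)=-y_i$ and $\tau(s_{ij})=s_{ij}$ for all $i,j$ (hence $\tau(f)=-e$, $\tau(y_i)=x_i$, $\tau(z)=z$), and for an $\mathfrak{s}_n$-module $M$ let $M^\tau$ be the space $M$ on which $u\in\mathfrak{s}_n$ acts as $\tau(u)$ acts on $M$. **Theorem.** Let $M$ be an irreducible Harish-Chandra $\mathfrak{s}_n$-module on which $z$ acts as a nonzero scalar $\dot z$.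 (a) If $e$ acts locally nilpotently on $M$, then $M$ is an irreducible highest weight module, and $$M\cong V\otimes_{\dot z}L_{\mathfrak{sl}_2}(\lambda)\otimes_{\dot z}\mathbb{C}[t_1,\dots,t_n]$$ for some finite-dimensional irreducible $\mathfrak{so}_n$-module $V$ and some $\lambda\in\mathbb{C}$. (b) If $f$ acts locally nilpotently on $M$, then $M$ is an irreducible lowest weight module, and $$M^\tau\cong V\otimes_{\dot z}L_{\mathfrak{sl}_2}(\lambda)\otimes_{\dot z}\mathbb{C}[t_1,\dots,t_n]$$ for some finite-dimensional irreducible $\mathfrak{so}_n$-module $V$ and some $\lambda\in\mathbb{C}$. (c) If both $e$ and $f$ act injectively on $M$, then $n=1$ and $$M\cong L_{\mathfrak{sl}_2}(k)\otimes_{\dot z}t_1^{\lambda}\mathbb{C}[t_1^{\pm1}]$$ for some integer $k\ge0$ and some $\lambda\in\mathbb{C}\setminus\mathbb{Z}$. -/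

import Mathlib

open scoped TensorProduct

noncomputable section

namespace Schrodinger

attribute [local instance] LieRing.ofAssociativeRing

/-! ### The Lie algebras `sl₂`, `soₙ`, the Heisenberg algebra and the Schrödinger algebra -/

/-- `sl₂` over `ℂ`: trace zero `2 × 2` matrices. -/
abbrev Sl2 : Type := LieAlgebra.SpecialLinear.sl (Fin 2) ℂ

/-- `soₙ` over `ℂ`: skew-symmetric `n × n` matrices. -/
abbrev So (n : ℕ) : Type := LieAlgebra.Orthogonal.so (Fin n) ℂ

/-- The standard basis of `sl₂`. -/
def e₂ : Sl2 := ⟨!![0, 1; 0, 0], by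
  simp [LieAlgebra.SpecialLinear.sl, Matrix.trace_fin_two]⟩

def f₂ : Sl2 := ⟨!![0, 0; 1, 0], by
  simp [LieAlgebra.SpecialLinear.sl, Matrix.trace_fin_two]⟩

def h₂ : Sl2 := ⟨!![1, 0; 0, -1], by
  simp [LieAlgebra.SpecialLinear.sl, Matrix.trace_fin_two]⟩

lemma sl2_apply_one_one (X : Sl2) : X.1 1 1 = -X.1 0 0 := by
  have h := X.2
  simp [LieAlgebra.SpecialLinear.sl, Matrix.trace_fin_two] at h
  linear_combination h

lemma so_apply_swap {n : ℕ} (A : So n) (i j : Fin n) : A.1 j i = -A.1 i j := by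
  have h := (LieAlgebra.Orthogonal.mem_so (Fin n) ℂ A.1).1 A.2
  exact congrFun (congrFun h i) j

/-- The Heisenberg Lie algebra `ℂ²ⁿ ⊕ ℂ z`; the element `⟨p, q, c⟩` stands for
`∑ pᵢ xᵢ + ∑ qᵢ yᵢ + c z`, where `xᵢ = eᵢ` and `yᵢ = eₙ₊ᵢ`. -/
@[ext] structure Heis (n : ℕ) where
  /-- coefficients of the `xᵢ` -/
  xc : Fin n → ℂ
  /-- coefficients of the `yᵢ` -/
  yc : Fin n → ℂ
  /-- coefficient of `z` -/
  zc : ℂ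

/-- The underlying vector space of the Heisenberg algebra is `ℂⁿ × ℂⁿ × ℂ`. -/
def Heis.equivProd (n : ℕ) : Heis n ≃ (Fin n → ℂ) × (Fin n → ℂ) × ℂ where
  toFun u := (u.xc, u.yc, u.zc)
  invFun v := ⟨v.1, v.2.1, v.2.2⟩
  left_inv _ := rfl
  right_inv _ := rfl

instance (n : ℕ) : AddCommGroup (Heis n) := (Heis.equivProd n).addCommGroup

instance (n : ℕ) : Module ℂ (Heis n) := (Heis.equivProd n).module ℂ

section
variable {n : ℕ} (u v : Heis n) (c : ℂ)
@[simp] lemma Heis.add_xc : (u + v).xc = u.xc + v.xc := rfl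
@[simp] lemma Heis.add_yc : (u + v).yc = u.yc + v.yc := rfl
@[simp] lemma Heis.add_zc : (u + v).zc = u.zc + v.zc := rfl
@[simp] lemma Heis.sub_xc : (u - v).xc = u.xc - v.xc := rfl
@[simp] lemma Heis.sub_yc : (u - v).yc = u.yc - v.yc := rfl
@[simp] lemma Heis.sub_zc : (u - v).zc = u.zc - v.zc := rfl
@[simp] lemma Heis.neg_xc : (-u).xc = -u.xc := rfl
@[simp] lemma Heis.neg_yc : (-u).yc = -u.yc := rfl
@[simp] lemma Heis.neg_zc : (-u).zc = -u.zc := rfl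
@[simp] lemma Heis.zero_xc : (0 : Heis n).xc = 0 := rfl
@[simp] lemma Heis.zero_yc : (0 : Heis n).yc = 0 := rfl
@[simp] lemma Heis.zero_zc : (0 : Heis n).zc = 0 := rfl
@[simp] lemma Heis.smul_xc : (c • u).xc = c • u.xc := rfl
@[simp] lemma Heis.smul_yc : (c • u).yc = c • u.yc := rfl
@[simp] lemma Heis.smul_zc : (c • u).zc = c * u.zc := rfl
end

instance (n : ℕ) : Bracket (Heis n) (Heis n) where
  bracket u v := ⟨0, 0, u.xc ⬝ᵥ v.yc - u.yc ⬝ᵥ v.xc⟩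

section
variable {n : ℕ} (u v : Heis n)
@[simp] lemma Heis.lie_xc : ⁅u, v⁆.xc = 0 := rfl
@[simp] lemma Heis.lie_yc : ⁅u, v⁆.yc = 0 := rfl
@[simp] lemma Heis.lie_zc : ⁅u, v⁆.zc = u.xc ⬝ᵥ v.yc - u.yc ⬝ᵥ v.xc := rfl
end

instance (n : ℕ) : LieRing (Heis n) where
  add_lie u v w := by ext <;> simp [add_dotProduct]; ring
  lie_add u v w := by ext <;> simp [dotProduct_add]; ring
  lie_self u := by ext <;> simp [dotProduct_comm]
  leibniz_lie u v w := by ext <;> simp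

instance (n : ℕ) : LieAlgebra ℂ (Heis n) where
  lie_smul c u v := by ext <;> simp [dotProduct_smul]; ring

/-- The derivation of the Heisenberg algebra given by the matrix
`[[a Iₙ + A, b Iₙ], [c Iₙ, -a Iₙ + A]]` on `ℂ²ⁿ`, and by zero on `z`. -/
def actDer (n : ℕ) (X : Sl2 × So n) : LieDerivation ℂ (Heis n) (Heis n) where
  toFun u := ⟨X.1.1 0 0 • u.xc + X.1.1 0 1 • u.yc + X.2.1.mulVec u.xc,
    X.1.1 1 0 • u.xc + X.1.1 1 1 • u.yc + X.2.1.mulVec u.yc, 0⟩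
  map_add' u v := by
    ext <;> simp [Matrix.mulVec_add] <;> ring
  map_smul' c u := by
    ext <;> simp [Matrix.mulVec_smul] <;> ring
  leibniz' u v := by
    have key : ∀ p q : Fin n → ℂ, p ⬝ᵥ X.2.1.mulVec q = -(X.2.1.mulVec p ⬝ᵥ q) := by
      intro p q
      have h := (LieAlgebra.Orthogonal.mem_so (Fin n) ℂ X.2.1).1 X.2.2
      rw [Matrix.dotProduct_mulVec, ← Matrix.mulVec_transpose, h, Matrix.neg_mulVec,
        neg_dotProduct]
    have k1 := key u.xc v.yc
    have k2 := key u.yc v.xc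
    have k3 := dotProduct_comm (X.2.1.mulVec u.yc) v.xc
    have k4 := dotProduct_comm (X.2.1.mulVec u.xc) v.yc
    have k5 := dotProduct_comm u.xc v.xc
    have k6 := dotProduct_comm u.xc v.yc
    have k7 := dotProduct_comm u.yc v.xc
    have k8 := dotProduct_comm u.yc v.yc
    ext
    · simp
    · simp
    · simp [dotProduct_add, sl2_apply_one_one]
      rw [k1, k2, ← k3, ← k4, ← k5, ← k6, ← k7, ← k8]
      ring

@[simp] lemma actDer_apply (n : ℕ) (X : Sl2 × So n) (u : Heis n) :
    actDer n X u = ⟨X.1.1 0 0 • u.xc + X.1.1 0 1 • u.yc + X.2.1.mulVec u.xc,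
      X.1.1 1 0 • u.xc + X.1.1 1 1 • u.yc + X.2.1.mulVec u.yc, 0⟩ := rfl

/-- The action of `sl₂ ⊕ soₙ` on the Heisenberg algebra by derivations. -/
def act (n : ℕ) : (Sl2 × So n) →ₗ⁅ℂ⁆ LieDerivation ℂ (Heis n) (Heis n) where
  toFun := actDer n
  map_add' X Y := by
    ext u <;> simp [Matrix.add_mulVec] <;> ring
  map_smul' c X := by
    ext u <;> simp [Matrix.smul_mulVec] <;> ring
  map_lie' := by
    intro X Y
    ext u <;>
      simp [Ring.lie_def, Matrix.sub_mulVec,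
        Matrix.mulVec_add, Matrix.mulVec_smul, Matrix.mul_apply, Fin.sum_univ_two,
        ← Matrix.mulVec_mulVec] <;> ring

/-- The Schrödinger Lie algebra `𝔰ₙ = (sl₂ ⊕ soₙ) ⋉ 𝔥ₙ`. -/
abbrev Sch (n : ℕ) : Type := LieAlgebra.SemiDirectSum (Heis n) (Sl2 × So n) (act n)

/-- The elements `x_k, y_k, z, e, f, h` of `𝔰ₙ`. -/
def xS {n : ℕ} (k : Fin n) : Sch n := ⟨⟨Pi.single k 1, 0, 0⟩, 0⟩

def yS {n : ℕ} (k : Fin n) : Sch n := ⟨⟨0, Pi.single k 1, 0⟩, 0⟩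

def zS (n : ℕ) : Sch n := ⟨⟨0, 0, 1⟩, 0⟩

def eS (n : ℕ) : Sch n := ⟨0, (e₂, 0)⟩

def fS (n : ℕ) : Sch n := ⟨0, (f₂, 0)⟩

def hS (n : ℕ) : Sch n := ⟨0, (h₂, 0)⟩

/-- The projections of `𝔰ₙ` onto `sl₂` and `soₙ`. -/
def toSl2 (n : ℕ) : Sch n →ₗ⁅ℂ⁆ Sl2 :=
  (LieHom.fst ℂ Sl2 (So n)).comp (LieAlgebra.SemiDirectSum.projr (act n))

def toSo (n : ℕ) : Sch n →ₗ⁅ℂ⁆ So n :=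
  (LieHom.snd ℂ Sl2 (So n)).comp (LieAlgebra.SemiDirectSum.projr (act n))

/-! ### The Weyl algebra and the differential operator realization -/

/-- The defining relations of the Weyl algebra; `Sum.inl i` is `tᵢ` and `Sum.inr i` is `∂ᵢ`. -/
inductive WeylRel (n : ℕ) :
    FreeAlgebra ℂ (Fin n ⊕ Fin n) → FreeAlgebra ℂ (Fin n ⊕ Fin n) → Prop
  | tt (i j : Fin n) : WeylRel n
      (FreeAlgebra.ι ℂ (Sum.inl i) * FreeAlgebra.ι ℂ (Sum.inl j))
      (FreeAlgebra.ι ℂ (Sum.inl j) * FreeAlgebra.ι ℂ (Sum.inl i))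
  | dd (i j : Fin n) : WeylRel n
      (FreeAlgebra.ι ℂ (Sum.inr i) * FreeAlgebra.ι ℂ (Sum.inr j))
      (FreeAlgebra.ι ℂ (Sum.inr j) * FreeAlgebra.ι ℂ (Sum.inr i))
  | dt (i j : Fin n) : WeylRel n
      (FreeAlgebra.ι ℂ (Sum.inr i) * FreeAlgebra.ι ℂ (Sum.inl j) -
        FreeAlgebra.ι ℂ (Sum.inl j) * FreeAlgebra.ι ℂ (Sum.inr i))
      (if i = j then 1 else 0)

/-- The Weyl algebra of rank `n`. -/
def Weyl (n : ℕ) : Type := RingQuot (WeylRel n)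

instance (n : ℕ) : Ring (Weyl n) := inferInstanceAs (Ring (RingQuot (WeylRel n)))

instance (n : ℕ) : Algebra ℂ (Weyl n) := inferInstanceAs (Algebra ℂ (RingQuot (WeylRel n)))

/-- The quotient map from the free algebra. -/
def Weyl.mk (n : ℕ) : FreeAlgebra ℂ (Fin n ⊕ Fin n) →ₐ[ℂ] Weyl n :=
  RingQuot.mkAlgHom ℂ (WeylRel n)

lemma Weyl.mk_rel {n : ℕ} {a b : FreeAlgebra ℂ (Fin n ⊕ Fin n)} (h : WeylRel n a b) :
    Weyl.mk n a = Weyl.mk n b :=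
  RingQuot.mkAlgHom_rel ℂ h

/-- The generator `tᵢ`. -/
def Weyl.t {n : ℕ} (i : Fin n) : Weyl n :=
  Weyl.mk n (FreeAlgebra.ι ℂ (Sum.inl i))

/-- The generator `∂ᵢ`. -/
def Weyl.d {n : ℕ} (i : Fin n) : Weyl n :=
  Weyl.mk n (FreeAlgebra.ι ℂ (Sum.inr i))

lemma Weyl.lie_tt {n : ℕ} (i j : Fin n) : ⁅(Weyl.t i : Weyl n), (Weyl.t j : Weyl n)⁆ = 0 := by
  have h := Weyl.mk_rel (WeylRel.tt i j)
  rw [map_mul, map_mul] at h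
  rw [Ring.lie_def, sub_eq_zero]
  exact h

lemma Weyl.lie_dd {n : ℕ} (i j : Fin n) : ⁅(Weyl.d i : Weyl n), (Weyl.d j : Weyl n)⁆ = 0 := by
  have h := Weyl.mk_rel (WeylRel.dd i j)
  rw [map_mul, map_mul] at h
  rw [Ring.lie_def, sub_eq_zero]
  exact h

lemma Weyl.lie_dt {n : ℕ} (i j : Fin n) :
    ⁅(Weyl.d i : Weyl n), (Weyl.t j : Weyl n)⁆ = if i = j then 1 else 0 := by
  have h := Weyl.mk_rel (WeylRel.dt i j)
  rw [map_sub, map_mul, map_mul] at h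
  rw [Ring.lie_def]
  refine Eq.trans h ?_
  split_ifs <;> simp

lemma Weyl.lie_td {n : ℕ} (i j : Fin n) :
    ⁅(Weyl.t i : Weyl n), (Weyl.d j : Weyl n)⁆ = if i = j then -1 else 0 := by
  rw [← lie_skew, Weyl.lie_dt]
  by_cases h : i = j
  · simp [h]
  · simp [h, Ne.symm h]

/-- Modules over the Weyl algebra are given by `n` pairs of operators satisfying its relations. -/
def Weyl.lift {n : ℕ} {L : Type*} [AddCommGroup L] [Module ℂ L]
    (T D : Fin n → Module.End ℂ L)
    (htt : ∀ i j, T i * T j = T j * T i) (hdd : ∀ i j, D i * D j = D j * D i)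
    (hdt : ∀ i j, D i * T j - T j * D i = if i = j then 1 else 0) :
    Weyl n →ₐ[ℂ] Module.End ℂ L :=
  RingQuot.liftAlgHom ℂ ⟨FreeAlgebra.lift ℂ (Sum.elim T D), by
    intro a b hab
    cases hab with
    | tt i j => simpa using htt i j
    | dd i j => simpa using hdd i j
    | dt i j =>
      simp only [map_sub, map_mul, FreeAlgebra.lift_ι_apply, Sum.elim_inl, Sum.elim_inr, hdt]
      split_ifs <;> simp⟩

@[simp] lemma Weyl.lift_t {n : ℕ} {L : Type*} [AddCommGroup L] [Module ℂ L]
    (T D : Fin n → Module.End ℂ L) (htt hdd hdt) (i : Fin n) :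
    Weyl.lift T D htt hdd hdt (Weyl.t i) = T i := by
  refine (RingQuot.liftAlgHom_mkAlgHom_apply _ _ _ _).trans ?_
  simp

@[simp] lemma Weyl.lift_d {n : ℕ} {L : Type*} [AddCommGroup L] [Module ℂ L]
    (T D : Fin n → Module.End ℂ L) (htt hdd hdt) (i : Fin n) :
    Weyl.lift T D htt hdd hdt (Weyl.d i) = D i := by
  refine (RingQuot.liftAlgHom_mkAlgHom_apply _ _ _ _).trans ?_
  simp

/-- `ẽ = ½ ∑ ∂ₖ²` -/
def eW (n : ℕ) : Weyl n := (1 / 2 : ℂ) • ∑ k, Weyl.d k * Weyl.d k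

/-- `f̃ = -½ ∑ tₖ²` -/
def fW (n : ℕ) : Weyl n := (-1 / 2 : ℂ) • ∑ k, Weyl.t k * Weyl.t k

/-- `h̃ = -½ ∑ (∂ₖ tₖ + tₖ ∂ₖ)` -/
def hW (n : ℕ) : Weyl n := (-1 / 2 : ℂ) • ∑ k, (Weyl.d k * Weyl.t k + Weyl.t k * Weyl.d k)

/-- For a skew-symmetric matrix `A`, the operator `∑ᵢⱼ Aᵢⱼ tᵢ ∂ⱼ = ∑_{i<j} Aᵢⱼ (tᵢ ∂ⱼ - tⱼ ∂ᵢ)`. -/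
def sW {n : ℕ} (A : Matrix (Fin n) (Fin n) ℂ) : Weyl n :=
  ∑ i, ∑ j, A i j • (Weyl.t i * Weyl.d j)

/-- The image of `sl₂ ⊕ soₙ` in the Weyl algebra. -/
def qW {n : ℕ} (X : Sl2 × So n) : Weyl n :=
  X.1.1 0 0 • hW n + X.1.1 0 1 • eW n + X.1.1 1 0 • fW n + sW X.2.1

/-- The image of `∑ pᵢ xᵢ + ∑ qᵢ yᵢ + c z`, where `r` is the chosen square root of the central
charge: `xᵢ ↦ r ∂ᵢ`, `yᵢ ↦ r tᵢ`, `z ↦ r²`. -/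
def uW {n : ℕ} (r : ℂ) (u : Heis n) : Weyl n :=
  r • ∑ i, u.xc i • Weyl.d i + r • ∑ i, u.yc i • Weyl.t i + (u.zc * r ^ 2) • (1 : Weyl n)

section WeylLemmas
variable {n : ℕ}

lemma mul_lie' {R : Type*} [Ring R] (a b c : R) : ⁅a * b, c⁆ = a * ⁅b, c⁆ + ⁅a, c⁆ * b := by
  simp only [Ring.lie_def]; noncomm_ring

lemma lie_mul' {R : Type*} [Ring R] (a b c : R) : ⁅a, b * c⁆ = ⁅a, b⁆ * c + b * ⁅a, c⁆ := by
  simp only [Ring.lie_def]; noncomm_ring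

lemma lie_q_d (X : Sl2 × So n) (k : Fin n) :
    ⁅qW X, (Weyl.d k : Weyl n)⁆ = X.1.1 0 0 • Weyl.d k + X.1.1 1 0 • Weyl.t k +
      ∑ i, X.2.1 i k • Weyl.d i := by
  have h1 : ⁅hW n, (Weyl.d k : Weyl n)⁆ = Weyl.d k := by
    simp [hW, sum_lie, mul_lie', Weyl.lie_dd, Weyl.lie_td, Finset.sum_add_distrib]
    module
  have h2 : ⁅eW n, (Weyl.d k : Weyl n)⁆ = 0 := by
    simp [eW, sum_lie, mul_lie', Weyl.lie_dd]
  have h3 : ⁅fW n, (Weyl.d k : Weyl n)⁆ = Weyl.t k := by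
    simp [fW, sum_lie, mul_lie', Weyl.lie_td, Finset.sum_add_distrib]
    module
  have h4 : ⁅sW X.2.1, (Weyl.d k : Weyl n)⁆ = ∑ i, X.2.1 i k • Weyl.d i := by
    simp [sW, sum_lie, mul_lie', Weyl.lie_dd, Weyl.lie_td]
    simp [so_apply_swap X.2 k]
  simp [qW, h1, h2, h3, h4]

lemma lie_q_t (X : Sl2 × So n) (k : Fin n) :
    ⁅qW X, (Weyl.t k : Weyl n)⁆ = X.1.1 0 1 • Weyl.d k - X.1.1 0 0 • Weyl.t k +
      ∑ i, X.2.1 i k • Weyl.t i := by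
  have h1 : ⁅hW n, (Weyl.t k : Weyl n)⁆ = -Weyl.t k := by
    simp [hW, sum_lie, mul_lie', Weyl.lie_tt, Weyl.lie_dt, Finset.sum_add_distrib]
    module
  have h2 : ⁅eW n, (Weyl.t k : Weyl n)⁆ = Weyl.d k := by
    simp [eW, sum_lie, mul_lie', Weyl.lie_dt, Finset.sum_add_distrib]
    module
  have h3 : ⁅fW n, (Weyl.t k : Weyl n)⁆ = 0 := by
    simp [fW, sum_lie, mul_lie', Weyl.lie_tt]
  have h4 : ⁅sW X.2.1, (Weyl.t k : Weyl n)⁆ = ∑ i, X.2.1 i k • Weyl.t i := by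
    simp [sW, sum_lie, mul_lie', Weyl.lie_tt, Weyl.lie_dt]
  simp [qW, h1, h2, h3, h4]
  module

/-- A skew matrix contracted with a symmetric family vanishes. -/
lemma skew_sum {R : Type*} [AddCommGroup R] [Module ℂ R] (A : So n) (g : Fin n → Fin n → R)
    (hg : ∀ i j, g i j = g j i) : ∑ i, ∑ j, A.1 i j • g i j = 0 := by
  have h : ∑ i, ∑ j, A.1 i j • g i j = -∑ i, ∑ j, A.1 i j • g i j := by
    conv_lhs => rw [Finset.sum_comm]
    simp only [← Finset.sum_neg_distrib]
    refine Finset.sum_congr rfl fun i _ => Finset.sum_congr rfl fun j _ => ?_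
    rw [so_apply_swap A i j, hg j i, neg_smul]
  have h2 : (2 : ℂ) • ∑ i, ∑ j, A.1 i j • g i j = 0 := by
    rw [two_smul]
    nth_rewrite 1 [h]
    exact neg_add_cancel _
  exact (smul_eq_zero.1 h2).resolve_left two_ne_zero

lemma lie_q_e (X : Sl2 × So n) :
    ⁅qW X, eW n⁆ = (2 * X.1.1 0 0) • eW n - X.1.1 1 0 • hW n := by
  have h := skew_sum X.2 (fun i k => (Weyl.d i : Weyl n) * Weyl.d k + Weyl.d k * Weyl.d i)
    (fun i j => add_comm _ _)
  rw [Finset.sum_comm] at h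
  have key : ∀ k : Fin n, ⁅qW X, (Weyl.d k : Weyl n) * Weyl.d k⁆ =
      (2 * X.1.1 0 0) • (Weyl.d k * Weyl.d k) +
      X.1.1 1 0 • (Weyl.d k * Weyl.t k + Weyl.t k * Weyl.d k) +
      ∑ i, X.2.1 i k • ((Weyl.d i : Weyl n) * Weyl.d k + Weyl.d k * Weyl.d i) := by
    intro k
    simp only [lie_mul', lie_q_d, add_mul, mul_add, Finset.sum_mul, Finset.mul_sum,
      smul_mul_assoc, mul_smul_comm, smul_add, Finset.sum_add_distrib]
    module
  simp only [eW, hW, lie_smul, lie_sum, key]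
  rw [Finset.sum_add_distrib, Finset.sum_add_distrib, h, ← Finset.smul_sum, ← Finset.smul_sum]
  module

lemma lie_q_f (X : Sl2 × So n) :
    ⁅qW X, fW n⁆ = X.1.1 0 1 • hW n - (2 * X.1.1 0 0) • fW n := by
  have h := skew_sum X.2 (fun i k => (Weyl.t i : Weyl n) * Weyl.t k + Weyl.t k * Weyl.t i)
    (fun i j => add_comm _ _)
  rw [Finset.sum_comm] at h
  have key : ∀ k : Fin n, ⁅qW X, (Weyl.t k : Weyl n) * Weyl.t k⁆ =
      (-(2 * X.1.1 0 0)) • (Weyl.t k * Weyl.t k) +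
      X.1.1 0 1 • (Weyl.d k * Weyl.t k + Weyl.t k * Weyl.d k) +
      ∑ i, X.2.1 i k • ((Weyl.t i : Weyl n) * Weyl.t k + Weyl.t k * Weyl.t i) := by
    intro k
    simp only [lie_mul', lie_q_t, add_mul, mul_add, sub_mul, mul_sub, Finset.sum_mul,
      Finset.mul_sum, smul_mul_assoc, mul_smul_comm, smul_add, Finset.sum_add_distrib]
    module
  simp only [fW, hW, lie_smul, lie_sum, key]
  rw [Finset.sum_add_distrib, Finset.sum_add_distrib, h, ← Finset.smul_sum, ← Finset.smul_sum]
  module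

lemma lie_q_h (X : Sl2 × So n) :
    ⁅qW X, hW n⁆ = (2 * X.1.1 1 0) • fW n - (2 * X.1.1 0 1) • eW n := by
  have h := skew_sum X.2 (fun i k => (Weyl.d i : Weyl n) * Weyl.t k + Weyl.d k * Weyl.t i +
    (Weyl.t i * Weyl.d k + Weyl.t k * Weyl.d i)) (fun i j => by abel)
  rw [Finset.sum_comm] at h
  have key : ∀ k : Fin n, ⁅qW X, (Weyl.d k : Weyl n) * Weyl.t k + Weyl.t k * Weyl.d k⁆ =
      (2 * X.1.1 1 0) • (Weyl.t k * Weyl.t k) +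
      (2 * X.1.1 0 1) • (Weyl.d k * Weyl.d k) +
      ∑ i, X.2.1 i k • ((Weyl.d i : Weyl n) * Weyl.t k + Weyl.d k * Weyl.t i +
        (Weyl.t i * Weyl.d k + Weyl.t k * Weyl.d i)) := by
    intro k
    simp only [lie_add, lie_mul', lie_q_t, lie_q_d, add_mul, mul_add, sub_mul, mul_sub,
      Finset.sum_mul, Finset.mul_sum, smul_mul_assoc, mul_smul_comm, smul_add,
      Finset.sum_add_distrib]
    module
  simp only [eW, fW, hW, lie_smul, lie_sum, key]
  rw [Finset.sum_add_distrib, Finset.sum_add_distrib, h, ← Finset.smul_sum, ← Finset.smul_sum]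
  module

lemma lie_q_s (X : Sl2 × So n) (B : So n) :
    ⁅qW X, sW B.1⁆ = sW (X.2.1 * B.1 - B.1 * X.2.1) := by
  have h1 := skew_sum B (fun k l => (Weyl.d k : Weyl n) * Weyl.d l)
    (fun i j => by simpa [Ring.lie_def, sub_eq_zero] using Weyl.lie_dd i j)
  have h2 := skew_sum B (fun k l => (Weyl.t k : Weyl n) * Weyl.t l)
    (fun i j => by simpa [Ring.lie_def, sub_eq_zero] using Weyl.lie_tt i j)
  have key : ∀ k l : Fin n, ⁅qW X, B.1 k l • ((Weyl.t k : Weyl n) * Weyl.d l)⁆ =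
      X.1.1 0 1 • (B.1 k l • (Weyl.d k * Weyl.d l)) +
      X.1.1 1 0 • (B.1 k l • (Weyl.t k * Weyl.t l)) +
      (∑ i, (X.2.1 i k * B.1 k l) • ((Weyl.t i : Weyl n) * Weyl.d l) -
        ∑ i, (B.1 k l * X.2.1 l i) • ((Weyl.t k : Weyl n) * Weyl.d i)) := by
    intro k l
    have hd : ⁅qW X, (Weyl.d l : Weyl n)⁆ = X.1.1 0 0 • Weyl.d l + X.1.1 1 0 • Weyl.t l -
        ∑ i, X.2.1 l i • Weyl.d i := by
      rw [lie_q_d, sub_eq_add_neg, ← Finset.sum_neg_distrib]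
      simp only [so_apply_swap X.2 l, neg_smul]
    have e1 : ∑ i, (X.2.1 i k * B.1 k l) • ((Weyl.t i : Weyl n) * Weyl.d l) =
        B.1 k l • ((∑ i, X.2.1 i k • Weyl.t i) * Weyl.d l) := by
      simp only [Finset.sum_mul, Finset.smul_sum, smul_mul_assoc, smul_smul, mul_comm (B.1 k l)]
    have e2 : ∑ i, (B.1 k l * X.2.1 l i) • ((Weyl.t k : Weyl n) * Weyl.d i) =
        B.1 k l • (Weyl.t k * ∑ i, X.2.1 l i • Weyl.d i) := by
      simp only [Finset.mul_sum, Finset.smul_sum, mul_smul_comm, smul_smul]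
    rw [e1, e2, lie_smul, lie_mul', lie_q_t, hd]
    simp only [add_mul, mul_add, sub_mul, mul_sub, smul_mul_assoc, mul_smul_comm]
    module
  have h3 : ∑ k, ∑ l, ∑ i, (X.2.1 i k * B.1 k l) • ((Weyl.t i : Weyl n) * Weyl.d l) =
      sW (X.2.1 * B.1) := by
    simp only [sW, Matrix.mul_apply, Finset.sum_smul]
    rw [Finset.sum_comm]
    conv_lhs => enter [2, l]; rw [Finset.sum_comm]
    rw [Finset.sum_comm]
  have h4 : ∑ k, ∑ l, ∑ i, (B.1 k l * X.2.1 l i) • ((Weyl.t k : Weyl n) * Weyl.d i) =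
      sW (B.1 * X.2.1) := by
    simp only [sW, Matrix.mul_apply, Finset.sum_smul]
    conv_lhs => enter [2, k]; rw [Finset.sum_comm]
  have h5 : sW (X.2.1 * B.1 - B.1 * X.2.1) = sW (X.2.1 * B.1) - sW (B.1 * X.2.1) := by
    simp only [sW, Matrix.sub_apply, sub_smul, Finset.sum_sub_distrib]
  rw [h5, ← h3, ← h4]
  nth_rewrite 1 [sW]
  simp only [lie_sum, key, Finset.sum_add_distrib, Finset.sum_sub_distrib, ← Finset.smul_sum,
    h1, h2]
  simp

lemma qW_add (X Y : Sl2 × So n) : qW (X + Y) = qW X + qW Y := by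
  have h1 : (X + Y).1.1 = X.1.1 + Y.1.1 := rfl
  have h2 : (X + Y).2.1 = X.2.1 + Y.2.1 := rfl
  simp only [qW, sW, h1, h2, Matrix.add_apply, add_smul, Finset.sum_add_distrib]
  abel

lemma qW_smul (c : ℂ) (X : Sl2 × So n) : qW (c • X) = c • qW X := by
  simp [qW, sW, smul_smul, Finset.smul_sum]

lemma uW_add (r : ℂ) (u v : Heis n) : uW r (u + v) = uW r u + uW r v := by
  simp only [uW, Heis.add_xc, Heis.add_yc, Heis.add_zc, Pi.add_apply, add_smul, add_mul,
    Finset.sum_add_distrib, smul_add]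
  abel

lemma uW_smul (r c : ℂ) (u : Heis n) : uW r (c • u) = c • uW r u := by
  simp only [uW, Heis.smul_xc, Heis.smul_yc, Heis.smul_zc, Pi.smul_apply, smul_eq_mul, smul_add,
    smul_smul, Finset.smul_sum]
  simp only [mul_left_comm, mul_assoc]

lemma lie_q_q (X Y : Sl2 × So n) : ⁅qW X, qW Y⁆ = qW ⁅X, Y⁆ := by
  have h : ⁅qW X, qW Y⁆ = Y.1.1 0 0 • ⁅qW X, hW n⁆ + Y.1.1 0 1 • ⁅qW X, eW n⁆ +
      Y.1.1 1 0 • ⁅qW X, fW n⁆ + ⁅qW X, sW Y.2.1⁆ := by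
    nth_rewrite 2 [qW]
    simp only [lie_add, lie_smul]
  have h' : qW ⁅X, Y⁆ = (X.1.1 0 1 * Y.1.1 1 0 - Y.1.1 0 1 * X.1.1 1 0) • hW n +
      (2 * X.1.1 0 0 * Y.1.1 0 1 - 2 * Y.1.1 0 0 * X.1.1 0 1) • eW n +
      (2 * X.1.1 1 0 * Y.1.1 0 0 - 2 * Y.1.1 1 0 * X.1.1 0 0) • fW n +
      sW (X.2.1 * Y.2.1 - Y.2.1 * X.2.1) := by
    simp only [qW, LieAlgebra.Prod.bracket_apply, LieSubalgebra.coe_bracket, Ring.lie_def,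
      Matrix.sub_apply, Matrix.mul_apply, Fin.sum_univ_two, sl2_apply_one_one]
    congr 1
    module
  rw [h, h', lie_q_h, lie_q_e, lie_q_f, lie_q_s]
  module

lemma lie_u_d (r : ℂ) (u : Heis n) (k : Fin n) :
    ⁅uW r u, (Weyl.d k : Weyl n)⁆ = -(r * u.yc k) • (1 : Weyl n) := by
  have h1 : ⁅(1 : Weyl n), (Weyl.d k : Weyl n)⁆ = 0 := by simp [Ring.lie_def]
  simp [uW, sum_lie, Weyl.lie_dd, Weyl.lie_td, h1, smul_smul]

lemma lie_u_t (r : ℂ) (u : Heis n) (k : Fin n) :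
    ⁅uW r u, (Weyl.t k : Weyl n)⁆ = (r * u.xc k) • (1 : Weyl n) := by
  have h1 : ⁅(1 : Weyl n), (Weyl.t k : Weyl n)⁆ = 0 := by simp [Ring.lie_def]
  simp [uW, sum_lie, Weyl.lie_tt, Weyl.lie_dt, h1, smul_smul]

lemma lie_u_u (r : ℂ) (u v : Heis n) : ⁅uW r u, uW r v⁆ = uW r ⁅u, v⁆ := by
  have h1 : ⁅uW r u, (1 : Weyl n)⁆ = 0 := by simp [Ring.lie_def]
  have h2 : ⁅uW r u, uW r v⁆ = r • ∑ i, v.xc i • (-(r * u.yc i) • (1 : Weyl n)) +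
      r • ∑ i, v.yc i • ((r * u.xc i) • (1 : Weyl n)) := by
    nth_rewrite 2 [uW]
    simp only [lie_add, lie_smul, lie_sum, lie_u_d, lie_u_t, h1, smul_zero, add_zero]
  rw [h2]
  simp only [uW, Heis.lie_xc, Heis.lie_yc, Heis.lie_zc, dotProduct, Pi.zero_apply, zero_smul,
    Finset.sum_const_zero, smul_zero, zero_add, smul_smul, ← Finset.sum_smul, ← add_smul]
  congr 1
  simp only [Finset.mul_sum, Finset.sum_mul, sub_mul, ← Finset.sum_add_distrib,
    ← Finset.sum_sub_distrib]
  refine Finset.sum_congr rfl fun i _ => ?_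
  ring

lemma lie_q_u (r : ℂ) (X : Sl2 × So n) (u : Heis n) :
    ⁅qW X, uW r u⁆ = uW r (act n X u) := by
  have h1 : ⁅qW X, (1 : Weyl n)⁆ = 0 := by simp [Ring.lie_def]
  have h2 : act n X u = actDer n X u := rfl
  have h3 : ∀ (p : Fin n → ℂ) (w : Fin n → Weyl n),
      ∑ k, p k • ∑ i, X.2.1 i k • w i = ∑ i, (X.2.1.mulVec p) i • w i := by
    intro p w
    simp only [Matrix.mulVec, dotProduct, Finset.smul_sum, Finset.sum_smul, smul_smul]
    rw [Finset.sum_comm]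
    simp only [mul_comm]
  have h4 := h3 u.xc Weyl.d
  have h5 := h3 u.yc Weyl.t
  rw [h2, actDer_apply]
  simp only [uW, lie_add, lie_smul, lie_sum, lie_q_d, lie_q_t, h1, smul_zero, add_zero,
    smul_add, smul_sub, Finset.sum_add_distrib, Finset.sum_sub_distrib, h4, h5,
    Pi.add_apply, Pi.smul_apply, smul_eq_mul, add_smul, zero_mul, zero_smul,
    sl2_apply_one_one, mul_smul, neg_smul, Pi.neg_apply, Finset.sum_neg_distrib,
    smul_comm (u.xc _), smul_comm (u.yc _), ← Finset.smul_sum]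
  module

end WeylLemmas

/-- The Lie algebra homomorphism `𝔰ₙ → 𝒟ₙ` underlying the algebra homomorphism
`U(𝔰ₙ)/⟨z - r²⟩ → 𝒟ₙ`. -/
def theta (n : ℕ) (r : ℂ) : Sch n →ₗ⁅ℂ⁆ Weyl n where
  toFun x := uW r x.left + qW x.right
  map_add' x y := by
    rw [LieAlgebra.SemiDirectSum.add_eq_mk, uW_add, qW_add]
    abel
  map_smul' c x := by
    rw [LieAlgebra.SemiDirectSum.smul_eq_mk, uW_smul, qW_smul, RingHom.id_apply, smul_add]
  map_lie' := by
    intro x y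
    have h : ⁅uW r x.left, qW y.right⁆ = -uW r (act n y.right x.left) := by
      rw [← lie_skew, lie_q_u]
    have h' : uW r (-act n y.right x.left) = -uW r (act n y.right x.left) := by
      rw [← neg_one_smul ℂ, uW_smul, neg_one_smul]
    simp only [LieAlgebra.SemiDirectSum.lie_eq_mk, add_lie, lie_add, h, lie_q_u, lie_u_u,
      lie_q_q, sub_eq_add_neg, uW_add, h']
    abel

/-! ### Modules -/

/-- The `L'`-module obtained from an `L`-module `M` by restriction along `φ : L' → L`. -/
def Restr {L' L : Type*} [LieRing L'] [LieAlgebra ℂ L'] [LieRing L] [LieAlgebra ℂ L]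
    (_φ : L' →ₗ⁅ℂ⁆ L) (M : Type*) : Type _ := M

section Restr
variable {L' L : Type*} [LieRing L'] [LieAlgebra ℂ L'] [LieRing L] [LieAlgebra ℂ L]
  (φ : L' →ₗ⁅ℂ⁆ L) (M : Type*) [AddCommGroup M] [Module ℂ M] [LieRingModule L M]

instance : AddCommGroup (Restr φ M) := inferInstanceAs (AddCommGroup M)

instance : Module ℂ (Restr φ M) := inferInstanceAs (Module ℂ M)

instance : LieRingModule L' (Restr φ M) := LieRingModule.compLieHom M φ

instance [LieModule ℂ L M] : LieModule ℂ L' (Restr φ M) := LieModule.compLieHom M φ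

/-- Restriction does not change the underlying vector space. -/
def Restr.equiv : Restr φ M ≃ₗ[ℂ] M := LinearEquiv.refl ℂ M

lemma Restr.equiv_lie (x : L') (m : Restr φ M) :
    Restr.equiv φ M ⁅x, m⁆ = ⁅φ x, Restr.equiv φ M m⁆ := rfl

end Restr

/-- The `𝔰ₙ`-module obtained from a `𝒟ₙ`-module `L` through `θ`. -/
abbrev WeylRestr {n : ℕ} (r : ℂ) {L : Type*} [AddCommGroup L] [Module ℂ L]
    (ρ : Weyl n →ₐ[ℂ] Module.End ℂ L) : Type _ :=
  Restr ((ρ : Weyl n →ₗ⁅ℂ⁆ Module.End ℂ L).comp (theta n r)) L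

/-- The `𝔰ₙ`-module `N ⊗ L` for an `sl₂`-module `N` and a `𝒟ₙ`-module `L`. -/
abbrev Tensor₂ {n : ℕ} (r : ℂ) (N : Type*) [AddCommGroup N] [Module ℂ N] [LieRingModule Sl2 N]
    {L : Type*} [AddCommGroup L] [Module ℂ L] (ρ : Weyl n →ₐ[ℂ] Module.End ℂ L) : Type _ :=
  Restr (toSl2 n) N ⊗[ℂ] WeylRestr r ρ

/-- The `𝔰ₙ`-module `V ⊗ N ⊗ L` for an `soₙ`-module `V`, an `sl₂`-module `N` and a
`𝒟ₙ`-module `L`: the tensor product of the restrictions of `V`, `N`, `L` along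
`𝔰ₙ → soₙ`, `𝔰ₙ → sl₂` and `θ : 𝔰ₙ → 𝒟ₙ`. -/
abbrev Tensor₃ {n : ℕ} (r : ℂ) (V : Type*) [AddCommGroup V] [Module ℂ V] [LieRingModule (So n) V]
    (N : Type*) [AddCommGroup N] [Module ℂ N] [LieRingModule Sl2 N]
    {L : Type*} [AddCommGroup L] [Module ℂ L] (ρ : Weyl n →ₐ[ℂ] Module.End ℂ L) : Type _ :=
  Restr (toSo n) V ⊗[ℂ] Tensor₂ r N ρ

/-- The `𝒟ₙ`-module `ℂ[t₁, …, tₙ]`. -/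
def polyRep (n : ℕ) : Weyl n →ₐ[ℂ] Module.End ℂ (MvPolynomial (Fin n) ℂ) :=
  Weyl.lift (fun i => LinearMap.mulLeft ℂ (MvPolynomial.X i))
    (fun i => (MvPolynomial.pderiv i).toLinearMap)
    (fun i j => by
      refine LinearMap.ext fun p => ?_
      simp only [Module.End.mul_apply, LinearMap.mulLeft_apply]
      ring)
    (fun i j => by
      have h : ⁅(MvPolynomial.pderiv i :
            Derivation ℂ (MvPolynomial (Fin n) ℂ) (MvPolynomial (Fin n) ℂ)),
          (MvPolynomial.pderiv j :
            Derivation ℂ (MvPolynomial (Fin n) ℂ) (MvPolynomial (Fin n) ℂ))⁆ = 0 := by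
        refine MvPolynomial.derivation_ext fun k => ?_
        simp only [Derivation.commutator_apply, MvPolynomial.pderiv_X, Derivation.zero_apply]
        have h1 : ∀ a b : Fin n, MvPolynomial.pderiv (R := ℂ) a
            (Pi.single (M := fun _ => MvPolynomial (Fin n) ℂ) b 1 k) = 0 := by
          intro a b
          by_cases hb : k = b
          · subst hb; simp
          · simp [Pi.single_eq_of_ne hb]
        rw [h1, h1, sub_zero]
      refine LinearMap.ext fun p => ?_
      have h2 := DFunLike.congr_fun h p
      rw [Derivation.commutator_apply, Derivation.zero_apply, sub_eq_zero] at h2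
      exact h2)
    (fun i j => by
      refine LinearMap.ext fun p => ?_
      by_cases h : i = j
      · subst h
        simp
      · simp [h, MvPolynomial.pderiv_X_of_ne (Ne.symm h)])

/-- Multiplication by `tᵢ` on `t₁^{μ₁} ⋯ tₙ^{μₙ} ℂ[t₁^{±1}, …, tₙ^{±1}]`; the basis vector indexed
by `m : Fin n → ℤ` stands for the monomial `∏ tⱼ ^ (μⱼ + mⱼ)`. -/
def laurentT {n : ℕ} (i : Fin n) : Module.End ℂ ((Fin n → ℤ) →₀ ℂ) :=
  Finsupp.lsum ℂ fun m => Finsupp.lsingle (m + Pi.single i 1)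

/-- The operator `∂ᵢ` on `t₁^{μ₁} ⋯ tₙ^{μₙ} ℂ[t₁^{±1}, …, tₙ^{±1}]`. -/
def laurentD {n : ℕ} (μ : Fin n → ℂ) (i : Fin n) : Module.End ℂ ((Fin n → ℤ) →₀ ℂ) :=
  Finsupp.lsum ℂ fun m => (μ i + m i) • Finsupp.lsingle (m - Pi.single i 1)

lemma laurentT_single {n : ℕ} (i : Fin n) (m : Fin n → ℤ) (c : ℂ) :
    laurentT i (Finsupp.single m c) = Finsupp.single (m + Pi.single i 1) c := by
  simp [laurentT, Finsupp.lsum_single]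

lemma laurentD_single {n : ℕ} (μ : Fin n → ℂ) (i : Fin n) (m : Fin n → ℤ) (c : ℂ) :
    laurentD μ i (Finsupp.single m c) =
      Finsupp.single (m - Pi.single i 1) ((μ i + m i) * c) := by
  rw [laurentD, Finsupp.lsum_single, LinearMap.smul_apply, Finsupp.lsingle_apply,
    Finsupp.smul_single, smul_eq_mul]

/-- The `𝒟ₙ`-module `t₁^{μ₁} ⋯ tₙ^{μₙ} ℂ[t₁^{±1}, …, tₙ^{±1}]`. -/
def laurentRep (n : ℕ) (μ : Fin n → ℂ) : Weyl n →ₐ[ℂ] Module.End ℂ ((Fin n → ℤ) →₀ ℂ) :=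
  Weyl.lift laurentT (laurentD μ)
    (fun i j => by
      refine Finsupp.lhom_ext fun m c => ?_
      rw [Module.End.mul_apply, Module.End.mul_apply]
      simp only [laurentT_single]
      rw [add_right_comm])
    (fun i j => by
      refine Finsupp.lhom_ext fun m c => ?_
      by_cases h : i = j
      · subst h; rfl
      · rw [Module.End.mul_apply, Module.End.mul_apply]
        simp only [laurentD_single]
        simp only [Pi.sub_apply, Pi.single_eq_of_ne h, Pi.single_eq_of_ne (Ne.symm h), sub_zero]
        rw [sub_right_comm, mul_left_comm])
    (fun i j => by
      refine Finsupp.lhom_ext fun m c => ?_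
      rw [LinearMap.sub_apply, Module.End.mul_apply, Module.End.mul_apply]
      simp only [laurentD_single, laurentT_single]
      have h1 : m + Pi.single j 1 - Pi.single i 1 = m - Pi.single i 1 + Pi.single j 1 := by
        abel
      rw [h1, ← Finsupp.single_sub]
      by_cases h : i = j
      · subst h
        simp only [Pi.add_apply, Pi.single_eq_same, sub_add_cancel, if_true, Module.End.one_apply]
        congr 1
        push_cast
        ring
      · simp [h])

/-- The operator of `X` on the Verma module of highest weight `l`, in the basis `vₖ = fᵏ v₀`. -/
def vermaOp (l : ℂ) (X : Sl2) : Module.End ℂ (ℕ →₀ ℂ) :=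
  Finsupp.lsum ℂ fun k =>
    (X.1 0 0 * (l - 2 * k)) • Finsupp.lsingle k +
    (X.1 0 1 * (k * (l - k + 1))) • Finsupp.lsingle (k - 1) +
    X.1 1 0 • Finsupp.lsingle (k + 1)

lemma vermaOp_single (l : ℂ) (X : Sl2) (k : ℕ) (c : ℂ) :
    vermaOp l X (Finsupp.single k c) =
      (X.1 0 0 * (l - 2 * k)) • Finsupp.single k c +
      (X.1 0 1 * (k * (l - k + 1))) • Finsupp.single (k - 1) c +
      X.1 1 0 • Finsupp.single (k + 1) c := by
  rw [vermaOp, Finsupp.lsum_single]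
  rfl

/-- The action of `sl₂` on the Verma module of highest weight `l`, in the basis `vₖ = fᵏ v₀`:
`h vₖ = (l - 2k) vₖ`, `e vₖ = k (l - k + 1) vₖ₋₁`, `f vₖ = vₖ₊₁`. -/
def vermaRep (l : ℂ) : Sl2 →ₗ⁅ℂ⁆ Module.End ℂ (ℕ →₀ ℂ) where
  toFun := vermaOp l
  map_add' X Y := by
    refine Finsupp.lhom_ext fun k c => ?_
    have h : (X + Y).1 = X.1 + Y.1 := rfl
    simp only [vermaOp_single, h, Matrix.add_apply, LinearMap.add_apply, add_mul, add_smul]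
    abel
  map_smul' a X := by
    refine Finsupp.lhom_ext fun k c => ?_
    have h : (a • X).1 = a • X.1 := rfl
    simp only [vermaOp_single, h, Matrix.smul_apply, LinearMap.smul_apply, smul_eq_mul,
      mul_assoc, mul_smul, smul_add, RingHom.id_apply]
  map_lie' := by
    intro X Y
    refine Finsupp.lhom_ext fun k c => ?_
    have h : ⁅X, Y⁆.1 = X.1 * Y.1 - Y.1 * X.1 := rfl
    rw [Ring.lie_def, LinearMap.sub_apply, Module.End.mul_apply, Module.End.mul_apply]
    rcases k with _ | _ | k <;>
    · simp only [vermaOp_single, map_add, map_smul, h, Matrix.sub_apply, Matrix.mul_apply,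
        Fin.sum_univ_two, sl2_apply_one_one, Nat.add_sub_cancel, Nat.zero_sub, zero_add]
      push_cast
      module

/-- The Verma module over `sl₂` of highest weight `l`. -/
abbrev Verma (l : ℂ) : Type := Restr (vermaRep l) (ℕ →₀ ℂ)

/-- The sum of all proper submodules of the Verma module, its unique maximal submodule. -/
def vermaMax (l : ℂ) : LieSubmodule ℂ Sl2 (Verma l) := sSup {N | N ≠ ⊤}

/-- The irreducible highest weight `sl₂`-module of highest weight `l`. -/
abbrev LSl2 (l : ℂ) : Type := Verma l ⧸ vermaMax l

/-! ### Weight modules over the Schrödinger algebra -/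

section Weight
variable (n : ℕ) (M : Type*) [AddCommGroup M] [Module ℂ M] [LieRingModule (Sch n) M]
  [LieModule ℂ (Sch n) M]

/-- The weight space `{v | h v = μ v}`. -/
def weightSpace (μ : ℂ) : Submodule ℂ M := (LieModule.toEnd ℂ (Sch n) M (hS n)).eigenspace μ

/-- Harish-Chandra modules: `M` is the direct sum of its weight spaces, all of which are
finite-dimensional. -/
structure IsHarishChandra : Prop where
  isInternal : DirectSum.IsInternal (weightSpace n M)
  finite : ∀ μ, FiniteDimensional ℂ (weightSpace n M μ)

/-- `𝔰ₙ⁺ = span {e, xᵢ}` and `𝔰ₙ⁻ = span {f, yᵢ}`. -/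
def sPos : Submodule ℂ (Sch n) := Submodule.span ℂ (insert (eS n) (Set.range xS))

def sNeg : Submodule ℂ (Sch n) := Submodule.span ℂ (insert (fS n) (Set.range yS))

/-- `M` is generated by a highest weight vector. -/
def IsHighestWeight : Prop :=
  ∃ (μ : ℂ) (v : M), v ∈ weightSpace n M μ ∧ v ≠ 0 ∧ (∀ x ∈ sPos n, ⁅x, v⁆ = 0) ∧
    LieSubmodule.lieSpan ℂ (Sch n) {v} = ⊤

/-- `M` is generated by a lowest weight vector. -/
def IsLowestWeight : Prop :=
  ∃ (μ : ℂ) (v : M), v ∈ weightSpace n M μ ∧ v ≠ 0 ∧ (∀ x ∈ sNeg n, ⁅x, v⁆ = 0) ∧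
    LieSubmodule.lieSpan ℂ (Sch n) {v} = ⊤

variable {n} in
/-- `x` acts locally nilpotently on `M`. -/
def ActsLocNilp (x : Sch n) : Prop :=
  ∀ v : M, ∃ k : ℕ, (LieModule.toEnd ℂ (Sch n) M x ^ k) v = 0

variable {n} in
/-- `x` acts injectively on `M`. -/
def ActsInj (x : Sch n) : Prop := Function.Injective fun v : M => ⁅x, v⁆

end Weight

/-! ### The automorphism `τ` -/

/-- Negative transpose on `sl₂`. -/
def negT (X : Sl2) : Sl2 := ⟨-X.1.transpose, by
  have h := X.2
  simp [LieAlgebra.SpecialLinear.sl, Matrix.trace_fin_two] at h ⊢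
  linear_combination h⟩

lemma negT_val (X : Sl2) : (negT X).1 = -X.1.transpose := rfl

/-- The Lie algebra automorphism `τ` of `𝔰ₙ` given by `xᵢ ↦ -yᵢ`, `yᵢ ↦ xᵢ`, `z ↦ z`,
`X ↦ -Xᵀ` for `X ∈ sl₂` (so `e ↦ -f`, `f ↦ -e`, `h ↦ -h`) and `A ↦ A` for `A ∈ soₙ`. -/
def tau (n : ℕ) : Sch n ≃ₗ⁅ℂ⁆ Sch n where
  toFun w := ⟨⟨w.left.yc, -w.left.xc, w.left.zc⟩, (negT w.right.1, w.right.2)⟩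
  invFun w := ⟨⟨-w.left.yc, w.left.xc, w.left.zc⟩, (negT w.right.1, w.right.2)⟩
  left_inv w := by
    refine LieAlgebra.SemiDirectSum.ext ?_ (Prod.ext (Subtype.ext ?_) rfl)
    · ext <;> simp
    · simp [negT_val]
  right_inv w := by
    refine LieAlgebra.SemiDirectSum.ext ?_ (Prod.ext (Subtype.ext ?_) rfl)
    · ext <;> simp
    · simp [negT_val]
  map_add' v w := by
    refine LieAlgebra.SemiDirectSum.ext ?_ (Prod.ext (Subtype.ext ?_) rfl)
    · ext <;> simp [add_comm]
    · simp [negT_val, add_comm]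
  map_smul' c w := by
    refine LieAlgebra.SemiDirectSum.ext ?_ (Prod.ext (Subtype.ext ?_) rfl)
    · ext <;> simp
    · simp [negT_val]
  map_lie' := by
    intro v w
    have hact : ∀ (X : Sl2 × So n) (u : Heis n), act n X u = actDer n X u := fun _ _ => rfl
    refine LieAlgebra.SemiDirectSum.ext ?_ (Prod.ext (Subtype.ext ?_) rfl)
    · ext
      · simp [hact, negT_val, sl2_apply_one_one]; ring
      · simp [hact, negT_val, sl2_apply_one_one, Matrix.mulVec_neg]; ring
      · simp [hact, dotProduct_comm]; ring
    · simp [negT_val, Ring.lie_def, Matrix.transpose_mul]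

section TauLemmas
variable (n : ℕ) (i : Fin n) (A : So n)

lemma tau_apply (w : Sch n) : tau n w =
    ⟨⟨w.left.yc, -w.left.xc, w.left.zc⟩, (negT w.right.1, w.right.2)⟩ := rfl

lemma tau_eS : tau n (eS n) = -fS n := by
  refine LieAlgebra.SemiDirectSum.ext ?_ (Prod.ext (Subtype.ext ?_) ?_)
  · ext <;> simp [tau_apply, eS, fS]
  · ext i j; fin_cases i <;> fin_cases j <;> simp [tau_apply, eS, fS, negT_val, e₂, f₂]
  · simp [tau_apply, eS, fS]

lemma tau_hS : tau n (hS n) = -hS n := by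
  refine LieAlgebra.SemiDirectSum.ext ?_ (Prod.ext (Subtype.ext ?_) ?_)
  · ext <;> simp [tau_apply, hS]
  · ext i j; fin_cases i <;> fin_cases j <;> simp [tau_apply, hS, negT_val, h₂]
  · simp [tau_apply, hS]

lemma tau_xS : tau n (xS i) = -yS i := by
  refine LieAlgebra.SemiDirectSum.ext ?_ (Prod.ext (Subtype.ext ?_) ?_)
  · ext <;> simp [tau_apply, xS, yS]
  · ext i j; simp [tau_apply, xS, yS, negT_val]
  · simp [tau_apply, xS, yS]

lemma tau_so : tau n ⟨0, (0, A)⟩ = ⟨0, (0, A)⟩ := by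
  refine LieAlgebra.SemiDirectSum.ext ?_ (Prod.ext (Subtype.ext ?_) rfl)
  · ext <;> simp [tau_apply]
  · ext i j; simp [tau_apply, negT_val]

end TauLemmas

end Schrodinger

end

open Schrodinger

noncomputable section

namespace Schrodinger

attribute [local instance] LieRing.ofAssociativeRing

/-! ### Linear algebra -/

section LinearAlgebra
variable {W : Type*} [AddCommGroup W] [Module ℂ W]

/-! Since `z` acts by `r² ≠ 0`, the operators `r⁻¹ yᵢ` and `r⁻¹ xᵢ` satisfy the relations of `tᵢ`
and `∂ᵢ`, so the Weyl algebra acts on `M` (`weylOn`). Composing with `theta` gives a second action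
of `𝔰ₙ` on `M`, which agrees with the given one on the Heisenberg ideal. The difference of the two
(`residual`) therefore vanishes on that ideal, commutes with the Weyl algebra and is again a Lie
homomorphism. Hence the action is the sum of three mutually commuting pieces, `sl2Res`, `soRes` and
the Weyl algebra part (`op_eq'`), which is the form of the action on a triple tensor product. What
remains is to factor the space itself.

The factoring is formal (`IsSplitting.exists_equiv`). Let `P` be a Weyl module generated by one
vector, and let `W` be a space of vectors of `M` behaving like that generator, stable under the
commuting pieces. Evaluation `W ⊗ P → M` is injective because the basis vectors of `P` have distinct
systems of eigenvalues under the operators `tᵢ ∂ᵢ`; it is surjective by irreducibility. Then `W` is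
irreducible under `sl₂` and `soₙ`. If `W` contains an `sl₂` highest weight vector of weight `l`, the
same kind of argument splits it as (highest weight space) `⊗ L(l)` (`exists_tensor_irr`), with the
first factor irreducible over `soₙ`.

If `e` is locally nilpotent, finite-dimensionality of weight spaces bounds the weights of vectors
killed by `e` along a string, and moving up by the `xᵢ` must stop at a vector killed by `e` and all
`xᵢ` (`exists_vacuum`). This gives `P = ℂ[t₁, …, tₙ]`, with `W` the common kernel of the `∂ᵢ`. The
case of `f` follows by twisting with `τ`.

If `e` and `f` are injective, so are all `∂ᵢ` and `tᵢ`: a kernel would make such an operator locally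
nilpotent and some weight space too large (`false_of_locNilp_of_injective`). For `i ≠ j` the
injective operator `tᵢ ∂ⱼ` preserves weights but shifts the eigenvalues of `tᵢ ∂ᵢ`, which is
impossible in a finite-dimensional weight space, so `n = 1`. Then `t` is invertible, `W` is an
eigenspace of `t ∂`, and `P` is a Laurent module. A similar count of eigenvalues shows that the
residual `e` and `f` are nilpotent on the vectors needed, so the `sl₂` factor is some `L(k)` with
`k` a natural number. -/

/-- If a subspace stable under a family of operators contains a sum of joint eigenvectors with
pairwise distinct systems of eigenvalues, then it contains each summand. -/
lemma mem_of_sum_mem {ι J : Type*} (φ : ι → Module.End ℂ W) (χ : J → ι → ℂ)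
    (hχ : Function.Injective χ) (N : Submodule ℂ W) (hN : ∀ i, ∀ w ∈ N, φ i w ∈ N)
    (s : Finset J) : ∀ u : J → W, (∀ j ∈ s, ∀ i, φ i (u j) = χ j i • u j) →
      ∑ j ∈ s, u j ∈ N → ∀ j ∈ s, u j ∈ N := by
  classical
  induction s using Finset.induction_on with
  | empty => simp
  | insert a s ha ih =>
    intro u hu hsum
    have key : ∀ j ∈ s, u j ∈ N := by
      intro j hj
      have hne : χ j ≠ χ a := fun h => ha (hχ h ▸ hj)
      obtain ⟨i, hi⟩ := Function.ne_iff.1 hne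
      -- Applying `φ i - χ a i` kills the summand at `a` and rescales the others, the one at `j` by
      -- a nonzero factor.
      have h1 := ih (fun k => (χ k i - χ a i) • u k)
        (fun k hk i' => by
          rw [map_smul, hu k (Finset.mem_insert_of_mem hk) i', smul_comm])
        (by
          have h2 := N.sub_mem (hN i _ hsum) (N.smul_mem (χ a i) hsum)
          rw [Finset.sum_insert ha, map_add, smul_add,
            hu a (Finset.mem_insert_self a s) i, add_sub_add_left_eq_sub, map_sum,
            Finset.smul_sum, ← Finset.sum_sub_distrib] at h2
          convert h2 using 2 with k hk
          rw [hu k (Finset.mem_insert_of_mem hk) i, sub_smul]) j hj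
      exact (N.smul_mem_iff (sub_ne_zero.2 hi)).1 h1
    intro j hj
    rcases Finset.mem_insert.1 hj with rfl | hj
    · rw [Finset.sum_insert ha] at hsum
      exact (N.add_mem_iff_left (N.sum_mem key)).1 hsum
    · exact key j hj

/-- A locally nilpotent operator is nilpotent on every finite-dimensional subspace. -/
lemma exists_pow_eq_zero_of_finite (A : Module.End ℂ W) (hA : ∀ w, ∃ k : ℕ, (A ^ k) w = 0)
    (U : Submodule ℂ W) [FiniteDimensional ℂ U] : ∃ N : ℕ, ∀ k ≥ N, ∀ w ∈ U, (A ^ k) w = 0 := by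
  have hmono : Monotone fun k : ℕ => LinearMap.ker (A ^ k) := by
    intro i j hij w hw
    obtain ⟨d, rfl⟩ := Nat.exists_eq_add_of_le hij
    rw [LinearMap.mem_ker] at hw ⊢
    rw [add_comm, pow_add, Module.End.mul_apply, hw, map_zero]
  obtain ⟨S, hS⟩ := (Module.Finite.iff_fg.1 ‹_› : U.FG)
  choose f hf using hA
  refine ⟨S.sup f, fun k hk w hw => ?_⟩
  have : U ≤ LinearMap.ker (A ^ k) := by
    rw [← hS, Submodule.span_le]
    intro s hs
    exact hmono ((Finset.le_sup (f := f) hs).trans hk) (hf s)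
  exact this hw

/-- If `[A, B] = c B`, then powers of `B` shift eigenvalues of `A` by multiples of `c`. -/
lemma apply_pow_of_commutator {A B : Module.End ℂ W} {c : ℂ} (h : A * B - B * A = c • B) {l : ℂ}
    {v : W} (hv : A v = l • v) (k : ℕ) : A ((B ^ k) v) = (l + k * c) • (B ^ k) v := by
  induction k with
  | zero => simpa using hv
  | succ k ih =>
    have := LinearMap.congr_fun h ((B ^ k) v)
    simp only [LinearMap.sub_apply, Module.End.mul_apply, ih, LinearMap.smul_apply, map_smul,
      sub_eq_iff_eq_add] at this
    rw [pow_succ', Module.End.mul_apply, this, ← add_smul]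
    congr 1
    push_cast
    ring

/-- If `[D, T] = c` and `D w = 0`, then `Dᵐ Tᵐ w = cᵐ m! w`. -/
lemma pow_pow_apply_of_commutator_eq (D T : Module.End ℂ W) (c : ℂ)
    (h : D * T - T * D = c • 1) (w : W) (hw : D w = 0) (m : ℕ) :
    (D ^ m) ((T ^ m) w) = (c ^ m * m.factorial) • w := by
  have h1 : ∀ k : ℕ, D ((T ^ (k + 1)) w) = (c * (k + 1)) • (T ^ k) w := by
    intro k
    induction k with
    | zero =>
      have := LinearMap.congr_fun h w
      simp [hw] at this
      simp [this]
    | succ k ih =>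
      have := LinearMap.congr_fun h ((T ^ (k + 1)) w)
      simp only [LinearMap.sub_apply, Module.End.mul_apply, ih, LinearMap.smul_apply,
        Module.End.one_apply, map_smul, sub_eq_iff_eq_add] at this
      rw [pow_succ' T (k + 1), Module.End.mul_apply, this, ← Module.End.mul_apply, ← pow_succ',
        ← add_smul]
      congr 1
      push_cast
      ring
  induction m with
  | zero => simp
  | succ m ih =>
    rw [pow_succ D, Module.End.mul_apply, h1, map_smul, ih, smul_smul, Nat.factorial_succ]
    congr 1
    push_cast
    ring

end LinearAlgebra

/-! ### Highest weight theory for operators satisfying the `sl₂` relations -/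

section Sl2Ops
variable {W : Type*} [AddCommGroup W] [Module ℂ W]

/-- Triples of operators satisfying the relations of `sl₂`. -/
structure IsSl2Ops (E F H : Module.End ℂ W) : Prop where
  ef : E * F - F * E = H
  he : H * E - E * H = (2 : ℂ) • E
  hf : H * F - F * H = (-2 : ℂ) • F

namespace IsSl2Ops
variable {E F H : Module.End ℂ W} (t : IsSl2Ops E F H)
include t

lemma h_f_pow {l : ℂ} {v : W} (hv : H v = l • v) (k : ℕ) :
    H ((F ^ k) v) = (l - 2 * k) • (F ^ k) v := by
  rw [apply_pow_of_commutator t.hf hv]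
  congr 1
  ring

lemma e_f_pow_succ {l : ℂ} {v : W} (hv : H v = l • v) (he : E v = 0) (k : ℕ) :
    E ((F ^ (k + 1)) v) = ((k + 1) * (l - k)) • (F ^ k) v := by
  induction k with
  | zero =>
    have := LinearMap.congr_fun t.ef v
    simp [hv, he] at this
    simp [this]
  | succ k ih =>
    have := LinearMap.congr_fun t.ef ((F ^ (k + 1)) v)
    simp only [LinearMap.sub_apply, Module.End.mul_apply, ih, t.h_f_pow hv, map_smul,
      sub_eq_iff_eq_add] at this
    rw [pow_succ' F (k + 1), Module.End.mul_apply, this, ← Module.End.mul_apply, ← pow_succ',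
      ← add_smul]
    congr 1
    push_cast
    ring

lemma e_f_pow {l : ℂ} {v : W} (hv : H v = l • v) (he : E v = 0) (k : ℕ) :
    E ((F ^ k) v) = (k * (l - k + 1)) • (F ^ (k - 1)) v := by
  cases k with
  | zero => simp [he]
  | succ k =>
    rw [t.e_f_pow_succ hv he, Nat.add_sub_cancel]
    congr 1
    push_cast
    ring

lemma e_pow_f_pow {l : ℂ} {v : W} (hv : H v = l • v) (he : E v = 0) (k : ℕ) :
    (E ^ k) ((F ^ k) v) = (∏ j ∈ Finset.range k, ((j + 1) * (l - j))) • v := by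
  induction k with
  | zero => simp
  | succ k ih =>
    rw [pow_succ E, Module.End.mul_apply, t.e_f_pow_succ hv he, map_smul, ih, smul_smul,
      Finset.prod_range_succ, mul_comm]

end IsSl2Ops

/-- The operators `∑ pₖ Fᵏ`. -/
def powOp (F : Module.End ℂ W) : (ℕ →₀ ℂ) →ₗ[ℂ] Module.End ℂ W :=
  Finsupp.linearCombination ℂ fun k => F ^ k

lemma powOp_single (F : Module.End ℂ W) (k : ℕ) (c : ℂ) :
    powOp F (Finsupp.single k c) = c • F ^ k := by
  simp [powOp]

lemma sl2_eq (X : Sl2) : X = X.1 0 0 • h₂ + X.1 0 1 • e₂ + X.1 1 0 • f₂ := by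
  refine Subtype.ext ?_
  ext i j
  have := sl2_apply_one_one X
  fin_cases i <;> fin_cases j <;> simp [h₂, e₂, f₂, this]

lemma isSl2Ops_of_lieHom (κ : Sl2 →ₗ⁅ℂ⁆ Module.End ℂ W) : IsSl2Ops (κ e₂) (κ f₂) (κ h₂) where
  ef := by
    rw [← Ring.lie_def, ← LieHom.map_lie]
    congr 1
    refine Subtype.ext ?_
    ext i j
    fin_cases i <;> fin_cases j <;> simp [h₂, e₂, f₂, Ring.lie_def]
  he := by
    rw [← Ring.lie_def, ← LieHom.map_lie, ← map_smul]
    congr 1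
    refine Subtype.ext ?_
    ext i j
    fin_cases i <;> fin_cases j <;> simp [h₂, e₂, Ring.lie_def]; norm_num
  hf := by
    rw [← Ring.lie_def, ← LieHom.map_lie, ← map_smul]
    congr 1
    refine Subtype.ext ?_
    ext i j
    fin_cases i <;> fin_cases j <;> simp [h₂, f₂, Ring.lie_def]; norm_num

/-- The space of highest weight vectors of weight `l`. -/
def hwSpace (κ : Sl2 →ₗ⁅ℂ⁆ Module.End ℂ W) (l : ℂ) : Submodule ℂ W :=
  LinearMap.ker (κ e₂) ⊓ (κ h₂).eigenspace l

lemma mem_hwSpace {κ : Sl2 →ₗ⁅ℂ⁆ Module.End ℂ W} {l : ℂ} {v : W} :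
    v ∈ hwSpace κ l ↔ κ e₂ v = 0 ∧ κ h₂ v = l • v := by
  simp [hwSpace]

/-- This is the universal property of the Verma module: a highest weight vector satisfies the
relations from which `vermaOp` was read off, so `p ↦ ∑ pₖ Fᵏ v` is equivariant. -/
lemma lieHom_powOp {κ : Sl2 →ₗ⁅ℂ⁆ Module.End ℂ W} {l : ℂ} {v : W} (hv : v ∈ hwSpace κ l)
    (X : Sl2) (p : ℕ →₀ ℂ) :
    κ X (powOp (κ f₂) p v) = powOp (κ f₂) (vermaOp l X p) v := by
  have t := isSl2Ops_of_lieHom κ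
  obtain ⟨he, hh⟩ := mem_hwSpace.1 hv
  induction p using Finsupp.induction_linear with
  | zero => simp
  | add p q hp hq => simp only [map_add, LinearMap.add_apply, hp, hq]
  | single k c =>
    conv_lhs => rw [sl2_eq X]
    simp only [powOp_single, vermaOp_single, map_add, map_smul, LinearMap.add_apply,
      LinearMap.smul_apply, t.h_f_pow hh, t.e_f_pow hh he]
    rw [← Module.End.mul_apply (κ f₂), ← pow_succ']
    module

end Sl2Ops

/-! ### The maximal submodule of a Verma module -/

lemma verma_lie_h_single (l : ℂ) (k : ℕ) (c : ℂ) :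
    vermaOp l h₂ (Finsupp.single k c) = (l - 2 * k) • Finsupp.single k c := by
  rw [vermaOp_single]; simp [h₂]

lemma verma_lie_f_single (l : ℂ) (k : ℕ) (c : ℂ) :
    vermaOp l f₂ (Finsupp.single k c) = Finsupp.single (k + 1) c := by
  rw [vermaOp_single]; simp [f₂]

lemma two_mul_sub_injective (l : ℂ) :
    Function.Injective fun (k : ℕ) (_ : Unit) => l - 2 * (k : ℂ) := by
  intro a b h
  have := congrFun h ()
  simpa using this

/-- If some element had a nonzero `v₀`-coefficient, separating its weight components would put `v₀`
itself into `N`, and the powers of `f` would then generate everything. -/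
lemma apply_zero_eq_zero_of_mem {l : ℂ} (N : LieSubmodule ℂ Sl2 (Verma l)) (hN : N ≠ ⊤)
    {p : Verma l} (hp : p ∈ N) : Restr.equiv (vermaRep l) (ℕ →₀ ℂ) p 0 = 0 := by
  by_contra hp0
  set q : ℕ →₀ ℂ := Restr.equiv (vermaRep l) (ℕ →₀ ℂ) p with hq
  let N' : Submodule ℂ (ℕ →₀ ℂ) :=
    N.toSubmodule.comap (Restr.equiv (vermaRep l) (ℕ →₀ ℂ)).symm.toLinearMap
  have hstab : ∀ X : Sl2, ∀ w ∈ N', vermaOp l X w ∈ N' := fun X w hw => N.lie_mem (x := X) hw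
  have hqN : q.sum Finsupp.single ∈ N' := by rw [Finsupp.sum_single]; exact hp
  have h0 := mem_of_sum_mem (fun _ : Unit => vermaOp l h₂) (fun (k : ℕ) _ => l - 2 * (k : ℂ))
    (two_mul_sub_injective l) N' (fun _ => hstab h₂) q.support (fun k => Finsupp.single k (q k))
    (fun k _ _ => verma_lie_h_single l k _) hqN 0 (Finsupp.mem_support_iff.2 hp0)
  have h1 : ∀ k : ℕ, ∀ c : ℂ, Finsupp.single k c ∈ N' := by
    intro k
    induction k with
    | zero =>
      intro c
      have := N'.smul_mem (c / q 0) h0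
      rwa [Finsupp.smul_single, smul_eq_mul, div_mul_cancel₀ _ hp0] at this
    | succ k ih => exact fun c => verma_lie_f_single l k c ▸ hstab f₂ _ (ih c)
  refine hN (eq_top_iff.2 fun x _ => ?_)
  have hx : (Restr.equiv (vermaRep l) (ℕ →₀ ℂ) x).sum Finsupp.single ∈ N' :=
    N'.sum_mem fun k _ => h1 k _
  rwa [Finsupp.sum_single] at hx

/-- The `v₀`-coefficient is linear, so its kernel contains the sum of all proper submodules. This is
why that sum is still proper. -/
lemma apply_zero_of_mem_vermaMax {l : ℂ} {p : Verma l} (hp : p ∈ vermaMax l) :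
    Restr.equiv (vermaRep l) (ℕ →₀ ℂ) p 0 = 0 := by
  have h : (vermaMax l).toSubmodule ≤ LinearMap.ker ((Finsupp.lapply 0).comp
      (Restr.equiv (vermaRep l) (ℕ →₀ ℂ)).toLinearMap) := by
    rw [vermaMax, LieSubmodule.sSup_toSubmodule, sSup_le_iff]
    rintro _ ⟨N, hN, rfl⟩ x hx
    exact apply_zero_eq_zero_of_mem N hN hx
  exact h hp

/-- A subspace of the Verma module stable under `sl₂` and not containing `v₀` is contained in the
maximal submodule. -/
lemma mem_vermaMax_of_stable {l : ℂ} (N : Submodule ℂ (ℕ →₀ ℂ))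
    (hN : ∀ X, ∀ p ∈ N, vermaOp l X p ∈ N) (h0 : Finsupp.single 0 1 ∉ N) {p : ℕ →₀ ℂ}
    (hp : p ∈ N) : (Restr.equiv (vermaRep l) (ℕ →₀ ℂ)).symm p ∈ vermaMax l := by
  let N' : LieSubmodule ℂ Sl2 (Verma l) :=
    { N.comap (Restr.equiv (vermaRep l) (ℕ →₀ ℂ)).toLinearMap with
      lie_mem := fun {X w} hw => hN X _ hw }
  have : N' ≤ vermaMax l := le_sSup (by
    intro h
    exact h0 (show (Restr.equiv (vermaRep l) (ℕ →₀ ℂ)).symm (Finsupp.single 0 1) ∈ N' by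
      rw [h]; trivial))
  exact this hp

/-! ### Irreducible modules over `sl₂` and a commuting family of operators -/

section HighestWeight
variable {W S : Type*} [AddCommGroup W] [Module ℂ W] (κ : Sl2 →ₗ⁅ℂ⁆ Module.End ℂ W)
  (s : S → Module.End ℂ W)

/-- The operators `κ X` and `s A` have no common invariant subspaces. -/
def JointlyIrreducible {G S : Type*} (κ : G → Module.End ℂ W) (s : S → Module.End ℂ W) : Prop :=
  ∀ N : Submodule ℂ W, (∀ X, ∀ w ∈ N, κ X w ∈ N) → (∀ A, ∀ w ∈ N, s A w ∈ N) → N = ⊥ ∨ N = ⊤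

lemma map_powOp_single_mem {l : ℂ} {v : W} (hv : v ∈ hwSpace κ l) {k : ℕ} (hk : k ≠ 0) (c : ℂ) :
    powOp (κ f₂) (Finsupp.single k c) v ∈ ⨆ j ≠ l, (κ h₂).eigenspace j := by
  have h1 : l - 2 * (k : ℂ) ≠ l := by simpa using hk
  refine (le_iSup₂_of_le (f := fun j (_ : j ≠ l) => (κ h₂).eigenspace j) (l - 2 * (k : ℂ)) h1
    le_rfl) ?_
  rw [Module.End.mem_eigenspace_iff, powOp_single, LinearMap.smul_apply, map_smul,
    (isSl2Ops_of_lieHom κ).h_f_pow (mem_hwSpace.1 hv).2, smul_comm]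

/-- All terms with `k > 0` have weight `l - 2k ≠ l`. Together with the independence of eigenspaces
this reads off the component of weight `l`. -/
lemma map_powOp_sub_mem {l : ℂ} {v : W} (hv : v ∈ hwSpace κ l) (p : ℕ →₀ ℂ) :
    powOp (κ f₂) p v - p 0 • v ∈ ⨆ j ≠ l, (κ h₂).eigenspace j := by
  induction p using Finsupp.induction_linear with
  | zero => simp
  | add p q hp hq =>
    convert add_mem hp hq using 1
    simp only [map_add, LinearMap.add_apply, Finsupp.add_apply]
    module
  | single k c =>
    rcases eq_or_ne k 0 with rfl | hk
    · simp [powOp_single]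
    · simpa [Finsupp.single_eq_of_ne hk.symm] using map_powOp_single_mem κ hv hk c

lemma eq_zero_of_mem_hwSpace {l : ℂ} {v : W} (hv : v ∈ hwSpace κ l)
    (h : v ∈ ⨆ j ≠ l, (κ h₂).eigenspace j) : v = 0 :=
  Submodule.disjoint_def.1 ((Module.End.eigenspaces_iSupIndep (κ h₂)) l) v hv.2 h

variable {κ s}

/-- The submodule generated by a set of highest weight vectors which is stable under the commuting
operators is everything. -/
lemma span_powOp_eq_top (hcomm : ∀ X A, κ X * s A = s A * κ X) (hirr : JointlyIrreducible κ s)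
    {l : ℂ} (V : Submodule ℂ W) (hV : V ≤ hwSpace κ l) (hVs : ∀ A, ∀ v ∈ V, s A v ∈ V)
    (Q : Submodule ℂ (ℕ →₀ ℂ)) (hQ : ∀ X, ∀ p ∈ Q, vermaOp l X p ∈ Q) :
    (∀ p ∈ Q, ∀ v ∈ V, powOp (κ f₂) p v = 0) ∨
      Submodule.span ℂ {w | ∃ p ∈ Q, ∃ v ∈ V, powOp (κ f₂) p v = w} = ⊤ := by
  have hs : ∀ A p, s A * powOp (κ f₂) p = powOp (κ f₂) p * s A := by
    intro A p
    induction p using Finsupp.induction_linear with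
    | zero => simp
    | add p q hp hq => rw [map_add, mul_add, add_mul, hp, hq]
    | single k c =>
      rw [powOp_single, mul_smul_comm, smul_mul_assoc]
      congr 1
      exact (Commute.pow_left (hcomm f₂ A) k).eq.symm
  refine (hirr (Submodule.span ℂ {w | ∃ p ∈ Q, ∃ v ∈ V, powOp (κ f₂) p v = w}) ?_ ?_).symm.elim
    Or.inr fun h => Or.inl ?_
  rotate_left 2
  · intro p hp v hv
    have : powOp (κ f₂) p v ∈ (⊥ : Submodule ℂ W) :=
      h ▸ Submodule.subset_span ⟨p, hp, v, hv, rfl⟩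
    simpa using this
  · intro X w hw
    refine Submodule.span_induction ?_ (by simp) (fun a b _ _ ha hb => ?_)
      (fun c a _ ha => ?_) hw
    · rintro _ ⟨p, hp, v, hv, rfl⟩
      rw [lieHom_powOp (hV hv)]
      exact Submodule.subset_span ⟨_, hQ X p hp, v, hv, rfl⟩
    · rw [map_add]; exact add_mem ha hb
    · rw [map_smul]; exact Submodule.smul_mem _ c ha
  · intro A w hw
    refine Submodule.span_induction ?_ (by simp) (fun a b _ _ ha hb => ?_)
      (fun c a _ ha => ?_) hw
    · rintro _ ⟨p, hp, v, hv, rfl⟩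
      rw [← Module.End.mul_apply, hs, Module.End.mul_apply]
      exact Submodule.subset_span ⟨p, hp, _, hVs A v hv, rfl⟩
    · rw [map_add]; exact add_mem ha hb
    · rw [map_smul]; exact Submodule.smul_mem _ c ha

lemma map_mem_hwSpace (hcomm : ∀ X A, κ X * s A = s A * κ X) {l : ℂ} (A : S) {v : W}
    (hv : v ∈ hwSpace κ l) : s A v ∈ hwSpace κ l := by
  obtain ⟨h1, h2⟩ := mem_hwSpace.1 hv
  rw [mem_hwSpace, ← Module.End.mul_apply, ← Module.End.mul_apply, hcomm, hcomm,
    Module.End.mul_apply, Module.End.mul_apply, h1, h2]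
  simp

/-- The space of highest weight vectors is irreducible under the commuting operators. -/
lemma hwSpace_irreducible (hcomm : ∀ X A, κ X * s A = s A * κ X)
    (hirr : JointlyIrreducible κ s) {l : ℂ} (V : Submodule ℂ W) (hV : V ≤ hwSpace κ l)
    (hVs : ∀ A, ∀ v ∈ V, s A v ∈ V) : V = ⊥ ∨ V = hwSpace κ l := by
  rcases span_powOp_eq_top hcomm hirr V hV hVs ⊤ (fun _ _ _ => trivial) with h | h
  · left
    rw [eq_bot_iff]
    intro v hv
    simpa [powOp_single] using h (Finsupp.single 0 1) trivial v hv
  · right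
    refine le_antisymm hV fun v hv => ?_
    -- The submodule generated by `V` is `V` in weight `l` plus other weights; as it is everything,
    -- no highest weight vector of weight `l` lies outside `V`.
    have h1 : Submodule.span ℂ {w | ∃ p ∈ (⊤ : Submodule ℂ (ℕ →₀ ℂ)), ∃ v ∈ V,
        powOp (κ f₂) p v = w} ≤ V ⊔ ⨆ j ≠ l, (κ h₂).eigenspace j := by
      rw [Submodule.span_le]
      rintro _ ⟨p, -, u, hu, rfl⟩
      refine Submodule.mem_sup.2 ⟨p 0 • u, V.smul_mem _ hu, _,
        map_powOp_sub_mem κ (hV hu) p, by abel⟩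
    rw [h] at h1
    obtain ⟨u, hu, y, hy, rfl⟩ := Submodule.mem_sup.1 (h1 (Submodule.mem_top (x := v)))
    have hy' : y ∈ hwSpace κ l := by simpa using sub_mem hv (hV hu)
    rw [eq_zero_of_mem_hwSpace κ hy' hy, add_zero]
    exact hu

/-- Irreducibility makes the Verma map factor through `L(l)`. If the maximal submodule did not act
by zero, its images would span `W`; they have no `v₀`-coefficient, so they lie in weights other than
`l`, which forces `v = 0`. -/
lemma powOp_vermaMax (hcomm : ∀ X A, κ X * s A = s A * κ X) (hirr : JointlyIrreducible κ s)
    {l : ℂ} {p : Verma l} (hp : p ∈ vermaMax l) {v : W} (hv : v ∈ hwSpace κ l) :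
    powOp (κ f₂) (Restr.equiv (vermaRep l) (ℕ →₀ ℂ) p) v = 0 := by
  rcases span_powOp_eq_top hcomm hirr (hwSpace κ l) le_rfl
    (fun A v hv => map_mem_hwSpace hcomm A hv)
    ((vermaMax l).toSubmodule.comap (Restr.equiv (vermaRep l) (ℕ →₀ ℂ)).symm.toLinearMap)
    (fun X p hp => (vermaMax l).lie_mem (x := X) hp) with h | h
  · exact h _ hp v hv
  · have h1 : (⊤ : Submodule ℂ W) ≤ ⨆ j ≠ l, (κ h₂).eigenspace j := by
      rw [← h, Submodule.span_le]
      rintro _ ⟨q, hq, u, hu, rfl⟩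
      have h0 : q 0 = 0 := apply_zero_of_mem_vermaMax hq
      simpa [h0] using map_powOp_sub_mem κ hu q
    rw [eq_zero_of_mem_hwSpace κ hv (h1 trivial), map_zero]

variable {V₀ : Type*} [AddCommGroup V₀] [Module ℂ V₀]

/-- The pairing of `L(l)` with highest weight vectors of weight `l`. -/
def irrPairing (hcomm : ∀ X A, κ X * s A = s A * κ X) (hirr : JointlyIrreducible κ s)
    {l : ℂ} (i : V₀ →ₗ[ℂ] W) (hi : ∀ v, i v ∈ hwSpace κ l) : LSl2 l →ₗ[ℂ] V₀ →ₗ[ℂ] W :=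
  (vermaMax l).toSubmodule.liftQ
    ((LinearMap.lcomp ℂ W i).comp ((powOp (κ f₂)).comp
      (Restr.equiv (vermaRep l) (ℕ →₀ ℂ)).toLinearMap))
    (fun _ hp => LinearMap.ext fun v => powOp_vermaMax hcomm hirr hp (hi v))

/-- The class of an element of the Verma module in `L(l)`. -/
def irrMk (l : ℂ) : (ℕ →₀ ℂ) →ₗ[ℂ] LSl2 l :=
  (vermaMax l).toSubmodule.mkQ.comp (Restr.equiv (vermaRep l) (ℕ →₀ ℂ)).symm.toLinearMap

lemma irrMk_surjective (l : ℂ) : Function.Surjective (irrMk l) :=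
  (Submodule.mkQ_surjective _).comp (Restr.equiv (vermaRep l) (ℕ →₀ ℂ)).symm.surjective

lemma irrMk_eq_zero {l : ℂ} {p : ℕ →₀ ℂ} :
    irrMk l p = 0 ↔ (Restr.equiv (vermaRep l) (ℕ →₀ ℂ)).symm p ∈ vermaMax l :=
  Submodule.Quotient.mk_eq_zero (vermaMax l).toSubmodule

lemma lie_irrMk (l : ℂ) (X : Sl2) (p : ℕ →₀ ℂ) : ⁅X, irrMk l p⁆ = irrMk l (vermaOp l X p) := rfl

@[simp] lemma irrPairing_irrMk (hcomm : ∀ X A, κ X * s A = s A * κ X)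
    (hirr : JointlyIrreducible κ s) {l : ℂ} (i : V₀ →ₗ[ℂ] W) (hi : ∀ v, i v ∈ hwSpace κ l)
    (p : ℕ →₀ ℂ) (v : V₀) :
    irrPairing hcomm hirr i hi (irrMk l p) v = powOp (κ f₂) p (i v) := rfl

/-- The annihilator of `v` in the Verma module is a submodule which does not contain `v₀`, so it
lies in the maximal one. This supplies the injectivity in `exists_tensor_irr`. -/
lemma irrMk_single_eq_zero {l : ℂ} {v : W} (hv : v ∈ hwSpace κ l) (hv0 : v ≠ 0) {k : ℕ}
    (hk : (κ f₂ ^ k) v = 0) : irrMk l (Finsupp.single k 1) = 0 := by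
  rw [irrMk_eq_zero]
  refine mem_vermaMax_of_stable (LinearMap.ker ((LinearMap.applyₗ v).comp (powOp (κ f₂))))
    (fun X p hp => ?_) ?_ ?_
  · have hp' : powOp (κ f₂) p v = 0 := hp
    change powOp (κ f₂) (vermaOp l X p) v = 0
    rw [← lieHom_powOp hv, hp', map_zero]
  · intro h
    have h' : powOp (κ f₂) (Finsupp.single 0 1) v = 0 := h
    simp [powOp_single] at h'
    exact hv0 h'
  · change powOp (κ f₂) (Finsupp.single k 1) v = 0
    simp [powOp_single, hk]

/-- The classes of the `vₖ` span `L(l)` but need not form a basis, since for `l` a natural number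
almost all of them vanish. No uniqueness of `w` is needed. -/
lemma exists_sum_irrMk {l : ℂ} (x : V₀ ⊗[ℂ] LSl2 l) :
    ∃ w : ℕ →₀ V₀, x = w.sum fun k v => v ⊗ₜ[ℂ] irrMk l (Finsupp.single k 1) := by
  induction x with
  | zero => exact ⟨0, by simp⟩
  | add x y hx hy =>
    obtain ⟨w, rfl⟩ := hx
    obtain ⟨w', rfl⟩ := hy
    exact ⟨w + w', by
      rw [Finsupp.sum_add_index' (by simp) (by intros; rw [TensorProduct.add_tmul])]⟩
  | tmul v y =>
    obtain ⟨p, rfl⟩ := irrMk_surjective l y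
    refine ⟨p.mapRange (fun c => c • v) (zero_smul _ _), ?_⟩
    rw [Finsupp.sum_mapRange_index (by simp)]
    conv_lhs => rw [← Finsupp.sum_single p, Finsupp.sum, map_sum, TensorProduct.tmul_sum]
    refine Finset.sum_congr rfl fun k _ => ?_
    rw [← mul_one (p k), ← smul_eq_mul, ← Finsupp.smul_single, map_smul,
      TensorProduct.tmul_smul, TensorProduct.smul_tmul', smul_eq_mul, mul_one]

/-- An irreducible module with a highest weight vector of weight `l` is the tensor product of its
space of highest weight vectors with `L(l)`. -/
theorem exists_tensor_irr (hcomm : ∀ X A, κ X * s A = s A * κ X) (hirr : JointlyIrreducible κ s)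
    {l : ℂ} (i : V₀ →ₗ[ℂ] W) (hinj : Function.Injective i)
    (hrange : LinearMap.range i = hwSpace κ l) (hne : hwSpace κ l ≠ ⊥) :
    ∃ Ψ : (V₀ ⊗[ℂ] LSl2 l) ≃ₗ[ℂ] W,
      (∀ X v y, Ψ (v ⊗ₜ ⁅X, y⁆) = κ X (Ψ (v ⊗ₜ y))) ∧
      (∀ A v v' y, i v' = s A (i v) → Ψ (v' ⊗ₜ y) = s A (Ψ (v ⊗ₜ y))) := by
  have hi : ∀ v, i v ∈ hwSpace κ l := fun v => hrange ▸ LinearMap.mem_range_self i v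
  set B := irrPairing hcomm hirr i hi with hB
  set Φ : (V₀ ⊗[ℂ] LSl2 l) →ₗ[ℂ] W := TensorProduct.lift B.flip with hΦ
  have hΦt : ∀ v p, Φ (v ⊗ₜ irrMk l p) = powOp (κ f₂) p (i v) := fun v p => by
    simp [hΦ, hB]
  have hsurj : Function.Surjective Φ := by
    rcases span_powOp_eq_top hcomm hirr (hwSpace κ l) le_rfl
      (fun A v hv => map_mem_hwSpace hcomm A hv) ⊤ (fun _ _ _ => trivial) with h | h
    · refine absurd ?_ hne
      rw [eq_bot_iff]
      intro v hv
      simpa [powOp_single] using h (Finsupp.single 0 1) trivial v hv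
    · rw [← LinearMap.range_eq_top, eq_top_iff, ← h, Submodule.span_le]
      rintro _ ⟨p, -, v, hv, rfl⟩
      rw [← hrange] at hv
      obtain ⟨v, rfl⟩ := hv
      exact ⟨v ⊗ₜ irrMk l p, hΦt v p⟩
  have hinjΦ : Function.Injective Φ := by
    rw [injective_iff_map_eq_zero]
    intro x hx
    obtain ⟨w, rfl⟩ := exists_sum_irrMk x
    have hΦs : ∀ k v, Φ (v ⊗ₜ irrMk l (Finsupp.single k 1)) = (κ f₂ ^ k) (i v) := by
      intro k v; rw [hΦt]; simp [powOp_single]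
    rw [Finsupp.sum, map_sum] at hx
    simp only [hΦs] at hx
    -- The terms have distinct weights `l - 2k`, so each `Fᵏ` kills its own highest weight vector; a
    -- nonzero such vector forces the class of `vₖ` in `L(l)` to be zero already.
    have h1 := mem_of_sum_mem (fun _ : Unit => κ h₂) (fun (k : ℕ) _ => l - 2 * (k : ℂ))
      (two_mul_sub_injective l) ⊥ (by simp) w.support (fun k => (κ f₂ ^ k) (i (w k)))
      (fun k _ _ => (isSl2Ops_of_lieHom κ).h_f_pow (mem_hwSpace.1 (hi _)).2 k)
      (by rw [hx]; exact zero_mem _)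
    refine Finset.sum_eq_zero fun k hk => ?_
    have hwk : i (w k) ≠ 0 := fun h => Finsupp.mem_support_iff.1 hk (hinj (by simpa using h))
    beta_reduce
    rw [irrMk_single_eq_zero (hi (w k)) hwk (by simpa using h1 k hk), TensorProduct.tmul_zero]
  have hbij : Function.Bijective Φ := ⟨hinjΦ, hsurj⟩
  refine ⟨LinearEquiv.ofBijective Φ hbij, fun X v y => ?_, fun A v v' y h => ?_⟩
  · obtain ⟨p, rfl⟩ := irrMk_surjective l y
    simp only [LinearEquiv.ofBijective_apply, lie_irrMk, hΦt]
    rw [lieHom_powOp (hi v)]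
  · obtain ⟨p, rfl⟩ := irrMk_surjective l y
    simp only [LinearEquiv.ofBijective_apply, hΦt, h]
    induction p using Finsupp.induction_linear with
    | zero => simp
    | add p q hp hq => simp only [map_add, LinearMap.add_apply, hp, hq]
    | single k c =>
      simp only [powOp_single, LinearMap.smul_apply, map_smul]
      congr 1
      exact LinearMap.congr_fun (Commute.pow_left (hcomm f₂ A) k).eq (i v)

end HighestWeight

/-! ### Splitting off a module over a commuting algebra -/

section Splitting
variable {M P A G I ι : Type*} [AddCommGroup M] [Module ℂ M] [AddCommGroup P] [Module ℂ P]
  (σ : A → Module.End ℂ M) (ρ : A → Module.End ℂ P) (κ : G → Module.End ℂ M)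

/-- The map `w ⊗ p ↦ ev p w`. -/
def evTensor (W : Submodule ℂ M) (ev : P →ₗ[ℂ] Module.End ℂ M) : W ⊗[ℂ] P →ₗ[ℂ] M :=
  TensorProduct.lift (((LinearMap.lcomp ℂ M W.subtype).comp ev).flip)

@[simp] lemma evTensor_tmul (W : Submodule ℂ M) (ev : P →ₗ[ℂ] Module.End ℂ M) (w : W) (p : P) :
    evTensor W ev (w ⊗ₜ p) = ev p w := rfl

/-- If the vectors `ev bᵢ w` are joint eigenvectors with distinct systems of eigenvalues, then
`w ⊗ p ↦ ev p w` is injective. -/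
lemma evTensor_injective (W : Submodule ℂ M) (ev : P →ₗ[ℂ] Module.End ℂ M) (b : Module.Basis I ℂ P)
    (φ : ι → Module.End ℂ M) (χ : I → ι → ℂ) (hχ : Function.Injective χ)
    (hφ : ∀ i j, ∀ w ∈ W, φ j (ev (b i) w) = χ i j • ev (b i) w)
    (h0 : ∀ i, ∀ w ∈ W, ev (b i) w = 0 → w = 0) : Function.Injective (evTensor W ev) := by
  classical
  rw [injective_iff_map_eq_zero]
  intro x hx
  obtain ⟨w, rfl⟩ := (TensorProduct.equivFinsuppOfBasisRight (M := W) b).symm.surjective x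
  rw [TensorProduct.equivFinsuppOfBasisRight_symm_apply, Finsupp.sum, map_sum] at hx
  simp only [evTensor_tmul] at hx
  have h1 := mem_of_sum_mem φ χ hχ ⊥ (by simp) w.support (fun i => ev (b i) (w i))
    (fun i _ j => hφ i j _ (w i).2) (by rw [hx]; exact zero_mem _)
  have : w = 0 := by
    ext i
    by_cases hi : i ∈ w.support
    · simpa using h0 i _ (w i).2 (by simpa using h1 i hi)
    · simpa using hi
  rw [this, map_zero]

variable {σ ρ κ}

/-- The range is stable under `κ`, which preserves `W` and commutes with `ev`, and under `σ`,
because `ev` is equivariant on `W`. Being nonzero, it is everything. -/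
lemma range_evTensor_eq_top (hirr : JointlyIrreducible κ σ) (W : Submodule ℂ M)
    (hW : ∀ g, ∀ w ∈ W, κ g w ∈ W) (ev : P →ₗ[ℂ] Module.End ℂ M)
    (hκ : ∀ g p, κ g * ev p = ev p * κ g) (hσ : ∀ a p, ∀ w ∈ W, σ a (ev p w) = ev (ρ a p) w)
    (hne : ∃ w ∈ W, ∃ p, ev p w ≠ 0) : LinearMap.range (evTensor W ev) = ⊤ := by
  refine (hirr (LinearMap.range (evTensor W ev)) ?_ ?_).symm.elim id fun h => ?_
  rotate_left 2
  · obtain ⟨w, hw, p, hp⟩ := hne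
    refine absurd ?_ hp
    have : evTensor W ev (⟨w, hw⟩ ⊗ₜ p) ∈ (⊥ : Submodule ℂ M) := h ▸ LinearMap.mem_range_self _ _
    simpa using this
  · rintro g _ ⟨x, rfl⟩
    induction x with
    | zero => simp
    | add x y hx hy => simp only [map_add]; exact add_mem hx hy
    | tmul w p =>
      refine ⟨⟨κ g w, hW g w w.2⟩ ⊗ₜ p, ?_⟩
      simp only [evTensor_tmul]
      exact (LinearMap.congr_fun (hκ g p) w).symm
  · rintro a _ ⟨x, rfl⟩
    induction x with
    | zero => simp
    | add x y hx hy => simp only [map_add]; exact add_mem hx hy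
    | tmul w p =>
      refine ⟨w ⊗ₜ ρ a p, ?_⟩
      simp only [evTensor_tmul]
      exact (hσ a p w w.2).symm

/-- The multiplicity space `W` is irreducible. -/
lemma multiplicity_irreducible (hirr : JointlyIrreducible κ σ) (W : Submodule ℂ M)
    (ev : P →ₗ[ℂ] Module.End ℂ M)
    (hκ : ∀ g p, κ g * ev p = ev p * κ g) (hσ : ∀ a p, ∀ w ∈ W, σ a (ev p w) = ev (ρ a p) w)
    (b : Module.Basis I ℂ P) (i₀ : I) (h0 : ∀ w ∈ W, ev (b i₀) w = 0 → w = 0)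
    (hinj : Function.Injective (evTensor W ev)) (N : Submodule ℂ M) (hN : N ≤ W)
    (hNs : ∀ g, ∀ w ∈ N, κ g w ∈ N) : N = ⊥ ∨ N = W := by
  rcases eq_or_ne N ⊥ with h | h
  · exact Or.inl h
  right
  obtain ⟨u, hu, hu0⟩ := (Submodule.ne_bot_iff N).1 h
  -- A nonzero invariant `N` already generates `M`, so for `w ∈ W` the vector `ev (b i₀) w` comes
  -- from `N ⊗ P`.
  have htop := range_evTensor_eq_top hirr N hNs ev hκ (fun a p w hw => hσ a p w (hN hw))
    ⟨u, hu, b i₀, fun h => hu0 (h0 u (hN hu) h)⟩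
  refine le_antisymm hN fun w hw => ?_
  obtain ⟨x, hx⟩ := LinearMap.range_eq_top.1 htop (ev (b i₀) w)
  have hfac : evTensor N ev =
      (evTensor W ev).comp (TensorProduct.map (Submodule.inclusion hN) LinearMap.id) :=
    TensorProduct.ext' fun _ _ => rfl
  rw [hfac] at hx
  have hx' : TensorProduct.map (Submodule.inclusion hN) LinearMap.id x =
      (⟨w, hw⟩ : W) ⊗ₜ[ℂ] b i₀ := hinj hx
  -- Contracting the second factor with the coordinate at `i₀` turns `w ⊗ b i₀` into `w` and sends
  -- `N ⊗ P` into `N`.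
  have h1 := congrArg (fun y => TensorProduct.rid ℂ W
    (TensorProduct.map LinearMap.id (b.coord i₀) y)) hx'
  have h2 : ∀ x : N ⊗[ℂ] P, TensorProduct.rid ℂ W (TensorProduct.map LinearMap.id (b.coord i₀)
      (TensorProduct.map (Submodule.inclusion hN) LinearMap.id x)) =
      Submodule.inclusion hN (TensorProduct.rid ℂ N
        (TensorProduct.map LinearMap.id (b.coord i₀) x)) := by
    intro x
    induction x with
    | zero => simp
    | add x y hx hy => simp only [map_add, hx, hy]
    | tmul w p => simp
  simp only [h2] at h1
  simp at h1
  have h3 := congrArg Subtype.val h1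
  simp only [Submodule.coe_inclusion] at h3
  rw [← h3]
  exact Subtype.property _

end Splitting

/-! ### Triple tensor product decompositions -/

section Triple
variable {M P A S V₀ I : Type*} [AddCommGroup M] [Module ℂ M] [AddCommGroup P] [Module ℂ P]
  [AddCommGroup V₀] [Module ℂ V₀]

/-- The restriction of a representation to an invariant subspace. -/
def restrictHom {L : Type*} [LieRing L] [LieAlgebra ℂ L] (κ : L →ₗ⁅ℂ⁆ Module.End ℂ M)
    (W : Submodule ℂ M) (h : ∀ X, ∀ w ∈ W, κ X w ∈ W) : L →ₗ⁅ℂ⁆ Module.End ℂ W where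
  toFun X := (κ X).restrict (h X)
  map_add' X Y := by ext; simp
  map_smul' c X := by ext; simp
  map_lie' := by intro X Y; ext; simp [Ring.lie_def]

@[simp] lemma coe_restrictHom_apply {L : Type*} [LieRing L] [LieAlgebra ℂ L]
    (κ : L →ₗ⁅ℂ⁆ Module.End ℂ M) (W : Submodule ℂ M) (h : ∀ X, ∀ w ∈ W, κ X w ∈ W) (X : L)
    (w : W) : (restrictHom κ W h X w : M) = κ X w := rfl

/-- Data splitting off a `σ`-module `P` from `M`, with multiplicity space `W`: here `κ` and `s` are
families of operators on `M` preserving `W`. -/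
structure IsSplitting (σ : A → Module.End ℂ M) (ρ : A → Module.End ℂ P)
    (κ : Sl2 →ₗ⁅ℂ⁆ Module.End ℂ M) (s : S → Module.End ℂ M) (W : Submodule ℂ M)
    (ev : P →ₗ[ℂ] Module.End ℂ M) (b : Module.Basis I ℂ P) (i₀ : I) : Prop where
  comm : ∀ X B, κ X * s B = s B * κ X
  irr : JointlyIrreducible (Sum.elim κ s) σ
  stable_left : ∀ X, ∀ w ∈ W, κ X w ∈ W
  stable_right : ∀ B, ∀ w ∈ W, s B w ∈ W
  comm_left : ∀ X p, κ X * ev p = ev p * κ X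
  comm_right : ∀ B p, s B * ev p = ev p * s B
  equivariant : ∀ a p, ∀ w ∈ W, σ a (ev p w) = ev (ρ a p) w
  faithful : ∀ w ∈ W, ev (b i₀) w = 0 → w = 0
  injective : Function.Injective (evTensor W ev)

namespace IsSplitting
variable {σ : A → Module.End ℂ M} {ρ : A → Module.End ℂ P}
    {κ : Sl2 →ₗ⁅ℂ⁆ Module.End ℂ M} {s : S → Module.End ℂ M} {W : Submodule ℂ M}
    {ev : P →ₗ[ℂ] Module.End ℂ M} {b : Module.Basis I ℂ P} {i₀ : I}
    (h : IsSplitting σ ρ κ s W ev b i₀)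
include h

lemma stable : ∀ g, ∀ w ∈ W, Sum.elim κ s g w ∈ W := by
  rintro (X | B)
  exacts [h.stable_left X, h.stable_right B]

lemma comm_ev : ∀ g p, Sum.elim κ s g * ev p = ev p * Sum.elim κ s g := by
  rintro (X | B)
  exacts [h.comm_left X, h.comm_right B]

lemma irreducible : JointlyIrreducible (restrictHom κ W h.stable_left)
    (fun B => (s B).restrict (h.stable_right B)) := by
  intro N hN₁ hN₂
  have h1 := multiplicity_irreducible h.irr W ev h.comm_ev h.equivariant b i₀ h.faithful
    h.injective (N.map W.subtype) (Submodule.map_subtype_le W N) (by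
      rintro (X | B) _ ⟨w, hw, rfl⟩
      exacts [⟨_, hN₁ X w hw, rfl⟩, ⟨_, hN₂ B w hw, rfl⟩])
  rcases h1 with h1 | h1
  · exact Or.inl (Submodule.map_injective_of_injective W.injective_subtype
      (h1.trans (Submodule.map_bot _).symm))
  · right
    refine eq_top_iff.2 fun w _ => ?_
    obtain ⟨w', hw', hww⟩ : (w : M) ∈ N.map W.subtype := by rw [h1]; exact w.2
    rwa [← Subtype.ext hww]

lemma comm_restrict (X : Sl2) (B : S) :
    restrictHom κ W h.stable_left X * (s B).restrict (h.stable_right B) =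
      (s B).restrict (h.stable_right B) * restrictHom κ W h.stable_left X := by
  ext w
  exact LinearMap.congr_fun (h.comm X B) w

lemma map_hwSpace (l : ℂ) : (hwSpace (restrictHom κ W h.stable_left) l).map W.subtype =
    W ⊓ hwSpace κ l := by
  ext w
  simp only [Submodule.mem_map, Submodule.mem_inf, mem_hwSpace, Submodule.subtype_apply]
  constructor
  · rintro ⟨w, ⟨h1, h2⟩, rfl⟩
    exact ⟨w.2, by simpa using congrArg Subtype.val h1, by simpa using congrArg Subtype.val h2⟩
  · rintro ⟨hw, h1, h2⟩
    exact ⟨⟨w, hw⟩, ⟨Subtype.ext (by simpa using h1), Subtype.ext (by simpa using h2)⟩, rfl⟩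

/-- The space of highest weight vectors in the multiplicity space is irreducible. -/
lemma hw_irreducible (l : ℂ) (N : Submodule ℂ M) (hN : N ≤ W ⊓ hwSpace κ l)
    (hNs : ∀ B, ∀ w ∈ N, s B w ∈ N) : N = ⊥ ∨ N = W ⊓ hwSpace κ l := by
  have hNW : N ≤ W := hN.trans inf_le_left
  have hmap : (N.comap W.subtype).map W.subtype = N := by
    rw [Submodule.map_comap_subtype, inf_eq_right.2 hNW]
  rcases hwSpace_irreducible h.comm_restrict h.irreducible (l := l) (N.comap W.subtype)
    (fun w hw => by
      have := hN hw
      rw [← h.map_hwSpace] at this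
      obtain ⟨w', hw', hww⟩ := this
      rwa [← Subtype.ext hww]) (fun B w hw => hNs B _ hw) with h1 | h1
  · left
    rw [← hmap, h1, Submodule.map_bot]
  · right
    rw [← hmap, h1, h.map_hwSpace]

/-- Evaluation identifies `M` with `W ⊗ P`, and `exists_tensor_irr` identifies `W` with `V₀ ⊗ L(l)`.
The injection `i` leaves the model of the highest weight space free: later it is `ℂᵈ` with a
transported `soₙ`-action, or just `ℂ` in rank one. -/
theorem exists_equiv {l : ℂ} (i : V₀ →ₗ[ℂ] M) (hi : Function.Injective i)
    (hrange : LinearMap.range i = W ⊓ hwSpace κ l) (hne : W ⊓ hwSpace κ l ≠ ⊥) :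
    ∃ Ψ : (V₀ ⊗[ℂ] (LSl2 l ⊗[ℂ] P)) ≃ₗ[ℂ] M,
      (∀ X v y p, Ψ (v ⊗ₜ (⁅X, y⁆ ⊗ₜ p)) = κ X (Ψ (v ⊗ₜ (y ⊗ₜ p)))) ∧
      (∀ B v v' y p, i v' = s B (i v) → Ψ (v' ⊗ₜ (y ⊗ₜ p)) = s B (Ψ (v ⊗ₜ (y ⊗ₜ p)))) ∧
      (∀ a v y p, Ψ (v ⊗ₜ (y ⊗ₜ ρ a p)) = σ a (Ψ (v ⊗ₜ (y ⊗ₜ p)))) := by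
  have hiW : ∀ v, i v ∈ W := fun v => (hrange ▸ LinearMap.mem_range_self i v :
    i v ∈ W ⊓ hwSpace κ l).1
  set i' : V₀ →ₗ[ℂ] W := i.codRestrict W hiW with hi'
  have hi'r : LinearMap.range i' = hwSpace (restrictHom κ W h.stable_left) l := by
    refine Submodule.map_injective_of_injective W.injective_subtype ?_
    rw [h.map_hwSpace, ← hrange, ← LinearMap.range_comp]
    rfl
  have hne' : hwSpace (restrictHom κ W h.stable_left) l ≠ ⊥ := by
    intro h0
    rw [← h.map_hwSpace, h0, Submodule.map_bot] at hne
    exact hne rfl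
  obtain ⟨Ψ₁, h1, h2⟩ := exists_tensor_irr h.comm_restrict h.irreducible i'
    (fun a b hab => hi (congrArg Subtype.val hab)) hi'r hne'
  obtain ⟨w, hw, hw0⟩ := (Submodule.ne_bot_iff _).1 hne
  have hbij : Function.Bijective (evTensor W ev) := ⟨h.injective, LinearMap.range_eq_top.1
    (range_evTensor_eq_top h.irr W h.stable ev h.comm_ev h.equivariant
      ⟨w, hw.1, b i₀, fun h0 => hw0 (h.faithful w hw.1 h0)⟩)⟩
  let Ψ := (TensorProduct.assoc ℂ V₀ (LSl2 l) P).symm ≪≫ₗ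
    TensorProduct.congr Ψ₁ (LinearEquiv.refl ℂ P) ≪≫ₗ LinearEquiv.ofBijective _ hbij
  have hΨ : ∀ v y p, Ψ (v ⊗ₜ (y ⊗ₜ p)) = ev p (Ψ₁ (v ⊗ₜ y)) := fun v y p => rfl
  refine ⟨Ψ, fun X v y p => ?_, fun B v v' y p hv => ?_, fun a v y p => ?_⟩
  · rw [hΨ, hΨ, h1]
    exact (LinearMap.congr_fun (h.comm_left X p) _).symm
  · rw [hΨ, hΨ, h2 B v v' y (Subtype.ext hv)]
    exact (LinearMap.congr_fun (h.comm_right B p) _).symm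
  · rw [hΨ, hΨ, h.equivariant a p _ (Ψ₁ _).2]

end IsSplitting

end Triple

/-! ### The Weyl algebra acting on modules of nonzero central charge -/

section WeylOn
variable {n : ℕ}

lemma lie_xS_xS (i j : Fin n) : ⁅(xS i : Sch n), xS j⁆ = 0 := by
  refine LieAlgebra.SemiDirectSum.ext ?_ ?_ <;>
    simp [xS, LieAlgebra.SemiDirectSum.lie_eq_mk]
  ext <;> simp

lemma lie_yS_yS (i j : Fin n) : ⁅(yS i : Sch n), yS j⁆ = 0 := by
  refine LieAlgebra.SemiDirectSum.ext ?_ ?_ <;>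
    simp [yS, LieAlgebra.SemiDirectSum.lie_eq_mk]
  ext <;> simp

lemma lie_xS_yS (i j : Fin n) : ⁅(xS i : Sch n), yS j⁆ = if i = j then zS n else 0 := by
  split_ifs with h
  · subst h
    refine LieAlgebra.SemiDirectSum.ext ?_ ?_ <;>
      simp [xS, yS, zS, LieAlgebra.SemiDirectSum.lie_eq_mk]
    ext <;> simp
  · refine LieAlgebra.SemiDirectSum.ext ?_ ?_ <;>
      simp [xS, yS, LieAlgebra.SemiDirectSum.lie_eq_mk]
    ext <;> simp [h]

/-- The inclusion of the Heisenberg algebra. -/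
def ofHeis (u : Heis n) : Sch n := ⟨u, 0⟩

lemma ofHeis_eq (u : Heis n) :
    ofHeis u = ∑ i, u.xc i • xS i + ∑ i, u.yc i • yS i + u.zc • zS n := by
  have hsum : ∀ (f : Fin n → Heis n), (∑ i, ofHeis (f i)) = ofHeis (∑ i, f i) := by
    intro f
    exact (map_sum (LieAlgebra.SemiDirectSum.inl (act n)) f Finset.univ).symm
  have hx : ∀ i, u.xc i • (xS i : Sch n) = ofHeis (u.xc i • ⟨Pi.single i 1, 0, 0⟩) := fun i => by
    simp [xS, ofHeis, LieAlgebra.SemiDirectSum.smul_eq_mk]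
  have hy : ∀ i, u.yc i • (yS i : Sch n) = ofHeis (u.yc i • ⟨0, Pi.single i 1, 0⟩) := fun i => by
    simp [yS, ofHeis, LieAlgebra.SemiDirectSum.smul_eq_mk]
  have hs1 : ∀ f : Fin n → Heis n, (∑ i, f i).xc = ∑ i, (f i).xc := fun f =>
    map_sum (⟨⟨Heis.xc, rfl⟩, fun _ _ => rfl⟩ : Heis n →+ (Fin n → ℂ)) f _
  have hs2 : ∀ f : Fin n → Heis n, (∑ i, f i).yc = ∑ i, (f i).yc := fun f =>
    map_sum (⟨⟨Heis.yc, rfl⟩, fun _ _ => rfl⟩ : Heis n →+ (Fin n → ℂ)) f _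
  have hs3 : ∀ f : Fin n → Heis n, (∑ i, f i).zc = ∑ i, (f i).zc := fun f =>
    map_sum (⟨⟨Heis.zc, rfl⟩, fun _ _ => rfl⟩ : Heis n →+ ℂ) f _
  simp only [hx, hy, hsum]
  refine LieAlgebra.SemiDirectSum.ext ?_ ?_
  · ext i <;> simp [ofHeis, zS, LieAlgebra.SemiDirectSum.add_eq_mk,
      LieAlgebra.SemiDirectSum.smul_eq_mk, hs1, hs2, hs3, Pi.single_apply]
  · simp [ofHeis, zS, LieAlgebra.SemiDirectSum.add_eq_mk, LieAlgebra.SemiDirectSum.smul_eq_mk]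

variable {M : Type*} [AddCommGroup M] [Module ℂ M] [LieRingModule (Sch n) M]
  [LieModule ℂ (Sch n) M]

/-- The Lie algebra action as operators. -/
abbrev op (n : ℕ) (M : Type*) [AddCommGroup M] [Module ℂ M] [LieRingModule (Sch n) M]
    [LieModule ℂ (Sch n) M] : Sch n →ₗ⁅ℂ⁆ Module.End ℂ M := LieModule.toEnd ℂ (Sch n) M

variable {r : ℂ} (hr : r ≠ 0) (hz : ∀ v : M, ⁅zS n, v⁆ = r ^ 2 • v)

/-- The action of the Weyl algebra on a module of central charge `r²`. -/
def weylOn (hr : r ≠ 0) (hz : ∀ v : M, ⁅zS n, v⁆ = r ^ 2 • v) : Weyl n →ₐ[ℂ] Module.End ℂ M :=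
  Weyl.lift (fun i => r⁻¹ • op n M (yS i)) (fun i => r⁻¹ • op n M (xS i))
    (fun i j => by
      have h : op n M ⁅yS i, yS j⁆ = 0 := by rw [lie_yS_yS, map_zero]
      rw [LieHom.map_lie, Ring.lie_def, sub_eq_zero] at h
      simp only [smul_mul_smul_comm, h])
    (fun i j => by
      have h : op n M ⁅xS i, xS j⁆ = 0 := by rw [lie_xS_xS, map_zero]
      rw [LieHom.map_lie, Ring.lie_def, sub_eq_zero] at h
      simp only [smul_mul_smul_comm, h])
    (fun i j => by
      have h : op n M ⁅xS i, yS j⁆ = if i = j then r ^ 2 • 1 else 0 := by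
        rw [lie_xS_yS]
        split_ifs
        · ext v; simpa using hz v
        · exact map_zero _
      rw [LieHom.map_lie, Ring.lie_def] at h
      simp only [smul_mul_smul_comm]
      rw [← smul_sub, h]
      split_ifs
      · rw [smul_smul]
        convert one_smul ℂ _
        field_simp
      · simp)

@[simp] lemma weylOn_t (i : Fin n) : weylOn hr hz (Weyl.t i) = r⁻¹ • op n M (yS i) := by
  simp [weylOn]

@[simp] lemma weylOn_d (i : Fin n) : weylOn hr hz (Weyl.d i) = r⁻¹ • op n M (xS i) := by
  simp [weylOn]

/-- The factors `r⁻¹` in `weylOn` cancel the factors `r` in `theta`, and the hypothesis on `z`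
handles the centre. -/
lemma weylOn_theta_ofHeis (u : Heis n) :
    weylOn hr hz (theta n r (ofHeis u)) = op n M (ofHeis u) := by
  have h1 : op n M (zS n) = r ^ 2 • 1 := by ext v; simpa using hz v
  have h2 : theta n r (ofHeis u) = uW r u := by
    change uW r u + qW 0 = uW r u
    simp [qW, sW]
  rw [h2, ofHeis_eq]
  simp only [uW, map_add, map_sum, map_smul, weylOn_t, weylOn_d, h1, map_one,
    Finset.smul_sum, smul_comm r, smul_smul, mul_assoc, mul_inv_cancel₀ hr, mul_one]

/-- An operator commuting with the generators of the Weyl algebra commutes with its action. -/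
lemma commute_algHom {M' : Type*} [AddCommGroup M'] [Module ℂ M']
    (σ : Weyl n →ₐ[ℂ] Module.End ℂ M') (Y : Module.End ℂ M')
    (ht : ∀ i, Y * σ (Weyl.t i) = σ (Weyl.t i) * Y) (hd : ∀ i, Y * σ (Weyl.d i) = σ (Weyl.d i) * Y)
    (a : Weyl n) : Y * σ a = σ a * Y := by
  obtain ⟨a, rfl⟩ : ∃ b, Weyl.mk n b = a := RingQuot.mkAlgHom_surjective ℂ (WeylRel n) a
  induction a using FreeAlgebra.induction with
  | grade0 c =>
    rw [AlgHom.commutes, AlgHom.commutes]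
    exact (Algebra.commutes c Y).symm
  | grade1 x =>
    rcases x with i | i
    exacts [ht i, hd i]
  | mul a b ha hb => rw [map_mul, map_mul, ← mul_assoc, ha, mul_assoc, hb, mul_assoc]
  | add a b ha hb => rw [map_add, map_add, mul_add, add_mul, ha, hb]

/-- The Heisenberg algebra is an ideal, so the original action and the one through `theta` agree
both on `u` and on `⁅X, u⁆`. Subtracting the two commutator identities gives the claim. -/
lemma op_lie_ofHeis (X : Sch n) (u : Heis n) :
    (op n M X - weylOn hr hz (theta n r X)) * op n M (ofHeis u) =
      op n M (ofHeis u) * (op n M X - weylOn hr hz (theta n r X)) := by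
  have h1 : ∃ u', ⁅X, ofHeis u⁆ = ofHeis u' := by
    refine ⟨⁅X, ofHeis u⁆.left, ?_⟩
    refine LieAlgebra.SemiDirectSum.ext rfl ?_
    simp [ofHeis, LieAlgebra.SemiDirectSum.lie_eq_mk]
  obtain ⟨u', hu'⟩ := h1
  have h2 := weylOn_theta_ofHeis hr hz (M := M) u'
  rw [← hu', LieHom.map_lie, LieHom.map_lie, Ring.lie_def, Ring.lie_def, map_sub, map_mul, map_mul,
    weylOn_theta_ofHeis] at h2
  rw [sub_mul, mul_sub]
  rw [sub_eq_sub_iff_sub_eq_sub]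
  exact h2.symm

lemma xS_eq_ofHeis (i : Fin n) : xS i = ofHeis ⟨Pi.single i 1, 0, 0⟩ := rfl

lemma yS_eq_ofHeis (i : Fin n) : yS i = ofHeis ⟨0, Pi.single i 1, 0⟩ := rfl

lemma residual_commute (X : Sch n) (a : Weyl n) :
    (op n M X - weylOn hr hz (theta n r X)) * weylOn hr hz a =
      weylOn hr hz a * (op n M X - weylOn hr hz (theta n r X)) := by
  refine commute_algHom _ _ (fun i => ?_) (fun i => ?_) a
  · rw [weylOn_t, mul_smul_comm, smul_mul_assoc, yS_eq_ofHeis, op_lie_ofHeis]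
  · rw [weylOn_d, mul_smul_comm, smul_mul_assoc, xS_eq_ofHeis, op_lie_ofHeis]

/-- The part of the action of `𝔰ₙ` commuting with the action of the Weyl algebra. -/
def residual : Sch n →ₗ⁅ℂ⁆ Module.End ℂ M where
  toFun X := op n M X - weylOn hr hz (theta n r X)
  map_add' X Y := by simp only [map_add]; abel
  map_smul' c X := by simp only [map_smul, smul_sub, RingHom.id_apply]
  map_lie' := by
    intro X Y
    -- Both mixed commutators between residuals and the Weyl algebra vanish, so the bracket of the
    -- differences is the difference of the brackets.
    have h1 := residual_commute hr hz (M := M) X (theta n r Y)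
    have h2 := residual_commute hr hz (M := M) Y (theta n r X)
    simp only [LieHom.map_lie, Ring.lie_def, map_sub, map_mul]
    simp only [sub_mul, mul_sub] at h1 h2 ⊢
    rw [sub_eq_sub_iff_add_eq_add] at h1 h2
    have h1' := eq_sub_of_add_eq h1
    have h2' := eq_sub_of_add_eq h2
    rw [h1', h2']
    abel

lemma op_eq (X : Sch n) : op n M X = residual hr hz X + weylOn hr hz (theta n r X) :=
  (sub_add_cancel _ _).symm

lemma residual_ofHeis (u : Heis n) : residual hr hz (M := M) (ofHeis u) = 0 := by
  change op n M (ofHeis u) - _ = 0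
  rw [weylOn_theta_ofHeis, sub_self]

/-- The commuting action of `sl₂`. -/
def sl2Res : Sl2 →ₗ⁅ℂ⁆ Module.End ℂ M :=
  (residual hr hz).comp ((LieAlgebra.SemiDirectSum.inr (act n)).comp (LieHom.inl ℂ Sl2 (So n)))

/-- The commuting action of `soₙ`. -/
def soRes : So n →ₗ⁅ℂ⁆ Module.End ℂ M :=
  (residual hr hz).comp ((LieAlgebra.SemiDirectSum.inr (act n)).comp (LieHom.inr ℂ Sl2 (So n)))

lemma residual_eq (X : Sch n) :
    residual hr hz (M := M) X = sl2Res hr hz (toSl2 n X) + soRes hr hz (toSo n X) := by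
  have h : X = ofHeis X.left + (⟨0, (toSl2 n X, 0)⟩ + ⟨0, (0, toSo n X)⟩) := by
    refine LieAlgebra.SemiDirectSum.ext ?_ ?_
    · simp [ofHeis, LieAlgebra.SemiDirectSum.add_eq_mk]
    · simp only [ofHeis, LieAlgebra.SemiDirectSum.add_eq_mk]
      exact Prod.ext (by simp [toSl2]) (by simp [toSo])
  conv_lhs => rw [h, map_add, map_add, residual_ofHeis, zero_add]
  rfl

/-- The three summands commute with one another, so this is the shape of the action on a tensor
product of an `sl₂`-module, an `soₙ`-module and a Weyl module. -/
lemma op_eq' (X : Sch n) : op n M X =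
    sl2Res hr hz (toSl2 n X) + soRes hr hz (toSo n X) + weylOn hr hz (theta n r X) := by
  rw [op_eq hr hz, residual_eq]

lemma sl2Res_soRes (X : Sl2) (A : So n) :
    sl2Res hr hz (M := M) X * soRes hr hz A = soRes hr hz A * sl2Res hr hz X := by
  rw [← sub_eq_zero, ← Ring.lie_def]
  simp only [sl2Res, soRes, LieHom.comp_apply]
  have h : ⁅LieHom.inl ℂ Sl2 (So n) X, LieHom.inr ℂ Sl2 (So n) A⁆ = 0 :=
    Prod.ext (by simp) (by simp)
  rw [← LieHom.map_lie, ← LieHom.map_lie, h, map_zero, map_zero]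

lemma sl2Res_weylOn (X : Sl2) (a : Weyl n) :
    sl2Res hr hz (M := M) X * weylOn hr hz a = weylOn hr hz a * sl2Res hr hz X :=
  residual_commute hr hz _ a

lemma soRes_weylOn (A : So n) (a : Weyl n) :
    soRes hr hz (M := M) A * weylOn hr hz a = weylOn hr hz a * soRes hr hz A :=
  residual_commute hr hz _ a

lemma jointlyIrreducible (hirr : LieModule.IsIrreducible ℂ (Sch n) M) :
    JointlyIrreducible (Sum.elim (sl2Res hr hz (M := M)) (soRes hr hz)) (weylOn hr hz) := by
  intro N hN₁ hN₂
  let N' : LieSubmodule ℂ (Sch n) M :=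
    { N with
      lie_mem := by
        intro X w hw
        have h := LinearMap.congr_fun (op_eq' hr hz (M := M) X) w
        have h' : ⁅X, w⁆ = _ := h
        change ⁅X, w⁆ ∈ N
        rw [h']
        exact add_mem (add_mem (hN₁ (Sum.inl _) w hw) (hN₁ (Sum.inr _) w hw)) (hN₂ _ w hw) }
  rcases hirr.eq_bot_or_eq_top N' with h | h
  · left
    simpa [N'] using congrArg LieSubmodule.toSubmodule h
  · right
    simpa [N'] using congrArg LieSubmodule.toSubmodule h

end WeylOn

/-! ### Weights -/

section Weights
variable {n : ℕ}

lemma hS_lie_xS (i : Fin n) : ⁅hS n, xS i⁆ = xS i := by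
  refine LieAlgebra.SemiDirectSum.ext ?_ ?_
  · change ⁅(0 : Heis n), _⁆ + actDer n _ _ - actDer n _ _ = _
    rw [actDer_apply, actDer_apply]
    ext <;> simp [xS, hS, h₂]
  · simp [xS, hS, LieAlgebra.SemiDirectSum.lie_eq_mk]

lemma hS_lie_yS (i : Fin n) : ⁅hS n, yS i⁆ = (-1 : ℂ) • yS i := by
  refine LieAlgebra.SemiDirectSum.ext ?_ ?_
  · change ⁅(0 : Heis n), _⁆ + actDer n _ _ - actDer n _ _ = _
    rw [actDer_apply, actDer_apply]
    ext <;> simp [yS, hS, h₂]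
  · simp [yS, hS, LieAlgebra.SemiDirectSum.lie_eq_mk]

lemma eS_lie_xS (i : Fin n) : ⁅eS n, xS i⁆ = 0 := by
  refine LieAlgebra.SemiDirectSum.ext ?_ ?_
  · change ⁅(0 : Heis n), _⁆ + actDer n _ _ - actDer n _ _ = _
    rw [actDer_apply, actDer_apply]
    ext <;> simp [xS, eS, e₂]
  · simp [xS, eS, LieAlgebra.SemiDirectSum.lie_eq_mk]

lemma fS_lie_yS (i : Fin n) : ⁅fS n, yS i⁆ = 0 := by
  refine LieAlgebra.SemiDirectSum.ext ?_ ?_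
  · change ⁅(0 : Heis n), _⁆ + actDer n _ _ - actDer n _ _ = _
    rw [actDer_apply, actDer_apply]
    ext <;> simp [yS, fS, f₂]
  · simp [yS, fS, LieAlgebra.SemiDirectSum.lie_eq_mk]

lemma theta_eS : theta n r (eS n) = eW n := by
  change uW r 0 + qW (e₂, 0) = _
  simp [uW, qW, sW, e₂]

lemma theta_hS : theta n r (hS n) = hW n := by
  change uW r 0 + qW (h₂, 0) = _
  simp [uW, qW, sW, h₂]

variable {M : Type*} [AddCommGroup M] [Module ℂ M] [LieRingModule (Sch n) M]
  [LieModule ℂ (Sch n) M]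

/-- The action of `sl₂` as a subalgebra of `𝔰ₙ`. -/
lemma isSl2Ops_op : IsSl2Ops (op n M (eS n)) (op n M (fS n)) (op n M (hS n)) :=
  isSl2Ops_of_lieHom ((op n M).comp
    ((LieAlgebra.SemiDirectSum.inr (act n)).comp (LieHom.inl ℂ Sl2 (So n))))

lemma mem_weightSpace {μ : ℂ} {v : M} : v ∈ weightSpace n M μ ↔ op n M (hS n) v = μ • v :=
  Module.End.mem_eigenspace_iff

lemma pow_map_mem_weightSpace {A : Module.End ℂ M} {c : ℂ}
    (hA : op n M (hS n) * A - A * op n M (hS n) = c • A) (k : ℕ) {μ : ℂ} {v : M}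
    (hv : v ∈ weightSpace n M μ) : (A ^ k) v ∈ weightSpace n M (μ + k * c) :=
  mem_weightSpace.2 (apply_pow_of_commutator hA (mem_weightSpace.1 hv) k)

lemma map_mem_weightSpace {A : Module.End ℂ M} {c : ℂ}
    (hA : op n M (hS n) * A - A * op n M (hS n) = c • A) {μ : ℂ} {v : M}
    (hv : v ∈ weightSpace n M μ) : A v ∈ weightSpace n M (μ + c) := by
  simpa using pow_map_mem_weightSpace hA 1 hv

lemma op_comm_of_lie {X Y : Sch n} {c : ℂ} (h : ⁅X, Y⁆ = c • Y) :
    op n M X * op n M Y - op n M Y * op n M X = c • op n M Y := by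
  rw [← Ring.lie_def, ← LieHom.map_lie, h, map_smul]

lemma weight_xS (i : Fin n) :
    op n M (hS n) * op n M (xS i) - op n M (xS i) * op n M (hS n) = (1 : ℂ) • op n M (xS i) :=
  op_comm_of_lie (by rw [hS_lie_xS, one_smul])

lemma weight_yS (i : Fin n) :
    op n M (hS n) * op n M (yS i) - op n M (yS i) * op n M (hS n) = (-1 : ℂ) • op n M (yS i) :=
  op_comm_of_lie (hS_lie_yS i)

lemma iSup_weightSpace (hHC : IsHarishChandra n M) : ⨆ μ, weightSpace n M μ = ⊤ :=
  hHC.isInternal.submodule_iSup_eq_top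

lemma exists_weight_vector [Nontrivial M] (hHC : IsHarishChandra n M) :
    ∃ μ, ∃ v ∈ weightSpace n M μ, v ≠ 0 := by
  by_contra! h
  have h1 : ⨆ μ, weightSpace n M μ = ⊥ := by
    rw [iSup_eq_bot]
    exact fun μ => (Submodule.eq_bot_iff _).2 (h μ)
  rw [iSup_weightSpace hHC] at h1
  exact top_ne_bot h1

/-- A weight-shifting operator nilpotent on a weight vector annihilates some weight vector. -/
lemma exists_killed_weight_vector {A : Module.End ℂ M} {c : ℂ}
    (hA : op n M (hS n) * A - A * op n M (hS n) = c • A) {μ : ℂ} {v : M}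
    (hv : v ∈ weightSpace n M μ) (hv0 : v ≠ 0) (hk : ∃ k : ℕ, (A ^ k) v = 0) :
    ∃ ν, ∃ w ∈ weightSpace n M ν, w ≠ 0 ∧ A w = 0 := by
  obtain ⟨k, hk1, hk2⟩ := Nat.exists_not_and_succ_of_not_zero_of_exists
    (p := fun k => (A ^ k) v = 0) (by simpa using hv0) hk
  refine ⟨_, _, pow_map_mem_weightSpace hA k hv, hk1, ?_⟩
  rwa [← Module.End.mul_apply, ← pow_succ']

/-- The operator `fᵏ` brings `w` into the fixed weight space of weight `μ`, where `eᵏ` vanishes for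
large `k`. But `eᵏ fᵏ w` is `w` times the product of the `(j + 1)(μ + 2k - j)` for `j < k`, which is
nonzero for large `k`. -/
lemma exists_bound_ker_eS (hHC : IsHarishChandra n M) (he : ActsLocNilp M (eS n)) (μ : ℂ) :
    ∃ N : ℕ, ∀ k ≥ N, ∀ w ∈ weightSpace n M (μ + 2 * k), op n M (eS n) w = 0 → w = 0 := by
  have := hHC.finite μ
  obtain ⟨N, hN⟩ := exists_pow_eq_zero_of_finite (op n M (eS n)) he (weightSpace n M μ)
  -- The second bound makes every factor `μ + 2k - j` with `j < k` have positive real part.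
  refine ⟨max N ⌈-μ.re⌉₊, fun k hk w hw hew => ?_⟩
  have t := isSl2Ops_op (n := n) (M := M)
  have h1 := t.e_pow_f_pow (mem_weightSpace.1 hw) hew k
  have h2 : (op n M (fS n) ^ k) w ∈ weightSpace n M μ := by
    convert pow_map_mem_weightSpace t.hf k hw using 2
    ring
  rw [hN k ((le_max_left _ _).trans hk) _ h2] at h1
  refine (smul_eq_zero.1 h1.symm).resolve_left (Finset.prod_ne_zero_iff.2 fun j hj => ?_)
  refine mul_ne_zero (by exact_mod_cast Nat.succ_ne_zero j) fun h => ?_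
  have h3 := congrArg Complex.re h
  simp at h3
  have h4 : -μ.re ≤ k := (Nat.le_ceil _).trans (by exact_mod_cast (le_max_right _ _).trans hk)
  have h5 : (j : ℝ) < k := by exact_mod_cast Finset.mem_range.1 hj
  linarith

/-- If `e` acts locally nilpotently, then there is a weight vector annihilated by `e` and all
`xᵢ`. -/
lemma exists_vacuum [Nontrivial M] (hHC : IsHarishChandra n M) (he : ActsLocNilp M (eS n)) :
    ∃ ν, ∃ v ∈ weightSpace n M ν, v ≠ 0 ∧ op n M (eS n) v = 0 ∧ ∀ i, op n M (xS i) v = 0 := by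
  obtain ⟨μ₀, v₀, hv₀, hv₀'⟩ := exists_weight_vector hHC
  obtain ⟨μ, v, hv, hv0, hev⟩ := exists_killed_weight_vector (isSl2Ops_op (n := n)).he hv₀ hv₀'
    (he v₀)
  obtain ⟨N₁, hN₁⟩ := exists_bound_ker_eS hHC he μ
  obtain ⟨N₂, hN₂⟩ := exists_bound_ker_eS hHC he (μ + 1)
  -- `p` holds at `0` and fails at `2 * N₁`, so there is some `k` with `p k` but not `p (k + 1)`.
  let p : ℕ → Prop := fun k => ∃ w ∈ weightSpace n M (μ + k), w ≠ 0 ∧ op n M (eS n) w = 0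
  have hp0 : p 0 := ⟨v, by simpa using hv, hv0, hev⟩
  have hbound : ∃ k, ¬ p k := by
    refine ⟨2 * N₁, ?_⟩
    rintro ⟨w, hw, hw0, hew⟩
    exact hw0 (hN₁ N₁ le_rfl w (by push_cast at hw; exact hw) hew)
  obtain ⟨k, hk1, hk2⟩ := Nat.exists_not_and_succ_of_not_zero_of_exists (p := fun k => ¬ p k)
    (not_not.2 hp0) hbound
  obtain ⟨w, hw, hw0, hew⟩ := not_not.1 hk1
  refine ⟨_, w, hw, hw0, hew, fun i => ?_⟩
  -- Each `xᵢ` raises the weight by one and commutes with `e`, so a nonzero `xᵢ w` would witness `p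
  -- (k + 1)`.
  by_contra hne
  refine hk2 ⟨op n M (xS i) w, ?_, hne, ?_⟩
  · convert map_mem_weightSpace (weight_xS i) hw using 2
    push_cast
    ring
  · have h := op_comm_of_lie (M := M) (c := 0) (by rw [eS_lie_xS i, zero_smul])
    have h' := LinearMap.congr_fun h w
    simpa [hew] using h'

end Weights

/-! ### The polynomial representation -/

section Poly
variable {n : ℕ} {M : Type*} [AddCommGroup M] [Module ℂ M]

/-- Equivariance under the Weyl algebra can be checked on generators. -/
lemma equivariant_of_generators {P : Type*} [AddCommGroup P] [Module ℂ P]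
    (σ : Weyl n →ₐ[ℂ] Module.End ℂ M) (ρ : Weyl n →ₐ[ℂ] Module.End ℂ P)
    (ev : P →ₗ[ℂ] Module.End ℂ M) (w : M)
    (ht : ∀ i p, σ (Weyl.t i) (ev p w) = ev (ρ (Weyl.t i) p) w)
    (hd : ∀ i p, σ (Weyl.d i) (ev p w) = ev (ρ (Weyl.d i) p) w) (a : Weyl n) :
    ∀ p, σ a (ev p w) = ev (ρ a p) w := by
  obtain ⟨a, rfl⟩ : ∃ b, Weyl.mk n b = a := RingQuot.mkAlgHom_surjective ℂ (WeylRel n) a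
  induction a using FreeAlgebra.induction with
  | grade0 c =>
    intro p
    rw [AlgHom.commutes, AlgHom.commutes, AlgHom.commutes, Module.algebraMap_end_apply,
      Module.algebraMap_end_apply, map_smul, LinearMap.smul_apply]
  | grade1 x =>
    rcases x with i | i
    exacts [ht i, hd i]
  | mul a b ha hb =>
    intro p
    rw [map_mul, map_mul, map_mul, Module.End.mul_apply, Module.End.mul_apply, hb, ha]
  | add a b ha hb =>
    intro p
    rw [map_add, map_add, map_add, LinearMap.add_apply, LinearMap.add_apply, ha, hb, map_add,
      LinearMap.add_apply]

lemma algHom_t_comm (σ : Weyl n →ₐ[ℂ] Module.End ℂ M) (i j : Fin n) :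
    σ (Weyl.t i) * σ (Weyl.t j) = σ (Weyl.t j) * σ (Weyl.t i) := by
  have h := Weyl.lie_tt i j
  rw [Ring.lie_def, sub_eq_zero] at h
  rw [← map_mul, ← map_mul, h]

lemma algHom_dt (σ : Weyl n →ₐ[ℂ] Module.End ℂ M) (i j : Fin n) :
    σ (Weyl.d i) * σ (Weyl.t j) = σ (Weyl.t j) * σ (Weyl.d i) + if i = j then 1 else 0 := by
  have h := Weyl.lie_dt i j
  rw [Ring.lie_def, sub_eq_iff_eq_add'] at h
  rw [← map_mul, h, map_add, map_mul]
  split_ifs <;> simp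

/-- Polynomials in the commuting operators `σ(tᵢ)`. -/
def polyEv (σ : Weyl n →ₐ[ℂ] Module.End ℂ M) : MvPolynomial (Fin n) ℂ →ₐ[ℂ] Module.End ℂ M :=
  -- `MvPolynomial.aeval` needs a commutative target; the subalgebra generated by the commuting
  -- `σ(tᵢ)` is one.
  letI : CommRing (Algebra.adjoin ℂ (Set.range fun i => σ (Weyl.t i))) :=
    { Subalgebra.toRing _ with
      mul_comm := (Algebra.isMulCommutative_adjoin ℂ (by
        rintro _ ⟨i, rfl⟩ _ ⟨j, rfl⟩
        exact algHom_t_comm σ i j)).is_comm.comm }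
  (Algebra.adjoin ℂ (Set.range fun i => σ (Weyl.t i))).val.comp
    (MvPolynomial.aeval fun i => ⟨σ (Weyl.t i), Algebra.subset_adjoin ⟨i, rfl⟩⟩)

@[simp] lemma polyEv_X (σ : Weyl n →ₐ[ℂ] Module.End ℂ M) (i : Fin n) :
    polyEv σ (MvPolynomial.X i) = σ (Weyl.t i) := by
  simp [polyEv]

@[simp] lemma polyRep_t (i : Fin n) (p : MvPolynomial (Fin n) ℂ) :
    polyRep n (Weyl.t i) p = MvPolynomial.X i * p := by
  simp [polyRep]

@[simp] lemma polyRep_d (i : Fin n) (p : MvPolynomial (Fin n) ℂ) :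
    polyRep n (Weyl.d i) p = MvPolynomial.pderiv i p := by
  simp [polyRep]

lemma commute_polyEv (σ : Weyl n →ₐ[ℂ] Module.End ℂ M) (Y : Module.End ℂ M)
    (hY : ∀ a, Y * σ a = σ a * Y) (p : MvPolynomial (Fin n) ℂ) :
    Y * polyEv σ p = polyEv σ p * Y := by
  induction p using MvPolynomial.induction_on with
  | C c =>
    rw [← MvPolynomial.algebraMap_eq, AlgHom.commutes]
    exact (Algebra.commutes c Y).symm
  | add p q hp hq => rw [map_add, mul_add, add_mul, hp, hq]
  | mul_X p i hp => rw [map_mul, polyEv_X, ← mul_assoc, hp, mul_assoc, hY, mul_assoc]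

/-- Commuting with `σ(∂ᵢ)` and differentiating both obey the Leibniz rule, and they agree on
variables by the Weyl relation. On a vector killed by `∂ᵢ` only the derivative survives. -/
lemma d_polyEv (σ : Weyl n →ₐ[ℂ] Module.End ℂ M) (i : Fin n) (p : MvPolynomial (Fin n) ℂ) :
    σ (Weyl.d i) * polyEv σ p = polyEv σ p * σ (Weyl.d i) + polyEv σ (MvPolynomial.pderiv i p) := by
  induction p using MvPolynomial.induction_on with
  | C c =>
    rw [MvPolynomial.pderiv_C, map_zero, add_zero, ← MvPolynomial.algebraMap_eq, AlgHom.commutes]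
    exact (Algebra.commutes c _).symm
  | add p q hp hq => simp only [map_add, mul_add, add_mul, hp, hq]; abel
  | mul_X p j hp =>
    rw [map_mul, polyEv_X, ← mul_assoc, hp, add_mul, mul_assoc, algHom_dt, Derivation.leibniz,
      map_add, smul_eq_mul, smul_eq_mul, map_mul, map_mul, polyEv_X, mul_add, mul_assoc]
    have h1 : σ (Weyl.t j) * polyEv σ (MvPolynomial.pderiv i p) =
        polyEv σ (MvPolynomial.pderiv i p) * σ (Weyl.t j) := by
      rw [← polyEv_X, ← map_mul, ← map_mul, mul_comm]
    rw [h1]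
    by_cases hij : i = j
    · subst hij
      simp [add_assoc]
    · simp [hij, MvPolynomial.pderiv_X_of_ne (Ne.symm hij)]

/-- The vectors killed by all `∂ᵢ`. -/
def vacuumSpace (σ : Weyl n →ₐ[ℂ] Module.End ℂ M) : Submodule ℂ M :=
  ⨅ i, LinearMap.ker (σ (Weyl.d i))

lemma mem_vacuumSpace {σ : Weyl n →ₐ[ℂ] Module.End ℂ M} {w : M} :
    w ∈ vacuumSpace σ ↔ ∀ i, σ (Weyl.d i) w = 0 := by
  simp [vacuumSpace]

lemma vacuumSpace_stable {σ : Weyl n →ₐ[ℂ] Module.End ℂ M} {Y : Module.End ℂ M}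
    (hY : ∀ a, Y * σ a = σ a * Y) : ∀ w ∈ vacuumSpace σ, Y w ∈ vacuumSpace σ := by
  intro w hw
  rw [mem_vacuumSpace] at hw ⊢
  intro i
  rw [← Module.End.mul_apply, ← hY, Module.End.mul_apply, hw, map_zero]

lemma polyEv_equivariant (σ : Weyl n →ₐ[ℂ] Module.End ℂ M) (a : Weyl n)
    (p : MvPolynomial (Fin n) ℂ) : ∀ w ∈ vacuumSpace σ,
    σ a (polyEv σ p w) = polyEv σ (polyRep n a p) w := by
  intro w hw
  refine equivariant_of_generators σ (polyRep n) (polyEv σ).toLinearMap w (fun i p => ?_)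
    (fun i p => ?_) a p
  · simp
  · have h := LinearMap.congr_fun (d_polyEv σ i p) w
    simpa [mem_vacuumSpace.1 hw i] using h

/-- Differentiating in a variable which occurs lowers the degree and multiplies the coefficient by a
nonzero exponent; allowing any nonzero `c` absorbs this factor in the induction. -/
lemma polyEv_monomial_faithful (σ : Weyl n →ₐ[ℂ] Module.End ℂ M) {w : M}
    (hw : w ∈ vacuumSpace σ) : ∀ (k : ℕ) (α : Fin n →₀ ℕ), α.degree = k → ∀ c : ℂ, c ≠ 0 →
      polyEv σ (MvPolynomial.monomial α c) w = 0 → w = 0 := by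
  intro k
  induction k with
  | zero =>
    intro α hα c hc h
    rw [Finsupp.degree_eq_zero_iff] at hα
    subst hα
    change polyEv σ (MvPolynomial.C c) w = 0 at h
    rw [← MvPolynomial.algebraMap_eq, AlgHom.commutes, Module.algebraMap_end_apply] at h
    exact (smul_eq_zero.1 h).resolve_left hc
  | succ k ih =>
    intro α hα c hc h
    obtain ⟨i, hi⟩ : ∃ i, α i ≠ 0 := by
      by_contra! h0
      have : α = 0 := Finsupp.ext h0
      simp [this] at hα
    have h1 := polyEv_equivariant σ (Weyl.d i) (MvPolynomial.monomial α c) w hw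
    rw [h, map_zero, polyRep_d, MvPolynomial.pderiv_monomial] at h1
    refine ih (α - Finsupp.single i 1) ?_ (c * α i) (mul_ne_zero hc (by exact_mod_cast hi)) h1.symm
    have h2 : α - Finsupp.single i 1 + Finsupp.single i 1 = α :=
      tsub_add_cancel_of_le (by simpa [Nat.one_le_iff_ne_zero] using hi)
    have h3 := congrArg Finsupp.degree h2
    rw [map_add, Finsupp.degree_single, hα] at h3
    omega

/-- The Euler operators `tᵢ ∂ᵢ` have the exponents as eigenvalues, so together they separate
monomials. -/
lemma polyEv_injective (σ : Weyl n →ₐ[ℂ] Module.End ℂ M) :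
    Function.Injective (evTensor (vacuumSpace σ) (polyEv σ).toLinearMap) := by
  refine evTensor_injective _ _ (MvPolynomial.basisMonomials (Fin n) ℂ)
    (fun i => σ (Weyl.t i * Weyl.d i)) (fun α i => (α i : ℂ)) ?_ ?_ ?_
  · intro α β h
    ext i
    exact Nat.cast_injective (R := ℂ) (congrFun h i)
  · intro α i w hw
    change σ _ (polyEv σ _ w) = _ • polyEv σ _ w
    rw [polyEv_equivariant σ _ _ w hw, map_mul, Module.End.mul_apply, polyRep_d, polyRep_t,
      MvPolynomial.coe_basisMonomials, MvPolynomial.X_mul_pderiv_monomial, map_nsmul,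
      LinearMap.smul_apply, Nat.cast_smul_eq_nsmul]
  · intro α w hw h
    refine polyEv_monomial_faithful σ hw _ α rfl 1 one_ne_zero ?_
    simpa using h

end Poly

/-! ### Locally nilpotent action of `e` -/

section Irreducible
variable {n : ℕ} {M : Type*} [AddCommGroup M] [Module ℂ M] [LieRingModule (Sch n) M]

lemma lieSpan_singleton_eq_top (hirr : LieModule.IsIrreducible ℂ (Sch n) M) {v : M} (hv : v ≠ 0) :
    LieSubmodule.lieSpan ℂ (Sch n) {v} = ⊤ :=
  (hirr.eq_bot_or_eq_top _).resolve_left fun h =>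
    hv (by simpa [h] using LieSubmodule.subset_lieSpan (R := ℂ) (L := Sch n) (s := {v}) rfl)

end Irreducible

section LocallyNilpotent
variable {n : ℕ} {M : Type*} [AddCommGroup M] [Module ℂ M] [LieRingModule (Sch n) M]
  [LieModule ℂ (Sch n) M] {r : ℂ} (hr : r ≠ 0) (hz : ∀ v : M, ⁅zS n, v⁆ = r ^ 2 • v)

lemma op_eS_eq : op n M (eS n) = sl2Res hr hz e₂ + weylOn hr hz (eW n) := by
  rw [op_eq' hr hz, theta_eS, show toSo n (eS n) = 0 from rfl, map_zero, add_zero]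
  rfl

lemma op_hS_eq : op n M (hS n) = sl2Res hr hz h₂ + weylOn hr hz (hW n) := by
  rw [op_eq' hr hz, theta_hS, show toSo n (hS n) = 0 from rfl, map_zero, add_zero]
  rfl

/-- Normal ordering produces the constant `n / 2`, which is the shift between weights for `h` and
for the residual `sl₂` on the vacuum space. -/
lemma hW_eq : hW n = -(∑ k : Fin n, Weyl.t k * Weyl.d k) - (n / 2 : ℂ) • 1 := by
  have h : ∀ k : Fin n, (Weyl.d k : Weyl n) * Weyl.t k = Weyl.t k * Weyl.d k + 1 := fun k => by
    have := Weyl.lie_dt k k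
    rwa [if_pos rfl, Ring.lie_def, sub_eq_iff_eq_add'] at this
  simp only [hW, h, Finset.sum_add_distrib, Finset.sum_const, Finset.card_univ, Fintype.card_fin]
  rw [← Nat.cast_smul_eq_nsmul ℂ]
  module

lemma mem_vacuumSpace_weylOn {w : M} :
    w ∈ vacuumSpace (weylOn hr hz) ↔ ∀ i, op n M (xS i) w = 0 := by
  rw [mem_vacuumSpace]
  refine forall_congr' fun i => ?_
  rw [weylOn_d, LinearMap.smul_apply, smul_eq_zero, or_iff_right (inv_ne_zero hr)]

lemma weylOn_eW_vacuum {w : M} (hw : w ∈ vacuumSpace (weylOn hr hz)) :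
    weylOn hr hz (eW n) w = 0 := by
  rw [mem_vacuumSpace] at hw
  simp only [eW, map_smul, map_sum, map_mul, LinearMap.smul_apply, LinearMap.sum_apply,
    Module.End.mul_apply, hw, map_zero, Finset.sum_const_zero, smul_zero]

lemma weylOn_hW_vacuum {w : M} (hw : w ∈ vacuumSpace (weylOn hr hz)) :
    weylOn hr hz (hW n) w = -(n / 2 : ℂ) • w := by
  rw [mem_vacuumSpace] at hw
  rw [hW_eq]
  simp only [map_sub, map_neg, map_smul, map_sum, map_mul, LinearMap.smul_apply,
    LinearMap.sum_apply, LinearMap.sub_apply, LinearMap.neg_apply, map_one, Module.End.one_apply,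
    Module.End.mul_apply, hw, map_zero, Finset.sum_const_zero, neg_zero, zero_sub, neg_smul]

/-- The distinguished basis index `0` is the constant polynomial `1`, which evaluates to the
identity. -/
lemma isSplitting_vacuum (hirr : LieModule.IsIrreducible ℂ (Sch n) M) :
    IsSplitting (weylOn hr hz) (polyRep n) (sl2Res hr hz) (soRes hr hz (M := M))
      (vacuumSpace (weylOn hr hz)) (polyEv (weylOn hr hz)).toLinearMap
      (MvPolynomial.basisMonomials (Fin n) ℂ) 0 where
  comm := sl2Res_soRes hr hz
  irr := jointlyIrreducible hr hz hirr
  stable_left X := vacuumSpace_stable (sl2Res_weylOn hr hz X)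
  stable_right B := vacuumSpace_stable (soRes_weylOn hr hz B)
  comm_left X p := commute_polyEv _ _ (sl2Res_weylOn hr hz X) p
  comm_right B p := commute_polyEv _ _ (soRes_weylOn hr hz B) p
  equivariant := polyEv_equivariant _
  faithful w hw h := polyEv_monomial_faithful _ hw _ 0 rfl 1 one_ne_zero (by simpa using h)
  injective := polyEv_injective _

/-- On the vacuum space the Weyl part of `e` vanishes and that of `h` is the scalar `-n / 2`. In
particular this multiplicity space sits in a single weight space, and so will be finite-dimensional.
-/
lemma mem_vacuum_hwSpace {w : M} {l : ℂ} :
    w ∈ vacuumSpace (weylOn hr hz) ⊓ hwSpace (sl2Res hr hz) l ↔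
      (∀ i, op n M (xS i) w = 0) ∧ op n M (eS n) w = 0 ∧
        w ∈ weightSpace n M (l - n / 2) := by
  rw [Submodule.mem_inf, ← mem_vacuumSpace_weylOn hr hz]
  refine and_congr_right fun hw => ?_
  rw [mem_hwSpace, mem_weightSpace, op_eS_eq hr hz, op_hS_eq hr hz, LinearMap.add_apply,
    LinearMap.add_apply, weylOn_eW_vacuum hr hz hw, weylOn_hW_vacuum hr hz hw, add_zero, sub_smul,
    neg_smul, ← sub_eq_add_neg, sub_left_inj]

/-- Assembling an equivalence with a triple tensor product from its components. -/
lemma nonempty_equiv_tensor₃ {V N L : Type*} [AddCommGroup V] [Module ℂ V]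
    [LieRingModule (So n) V] [LieModule ℂ (So n) V] [AddCommGroup N] [Module ℂ N]
    [LieRingModule Sl2 N] [LieModule ℂ Sl2 N] [AddCommGroup L] [Module ℂ L]
    (ρ : Weyl n →ₐ[ℂ] Module.End ℂ L) (Ψ : (V ⊗[ℂ] (N ⊗[ℂ] L)) ≃ₗ[ℂ] M)
    (h₁ : ∀ X v y p, Ψ (v ⊗ₜ (⁅X, y⁆ ⊗ₜ p)) = sl2Res hr hz X (Ψ (v ⊗ₜ (y ⊗ₜ p))))
    (h₂ : ∀ B v y p, Ψ (⁅B, v⁆ ⊗ₜ (y ⊗ₜ p)) = soRes hr hz B (Ψ (v ⊗ₜ (y ⊗ₜ p))))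
    (h₃ : ∀ a v y p, Ψ (v ⊗ₜ (y ⊗ₜ ρ a p)) = weylOn hr hz a (Ψ (v ⊗ₜ (y ⊗ₜ p)))) :
    Nonempty (M ≃ₗ⁅ℂ, Sch n⁆ Tensor₃ r V N ρ) := by
  let Ψ' : Tensor₃ r V N ρ ≃ₗ[ℂ] M :=
    TensorProduct.congr (Restr.equiv (toSo n) V)
      (TensorProduct.congr (Restr.equiv (toSl2 n) N)
        (Restr.equiv ((ρ : Weyl n →ₗ⁅ℂ⁆ Module.End ℂ L).comp (theta n r)) L)) ≪≫ₗ Ψ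
  have hΨ : ∀ (X : Sch n) (x : Tensor₃ r V N ρ), Ψ' ⁅X, x⁆ = ⁅X, Ψ' x⁆ := by
    intro X x
    induction x using TensorProduct.induction_on with
    | zero => simp
    | add x y hx hy => simp only [lie_add, map_add, hx, hy]
    | tmul v x =>
      induction x using TensorProduct.induction_on with
      | zero => simp
      | add x y hx hy => simp only [TensorProduct.tmul_add, lie_add, map_add, hx, hy]
      | tmul y p =>
        have h := LinearMap.congr_fun (op_eq' hr hz (M := M) X) (Ψ' (v ⊗ₜ (y ⊗ₜ p)))
        refine Eq.trans ?_ h.symm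
        rw [TensorProduct.LieModule.lie_tmul_right, TensorProduct.LieModule.lie_tmul_right,
          TensorProduct.tmul_add, map_add, map_add]
        simp only [LinearMap.add_apply]
        rw [add_left_comm, ← add_assoc]
        congr 1
        · congr 1
          · exact h₁ _ _ _ _
          · exact h₂ _ _ _ _
        · exact h₃ _ _ _ _
  exact ⟨LieModuleEquiv.symm { Ψ' with map_lie' := fun {X x} => hΨ X x }⟩

/-- A finite-dimensional invariant subspace realized on some `ℂᵈ`. -/
def coordHom {L : Type*} [LieRing L] [LieAlgebra ℂ L] (κ : L →ₗ⁅ℂ⁆ Module.End ℂ M)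
    (U : Submodule ℂ M) (h : ∀ X, ∀ w ∈ U, κ X w ∈ U) {d : ℕ} (φ : U ≃ₗ[ℂ] (Fin d → ℂ)) :
    L →ₗ⁅ℂ⁆ Module.End ℂ (Fin d → ℂ) :=
  (φ.lieConj : Module.End ℂ U →ₗ⁅ℂ⁆ Module.End ℂ (Fin d → ℂ)).comp (restrictHom κ U h)

lemma coe_symm_coordHom {L : Type*} [LieRing L] [LieAlgebra ℂ L] (κ : L →ₗ⁅ℂ⁆ Module.End ℂ M)
    (U : Submodule ℂ M) (h : ∀ X, ∀ w ∈ U, κ X w ∈ U) {d : ℕ} (φ : U ≃ₗ[ℂ] (Fin d → ℂ)) (X : L)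
    (v : Fin d → ℂ) : (φ.symm (coordHom κ U h φ X v) : M) = κ X (φ.symm v) := by
  simp [coordHom, LinearEquiv.lieConj_apply]

theorem highestWeight_of_locNilp (hirr : LieModule.IsIrreducible ℂ (Sch n) M)
    (hHC : IsHarishChandra n M) (he : ActsLocNilp M (eS n)) : IsHighestWeight n M := by
  have : Nontrivial M := (LieSubmodule.nontrivial_iff ℂ (Sch n) M).1 hirr.toNontrivial
  obtain ⟨ν, v, hv, hv0, hev, hxv⟩ := exists_vacuum hHC he
  refine ⟨ν, v, hv, hv0, fun x hx => ?_, lieSpan_singleton_eq_top hirr hv0⟩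
  refine Submodule.span_induction ?_ (zero_lie v) (fun a b _ _ ha hb => ?_)
    (fun c a _ ha => ?_) hx
  · rintro _ (rfl | ⟨i, rfl⟩)
    exacts [hev, hxv i]
  · rw [add_lie, ha, hb, add_zero]
  · rw [smul_lie, ha, smul_zero]

include hr hz in
theorem tensor_of_locNilp (hirr : LieModule.IsIrreducible ℂ (Sch n) M)
    (hHC : IsHarishChandra n M) (he : ActsLocNilp M (eS n)) :
    ∃ (V : Type) (_ : AddCommGroup V) (_ : Module ℂ V) (_ : LieRingModule (So n) V)
      (_ : LieModule ℂ (So n) V) (l : ℂ),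
      FiniteDimensional ℂ V ∧ LieModule.IsIrreducible ℂ (So n) V ∧
      Nonempty (M ≃ₗ⁅ℂ, Sch n⁆ Tensor₃ r V (LSl2 l) (polyRep n)) := by
  have : Nontrivial M := (LieSubmodule.nontrivial_iff ℂ (Sch n) M).1 hirr.toNontrivial
  obtain ⟨ν, v, hv, hv0, hev, hxv⟩ := exists_vacuum hHC he
  have hS := isSplitting_vacuum hr hz hirr
  set l : ℂ := ν + n / 2 with hl
  set U := vacuumSpace (weylOn hr hz) ⊓ hwSpace (sl2Res hr hz) l with hU
  have hvU : v ∈ U := (mem_vacuum_hwSpace hr hz).2 ⟨hxv, hev, by rwa [hl, add_sub_cancel_right]⟩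
  have hne : U ≠ ⊥ := (Submodule.ne_bot_iff U).2 ⟨v, hvU, hv0⟩
  have hUs : ∀ B, ∀ w ∈ U, soRes hr hz B w ∈ U := fun B w hw =>
    ⟨hS.stable_right B w hw.1, map_mem_hwSpace (sl2Res_soRes hr hz) B hw.2⟩
  have := hHC.finite (l - n / 2)
  have hfin : FiniteDimensional ℂ U := Submodule.finiteDimensional_of_le
    (S₂ := weightSpace n M (l - n / 2)) fun w hw => ((mem_vacuum_hwSpace hr hz).1 hw).2.2
  -- The space `U` lives in the universe of `M`; coordinates move it to some `ℂᵈ`, which lies in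
  -- `Type` as the statement demands.
  let φ : U ≃ₗ[ℂ] (Fin (Module.finrank ℂ U) → ℂ) := (Module.finBasis ℂ U).equivFun
  let ψ := coordHom (soRes hr hz) U hUs φ
  let i : Restr ψ (Fin (Module.finrank ℂ U) → ℂ) →ₗ[ℂ] M :=
    U.subtype.comp (φ.symm.toLinearMap.comp (Restr.equiv ψ _).toLinearMap)
  have hi : Function.Injective i := U.injective_subtype.comp
    (φ.symm.injective.comp (Restr.equiv ψ _).injective)
  have hrange : LinearMap.range i = U := by
    refine le_antisymm ?_ fun w hw => ?_
    · rintro _ ⟨w, rfl⟩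
      exact Subtype.property _
    · exact ⟨(Restr.equiv ψ _).symm (φ ⟨w, hw⟩), by simp [i]⟩
  have hi_lie : ∀ (B : So n) w, i ⁅B, w⁆ = soRes hr hz B (i w) := fun B w =>
    coe_symm_coordHom (soRes hr hz) U hUs φ B _
  obtain ⟨Ψ, h1, h2, h3⟩ := hS.exists_equiv i hi hrange hne
  refine ⟨Restr ψ (Fin (Module.finrank ℂ U) → ℂ), inferInstance, inferInstance, inferInstance,
    inferInstance, l, ?_, ?_, nonempty_equiv_tensor₃ hr hz (polyRep n) Ψ h1
      (fun B v y p => h2 B v _ y p (hi_lie B v)) h3⟩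
  · exact inferInstanceAs (FiniteDimensional ℂ (Fin (Module.finrank ℂ U) → ℂ))
  · have hnt : Nontrivial (Restr ψ (Fin (Module.finrank ℂ U) → ℂ)) := by
      obtain ⟨u, hu⟩ : v ∈ LinearMap.range i := hrange.ge hvU
      exact nontrivial_of_ne u 0 fun h => hv0 (by rw [← hu, h, map_zero])
    refine LieModule.IsIrreducible.mk fun N hN => ?_
    rcases hS.hw_irreducible l (N.toSubmodule.map i)
      (LinearMap.map_le_range.trans hrange.le) (by
        rintro B _ ⟨w, hw, rfl⟩
        exact ⟨⁅B, w⁆, N.lie_mem hw, hi_lie B w⟩) with h | h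
    · refine absurd ?_ hN
      rw [← LieSubmodule.toSubmodule_eq_bot]
      exact Submodule.map_injective_of_injective hi (h.trans (Submodule.map_bot _).symm)
    · rw [← LieSubmodule.toSubmodule_eq_top]
      refine Submodule.map_injective_of_injective hi ?_
      rw [h, Submodule.map_top, hrange]

end LocallyNilpotent

/-! ### Twisting by `τ` -/

section Twist
variable {n : ℕ} {M : Type*} [AddCommGroup M] [Module ℂ M] [LieRingModule (Sch n) M]

variable (n M) in
/-- The twisted module. -/
abbrev Twist : Type _ := Restr (tau n : Sch n →ₗ⁅ℂ⁆ Sch n) M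

/-- The identification of the twisted module with the module. -/
def untwist : Twist n M ≃ₗ[ℂ] M := Restr.equiv (tau n : Sch n →ₗ⁅ℂ⁆ Sch n) M

lemma untwist_lie (X : Sch n) (m : Twist n M) : untwist ⁅X, m⁆ = ⁅tau n X, untwist m⁆ := rfl

variable [LieModule ℂ (Sch n) M]

lemma twist_isIrreducible (hirr : LieModule.IsIrreducible ℂ (Sch n) M) :
    LieModule.IsIrreducible ℂ (Sch n) (Twist n M) := by
  have hM : Nontrivial M := (LieSubmodule.nontrivial_iff ℂ (Sch n) M).1 hirr.toNontrivial
  have : Nontrivial (Twist n M) := hM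
  refine LieModule.IsIrreducible.mk fun N hN => ?_
  let N' : LieSubmodule ℂ (Sch n) M :=
    { N.toSubmodule.comap (untwist (n := n) (M := M)).symm.toLinearMap with
      lie_mem := by
        intro X w hw
        have h := N.lie_mem (x := (tau n).symm X) hw
        have h'' : ⁅(tau n).symm X, (untwist (n := n) (M := M)).symm w⁆ =
            (untwist (n := n) (M := M)).symm ⁅X, w⁆ := by
          apply (untwist (n := n) (M := M)).injective
          rw [untwist_lie, LieEquiv.apply_symm_apply, LinearEquiv.apply_symm_apply,
            LinearEquiv.apply_symm_apply]
        change (untwist (n := n) (M := M)).symm ⁅X, w⁆ ∈ N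
        rw [← h'']
        exact h }
  rcases hirr.eq_bot_or_eq_top N' with h | h
  · refine absurd ((LieSubmodule.eq_bot_iff N).2 fun w hw => ?_) hN
    exact (LieSubmodule.eq_bot_iff N').1 h w hw
  · refine eq_top_iff.2 fun w _ => ?_
    have : untwist w ∈ N' := h ▸ LieSubmodule.mem_top (R := ℂ) (L := Sch n) (M := M) _
    exact this

lemma twist_weightSpace (μ : ℂ) : weightSpace n (Twist n M) μ =
    (weightSpace n M (-μ)).comap (untwist (n := n) (M := M)).toLinearMap := by
  ext w
  rw [mem_weightSpace, Submodule.mem_comap, mem_weightSpace, ← untwist.injective.eq_iff,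
    map_smul]
  change untwist ⁅hS n, w⁆ = μ • untwist w ↔ ⁅hS n, untwist w⁆ = -μ • untwist w
  rw [untwist_lie, tau_hS, neg_lie, neg_smul, neg_eq_iff_eq_neg]

lemma twist_weightSpace' : weightSpace n (Twist n M) = fun μ => (weightSpace n M (-μ)).map
    (untwist (n := n) (M := M)).symm.toLinearMap := by
  ext1 μ
  rw [twist_weightSpace]
  exact (Submodule.map_equiv_eq_comap_symm (untwist (n := n) (M := M)).symm _).symm

lemma twist_isHarishChandra (hHC : IsHarishChandra n M) : IsHarishChandra n (Twist n M) where
  isInternal := by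
    rw [DirectSum.isInternal_submodule_iff_iSupIndep_and_iSup_eq_top]
    refine ⟨Module.End.eigenspaces_iSupIndep _, ?_⟩
    have h : ⨆ μ, weightSpace n M (-μ) = ⨆ μ, weightSpace n M μ :=
      (Equiv.neg ℂ).iSup_comp (g := weightSpace n M)
    rw [twist_weightSpace', ← Submodule.map_iSup, h, iSup_weightSpace hHC, Submodule.map_top,
      LinearEquiv.range]
  finite μ := by
    have := hHC.finite (-μ)
    rw [twist_weightSpace']
    infer_instance

lemma twist_locNilp (hf : ActsLocNilp M (fS n)) : ActsLocNilp (Twist n M) (eS n) := by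
  intro v
  obtain ⟨k, hk⟩ := hf (untwist v)
  refine ⟨k, ?_⟩
  have h : ∀ (j : ℕ) (w : Twist n M), untwist ((op n (Twist n M) (eS n) ^ j) w) =
      (-1 : ℂ) ^ j • (op n M (fS n) ^ j) (untwist w) := by
    intro j
    induction j with
    | zero => simp
    | succ j ih =>
      intro w
      rw [pow_succ, Module.End.mul_apply, ih, pow_succ (op n M (fS n)), Module.End.mul_apply]
      have h1 : untwist (op n (Twist n M) (eS n) w) = -op n M (fS n) (untwist w) := by
        change untwist ⁅eS n, w⁆ = -⁅fS n, untwist w⁆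
        rw [untwist_lie, tau_eS, neg_lie]
      rw [h1, map_neg, pow_succ]
      simp
  apply untwist.injective
  rw [h, hk, smul_zero, map_zero]

lemma tau_zS : tau n (zS n) = zS n := by
  refine LieAlgebra.SemiDirectSum.ext ?_ (Prod.ext (Subtype.ext ?_) rfl)
  · ext <;> simp [tau_apply, zS]
  · ext i j; simp [tau_apply, zS, negT_val]

lemma twist_zS {c : ℂ} (hz : ∀ v : M, ⁅zS n, v⁆ = c • v) (v : Twist n M) :
    ⁅zS n, v⁆ = c • v := by
  apply untwist.injective
  rw [untwist_lie, tau_zS, hz, map_smul]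

/-- `τ` sends `e` and `xᵢ` to `-f` and `-yᵢ` and negates `h`, so the same vector serves, with the
opposite weight; it generates because `M` is irreducible. -/
lemma lowestWeight_of_twist (h : IsHighestWeight n (Twist n M))
    (hirr : LieModule.IsIrreducible ℂ (Sch n) M) : IsLowestWeight n M := by
  obtain ⟨μ, v, hv, hv0, hpos, -⟩ := h
  rw [twist_weightSpace] at hv
  have hpos' : ∀ x ∈ sPos n, ⁅tau n x, untwist v⁆ = 0 := fun x hx => by
    rw [← untwist_lie, hpos x hx, map_zero]
  have hv0' : untwist v ≠ 0 := by simpa using hv0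
  refine ⟨-μ, untwist v, hv, hv0', fun x hx => ?_, lieSpan_singleton_eq_top hirr hv0'⟩
  refine Submodule.span_induction ?_ (zero_lie _) (fun a b _ _ ha hb => ?_)
    (fun c a _ ha => ?_) hx
  · rintro _ (rfl | ⟨i, rfl⟩)
    · have h1 := hpos' (eS n) (Submodule.subset_span (Set.mem_insert _ _))
      rwa [tau_eS, neg_lie, neg_eq_zero] at h1
    · have h1 := hpos' (xS i) (Submodule.subset_span (Set.mem_insert_of_mem _ ⟨i, rfl⟩))
      rwa [tau_xS, neg_lie, neg_eq_zero] at h1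
  · rw [add_lie, ha, hb, add_zero]
  · rw [smul_lie, ha, smul_zero]

end Twist

/-! ### Injective action of `e` and `f` -/

section LinearAlgebra
variable {W : Type*} [AddCommGroup W] [Module ℂ W]

/-- A finite-dimensional space does not contain eigenvectors for infinitely many eigenvalues. -/
lemma exists_eq_zero_of_eigenvalues (A : Module.End ℂ W) (U : Submodule ℂ W)
    [FiniteDimensional ℂ U] (χ : ℕ → ℂ) (hχ : Function.Injective χ) (u : ℕ → W)
    (hU : ∀ k, u k ∈ U) (hu : ∀ k, A (u k) = χ k • u k) : ∃ k, u k = 0 := by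
  by_contra! h
  have h1 : LinearIndependent ℂ u := Module.End.eigenvectors_linearIndependent' A χ hχ u
    fun k => ⟨Module.End.mem_eigenspace_iff.2 (hu k), h k⟩
  have h2 : LinearIndependent ℂ (fun k => (⟨u k, hU k⟩ : U)) :=
    LinearIndependent.of_comp U.subtype h1
  exact h2.lt_aleph0_of_finite.ne Cardinal.mk_nat

/-- A scalar commutator means `Aᵏ⁺¹ B = B Aᵏ⁺¹ + (k + 1) c Aᵏ`, so `B` raises the order of
nilpotency by at most one. -/
lemma pow_succ_apply_of_commutator {A B : Module.End ℂ W} {c : ℂ} (h : A * B - B * A = c • 1)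
    (k : ℕ) : ∀ v, (A ^ k) v = 0 → (A ^ (k + 1)) (B v) = 0 := by
  induction k with
  | zero => intro v hv; simp at hv; simp [hv]
  | succ k ih =>
    intro v hv
    have h1 := LinearMap.congr_fun h v
    simp only [LinearMap.sub_apply, Module.End.mul_apply, LinearMap.smul_apply,
      Module.End.one_apply, sub_eq_iff_eq_add] at h1
    rw [pow_succ A (k + 1), Module.End.mul_apply, h1, map_add, map_smul, hv, smul_zero, zero_add]
    exact ih _ (by rwa [← Module.End.mul_apply, ← pow_succ])

/-- If an operator has scalar commutators with operators without common invariant subspaces and is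
not injective, then it is locally nilpotent. -/
lemma locNilp_of_apply_eq_zero {G S : Type*} {κ : G → Module.End ℂ W} {s : S → Module.End ℂ W}
    (hirr : JointlyIrreducible κ s) (A : Module.End ℂ W)
    (hκ : ∀ g, ∃ c : ℂ, A * κ g - κ g * A = c • 1) (hs : ∀ g, ∃ c : ℂ, A * s g - s g * A = c • 1)
    {w : W} (hw : w ≠ 0) (hAw : A w = 0) (v : W) : ∃ k : ℕ, (A ^ k) v = 0 := by
  have hmem : ∀ u, u ∈ A.maxGenEigenspace 0 ↔ ∃ k : ℕ, (A ^ k) u = 0 := fun u => by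
    simp [Module.End.mem_maxGenEigenspace]
  -- The vectors killed by a power of `A` form an invariant subspace, and it contains `w ≠ 0`.
  have hstab : ∀ B : Module.End ℂ W, (∃ c : ℂ, A * B - B * A = c • 1) →
      ∀ u ∈ A.maxGenEigenspace 0, B u ∈ A.maxGenEigenspace 0 := by
    rintro B ⟨c, hc⟩ u hu
    rw [hmem] at hu ⊢
    obtain ⟨k, hk⟩ := hu
    exact ⟨k + 1, pow_succ_apply_of_commutator hc k u hk⟩
  have hwA : w ∈ A.maxGenEigenspace 0 := (hmem w).2 ⟨1, by simpa using hAw⟩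
  rcases hirr (A.maxGenEigenspace 0) (fun g => hstab _ (hκ g)) (fun g => hstab _ (hs g)) with h | h
  · rw [h] at hwA
    exact absurd hwA hw
  · exact (hmem v).1 (h ▸ Submodule.mem_top)

lemma pow_apply_eq_zero {A : Module.End ℂ W} (hA : ∀ w, A w = 0 → w = 0) (k : ℕ) :
    ∀ w, (A ^ k) w = 0 → w = 0 := by
  induction k with
  | zero => intro w hw; simpa using hw
  | succ k ih =>
    intro w hw
    rw [pow_succ', Module.End.mul_apply] at hw
    exact ih w (hA _ hw)

end LinearAlgebra

/-! ### Passing to generators of the Weyl algebra -/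

section Generators
variable {n : ℕ} {M : Type*} [AddCommGroup M] [Module ℂ M]

/-- A subspace stable under the generators of the Weyl algebra is stable under the Weyl algebra. -/
lemma jointlyIrreducible_generators {G : Type*} {κ : G → Module.End ℂ M}
    (σ : Weyl n →ₐ[ℂ] Module.End ℂ M) (h : JointlyIrreducible κ σ) :
    JointlyIrreducible κ (Sum.elim (fun i => σ (Weyl.t i)) (fun i => σ (Weyl.d i))) := by
  intro N hN₁ hN₂
  refine h N hN₁ fun a => ?_
  obtain ⟨a, rfl⟩ : ∃ b, Weyl.mk n b = a := RingQuot.mkAlgHom_surjective ℂ (WeylRel n) a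
  induction a using FreeAlgebra.induction with
  | grade0 c =>
    intro w hw
    rw [AlgHom.commutes, AlgHom.commutes, Module.algebraMap_end_apply]
    exact N.smul_mem c hw
  | grade1 x =>
    rcases x with i | i
    exacts [hN₂ (Sum.inl i), hN₂ (Sum.inr i)]
  | mul a b ha hb =>
    intro w hw
    rw [map_mul, map_mul, Module.End.mul_apply]
    exact ha _ (hb w hw)
  | add a b ha hb =>
    intro w hw
    rw [map_add, map_add, LinearMap.add_apply]
    exact add_mem (ha w hw) (hb w hw)

lemma algHom_d_comm (σ : Weyl n →ₐ[ℂ] Module.End ℂ M) (i j : Fin n) :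
    σ (Weyl.d i) * σ (Weyl.d j) = σ (Weyl.d j) * σ (Weyl.d i) := by
  have h := Weyl.lie_dd i j
  rw [Ring.lie_def, sub_eq_zero] at h
  rw [← map_mul, ← map_mul, h]

end Generators

/-! ### Injectivity of `∂ᵢ` and `tᵢ`, and the bound on the rank -/

section Injective
variable {n : ℕ} {M : Type*} [AddCommGroup M] [Module ℂ M] [LieRingModule (Sch n) M]
  [LieModule ℂ (Sch n) M]

/-- If `A` is locally nilpotent, has a conjugate operator `B`, and commutes with an injective
operator `g` shifting weights in the opposite direction of `B²`, then weight spaces cannot be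
finite-dimensional. -/
lemma false_of_locNilp_of_injective [Nontrivial M] (hHC : IsHarishChandra n M)
    {A B g : Module.End ℂ M} {a b c k₀ : ℂ} (hk₀ : k₀ ≠ 0) (hAB : A * B - B * A = k₀ • 1)
    (hA : op n M (hS n) * A - A * op n M (hS n) = a • A)
    (hB : op n M (hS n) * B - B * op n M (hS n) = b • B)
    (hg : op n M (hS n) * g - g * op n M (hS n) = c • g) (hbc : 2 * b + c = 0)
    (hAg : Commute A g) (hinj : ∀ w, g w = 0 → w = 0) (hnil : ∀ v, ∃ k : ℕ, (A ^ k) v = 0) :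
    False := by
  obtain ⟨μ₀, v, hv, hv0⟩ := exists_weight_vector hHC
  obtain ⟨μ, w, hw, hw0, hAw⟩ := exists_killed_weight_vector hA hv hv0 (hnil v)
  have := hHC.finite μ
  obtain ⟨N, hN⟩ := exists_pow_eq_zero_of_finite A hnil (weightSpace n M μ)
  have h1 : A ((g ^ N) w) = 0 := by
    rw [← Module.End.mul_apply, (hAg.pow_right N).eq, Module.End.mul_apply, hAw, map_zero]
  -- `gᴺ w` is still killed by `A`, and `B²ᴺ` returns it to weight `μ`, where `A²ᴺ` is zero. Yet
  -- `A²ᴺ B²ᴺ` multiplies `gᴺ w` by a nonzero scalar.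
  have h2 := pow_pow_apply_of_commutator_eq A B k₀ hAB _ h1 (2 * N)
  have h3 : (B ^ (2 * N)) ((g ^ N) w) ∈ weightSpace n M μ := by
    convert pow_map_mem_weightSpace hB (2 * N) (pow_map_mem_weightSpace hg N hw) using 2
    push_cast
    linear_combination (-(N : ℂ)) * hbc
  rw [hN (2 * N) (by omega) _ h3] at h2
  exact hw0 (pow_apply_eq_zero hinj N w ((smul_eq_zero.1 h2.symm).resolve_left
    (mul_ne_zero (pow_ne_zero _ hk₀) (by exact_mod_cast Nat.factorial_ne_zero _))))

variable {r : ℂ} (hr : r ≠ 0) (hz : ∀ v : M, ⁅zS n, v⁆ = r ^ 2 • v)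

lemma weight_weylOn_d (i : Fin n) :
    op n M (hS n) * weylOn hr hz (Weyl.d i) - weylOn hr hz (Weyl.d i) * op n M (hS n) =
      (1 : ℂ) • weylOn hr hz (Weyl.d i) := by
  rw [weylOn_d, mul_smul_comm, smul_mul_assoc, ← smul_sub, weight_xS, smul_comm]

lemma weight_weylOn_t (i : Fin n) :
    op n M (hS n) * weylOn hr hz (Weyl.t i) - weylOn hr hz (Weyl.t i) * op n M (hS n) =
      (-1 : ℂ) • weylOn hr hz (Weyl.t i) := by
  rw [weylOn_t, mul_smul_comm, smul_mul_assoc, ← smul_sub, weight_yS, smul_comm]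

lemma commutator_elim_weylOn {g : Sl2 ⊕ So n} (a : Weyl n) :
    weylOn hr hz (M := M) a * Sum.elim (sl2Res hr hz) (soRes hr hz) g -
      Sum.elim (sl2Res hr hz) (soRes hr hz) g * weylOn hr hz a = (0 : ℂ) • 1 := by
  rw [zero_smul, sub_eq_zero]
  rcases g with X | B
  exacts [(sl2Res_weylOn hr hz X a).symm, (soRes_weylOn hr hz B a).symm]

/-- All commutators of `∂ᵢ` with the generating operators are scalar, so a kernel vector would make
it locally nilpotent. The contradiction uses `A = ∂ᵢ`, `B = tᵢ`, `g = e`, of weights `1`, `-1`, `2`.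
-/
lemma weylOn_d_injective (hirr : LieModule.IsIrreducible ℂ (Sch n) M)
    (hHC : IsHarishChandra n M) (he : ActsInj M (eS n)) (i : Fin n) (w : M)
    (hw : weylOn hr hz (Weyl.d i) w = 0) : w = 0 := by
  have : Nontrivial M := (LieSubmodule.nontrivial_iff ℂ (Sch n) M).1 hirr.toNontrivial
  by_contra hw0
  have hdt := algHom_dt (weylOn hr hz)
  have hnil := locNilp_of_apply_eq_zero
    (jointlyIrreducible_generators _ (jointlyIrreducible hr hz hirr)) (weylOn hr hz (Weyl.d i))
    (fun g => ⟨0, commutator_elim_weylOn hr hz _⟩) (by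
      rintro (j | j)
      · refine ⟨if i = j then 1 else 0, ?_⟩
        simp only [Sum.elim_inl, hdt i j, add_sub_cancel_left]
        split_ifs <;> simp
      · exact ⟨0, by rw [Sum.elim_inr, algHom_d_comm _ i j, sub_self, zero_smul]⟩) hw0 hw
  have hcomm : Commute (weylOn hr hz (Weyl.d i)) (op n M (eS n)) := by
    rw [weylOn_d]
    have h := op_comm_of_lie (M := M) (c := 0) (by rw [eS_lie_xS i, zero_smul])
    rw [zero_smul, sub_eq_zero] at h
    exact Commute.smul_left h.symm _
  exact false_of_locNilp_of_injective hHC one_ne_zero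
    (by rw [hdt i i, if_pos rfl, add_sub_cancel_left, one_smul]) (weight_weylOn_d hr hz i)
    (weight_weylOn_t hr hz i) isSl2Ops_op.he (by norm_num) hcomm
    (fun w hw => he (by simpa using hw)) hnil

/-- The mirror image, with `A = tᵢ`, `B = ∂ᵢ`, `g = f`, of weights `-1`, `1`, `-2`. -/
lemma weylOn_t_injective (hirr : LieModule.IsIrreducible ℂ (Sch n) M)
    (hHC : IsHarishChandra n M) (hf : ActsInj M (fS n)) (i : Fin n) (w : M)
    (hw : weylOn hr hz (Weyl.t i) w = 0) : w = 0 := by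
  have : Nontrivial M := (LieSubmodule.nontrivial_iff ℂ (Sch n) M).1 hirr.toNontrivial
  by_contra hw0
  have hdt := algHom_dt (weylOn hr hz)
  have hnil := locNilp_of_apply_eq_zero
    (jointlyIrreducible_generators _ (jointlyIrreducible hr hz hirr)) (weylOn hr hz (Weyl.t i))
    (fun g => ⟨0, commutator_elim_weylOn hr hz _⟩) (by
      rintro (j | j)
      · exact ⟨0, by rw [Sum.elim_inl, algHom_t_comm _ i j, sub_self, zero_smul]⟩
      · refine ⟨if j = i then -1 else 0, ?_⟩
        simp only [Sum.elim_inr, hdt j i, sub_add_cancel_left]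
        split_ifs <;> simp) hw0 hw
  have hcomm : Commute (weylOn hr hz (Weyl.t i)) (op n M (fS n)) := by
    rw [weylOn_t]
    have h := op_comm_of_lie (M := M) (c := 0) (by rw [fS_lie_yS i, zero_smul])
    rw [zero_smul, sub_eq_zero] at h
    exact Commute.smul_left h.symm _
  exact false_of_locNilp_of_injective hHC (neg_ne_zero.2 one_ne_zero)
    (by rw [hdt i i, if_pos rfl, sub_add_cancel_left, neg_one_smul]) (weight_weylOn_t hr hz i)
    (weight_weylOn_d hr hz i) isSl2Ops_op.hf (by norm_num) hcomm
    (fun w hw => hf (by simpa using hw)) hnil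

/-- `tᵢ ∂ⱼ` preserves weights. -/
lemma weylOn_td_mem (i j : Fin n) {μ : ℂ} {w : M} (hw : w ∈ weightSpace n M μ) :
    (weylOn hr hz (Weyl.t i) * weylOn hr hz (Weyl.d j)) w ∈ weightSpace n M μ := by
  have := map_mem_weightSpace (weight_weylOn_t hr hz i)
    (map_mem_weightSpace (weight_weylOn_d hr hz j) hw)
  rwa [add_neg_cancel_right] at this

lemma exists_eigenvector_td [Nontrivial M] (hHC : IsHarishChandra n M) (i : Fin n) :
    ∃ μ l : ℂ, ∃ v ∈ weightSpace n M μ, v ≠ 0 ∧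
      (weylOn hr hz (Weyl.t i) * weylOn hr hz (Weyl.d i)) v = l • v := by
  obtain ⟨μ, v, hv, hv0⟩ := exists_weight_vector hHC
  have := hHC.finite μ
  have : Nontrivial (weightSpace n M μ) :=
    nontrivial_of_ne (⟨v, hv⟩ : weightSpace n M μ) 0 fun h => hv0 (congrArg Subtype.val h)
  obtain ⟨l, hl⟩ := Module.End.exists_eigenvalue
    ((weylOn hr hz (Weyl.t i) * weylOn hr hz (Weyl.d i)).restrict
      (p := weightSpace n M μ) (q := weightSpace n M μ) fun w hw => weylOn_td_mem hr hz i i hw)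
  obtain ⟨w, hw⟩ := hl.exists_hasEigenvector
  refine ⟨μ, l, w, w.2, fun h => hw.2 (Subtype.ext h), ?_⟩
  simpa using congrArg Subtype.val (Module.End.mem_eigenspace_iff.1 hw.1)

include hr hz in
/-- If `e` and `f` act injectively, then the rank is at most one. -/
lemma rank_le_one_of_injective (hirr : LieModule.IsIrreducible ℂ (Sch n) M)
    (hHC : IsHarishChandra n M) (he : ActsInj M (eS n)) (hf : ActsInj M (fS n)) : n ≤ 1 := by
  have : Nontrivial M := (LieSubmodule.nontrivial_iff ℂ (Sch n) M).1 hirr.toNontrivial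
  by_contra! hn
  let i : Fin n := ⟨0, by omega⟩
  let j : Fin n := ⟨1, hn⟩
  have hij : i ≠ j := by simp [i, j]
  obtain ⟨μ, l, v, hv, hv0, hl⟩ := exists_eigenvector_td hr hz hHC i
  have := hHC.finite μ
  set σ := weylOn hr hz (M := M)
  have hcom : (σ (Weyl.t i) * σ (Weyl.d i)) * (σ (Weyl.t i) * σ (Weyl.d j)) -
      (σ (Weyl.t i) * σ (Weyl.d j)) * (σ (Weyl.t i) * σ (Weyl.d i)) =
        (1 : ℂ) • (σ (Weyl.t i) * σ (Weyl.d j)) := by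
    have h1 := algHom_dt σ i i
    have h2 := algHom_dt σ j i
    rw [if_neg hij.symm, add_zero] at h2
    rw [if_pos rfl] at h1
    rw [mul_assoc, ← mul_assoc (σ (Weyl.d i)), h1, mul_assoc (σ (Weyl.t i)) (σ (Weyl.d j)),
      ← mul_assoc (σ (Weyl.d j)), h2, mul_assoc, algHom_d_comm σ j i, one_smul]
    noncomm_ring
  -- The iterates of `tᵢ ∂ⱼ` on `v` stay in one weight space while the eigenvalue of `tᵢ ∂ᵢ` grows
  -- by one each time, so one of them vanishes, against injectivity.
  obtain ⟨k, hk⟩ := exists_eq_zero_of_eigenvalues (σ (Weyl.t i) * σ (Weyl.d i))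
    (weightSpace n M μ) (fun k => l + k * 1) (fun a b hab => by simpa using hab)
    (fun k => ((σ (Weyl.t i) * σ (Weyl.d j)) ^ k) v) (fun k => by
      induction k with
      | zero => simpa using hv
      | succ k ih =>
        rw [pow_succ', Module.End.mul_apply]
        exact weylOn_td_mem hr hz i j ih) (fun k => apply_pow_of_commutator hcom hl k)
  refine hv0 (pow_apply_eq_zero (fun w hw => ?_) k v hk)
  exact weylOn_d_injective hr hz hirr hHC he j w
    (weylOn_t_injective hr hz hirr hHC hf i _ hw)

end Injective

/-! ### The Laurent representation in rank one -/

section Laurent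
variable {M : Type*} [AddCommGroup M] [Module ℂ M] (σ : Weyl 1 →ₐ[ℂ] Module.End ℂ M)

/-- Laurent polynomials in an invertible operator. -/
def laurentEv (T : (Module.End ℂ M)ˣ) : ((Fin 1 → ℤ) →₀ ℂ) →ₗ[ℂ] Module.End ℂ M :=
  Finsupp.linearCombination ℂ fun m => ((T ^ m 0 : (Module.End ℂ M)ˣ) : Module.End ℂ M)

lemma laurentEv_single (T : (Module.End ℂ M)ˣ) (m : Fin 1 → ℤ) (c : ℂ) :
    laurentEv T (Finsupp.single m c) = c • ((T ^ m 0 : (Module.End ℂ M)ˣ) : Module.End ℂ M) := by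
  simp [laurentEv]

lemma unit_apply_injective (T : (Module.End ℂ M)ˣ) {w : M} (h : (T : Module.End ℂ M) w = 0) :
    w = 0 := by
  have := congrArg ((T⁻¹ : (Module.End ℂ M)ˣ) : Module.End ℂ M) h
  rwa [← Module.End.mul_apply, Units.inv_mul, map_zero] at this

lemma commute_laurentEv {T : (Module.End ℂ M)ˣ} {Y : Module.End ℂ M}
    (hY : Commute Y (T : Module.End ℂ M)) (p : (Fin 1 → ℤ) →₀ ℂ) :
    Y * laurentEv T p = laurentEv T p * Y := by
  induction p using Finsupp.induction_linear with
  | zero => simp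
  | add p q hp hq => rw [map_add, mul_add, add_mul, hp, hq]
  | single m c =>
    rw [laurentEv_single, mul_smul_comm, smul_mul_assoc, (hY.units_zpow_right (m 0)).eq]

variable {σ} {T : (Module.End ℂ M)ˣ} (hT : (T : Module.End ℂ M) = σ (Weyl.t 0))
include hT

/-- The relation for `T` extends to positive powers by induction; multiplying it by `T⁻¹` on both
sides gives the relation for `T⁻¹`, which starts the negative powers. -/
lemma td_zpow (m : ℤ) : (σ (Weyl.t 0) * σ (Weyl.d 0)) * ((T ^ m : (Module.End ℂ M)ˣ) :
    Module.End ℂ M) = ((T ^ m : (Module.End ℂ M)ˣ) : Module.End ℂ M) *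
      (σ (Weyl.t 0) * σ (Weyl.d 0)) + (m : ℂ) • ((T ^ m : (Module.End ℂ M)ˣ) : Module.End ℂ M) := by
  have h1 : (σ (Weyl.t 0) * σ (Weyl.d 0)) * (T : Module.End ℂ M) =
      (T : Module.End ℂ M) * (σ (Weyl.t 0) * σ (Weyl.d 0)) + (T : Module.End ℂ M) := by
    have := algHom_dt σ 0 0
    rw [if_pos rfl] at this
    rw [hT, mul_assoc, this, mul_add, mul_one]
  set S := σ (Weyl.t 0) * σ (Weyl.d 0)
  have h2 : S * ((T⁻¹ : (Module.End ℂ M)ˣ) : Module.End ℂ M) =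
      ((T⁻¹ : (Module.End ℂ M)ˣ) : Module.End ℂ M) * S -
        ((T⁻¹ : (Module.End ℂ M)ˣ) : Module.End ℂ M) := by
    rw [Units.mul_inv_eq_iff_eq_mul, sub_mul, Units.inv_mul, mul_assoc, h1, mul_add, ← mul_assoc,
      Units.inv_mul, one_mul, add_sub_cancel_right]
  induction m using Int.induction_on with
  | zero => simp
  | succ k ih =>
    rw [zpow_add_one, Units.val_mul, ← mul_assoc, ih, add_mul, mul_assoc, h1]
    push_cast
    rw [mul_add, add_smul, one_smul, smul_mul_assoc, mul_assoc]
    abel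
  | pred k ih =>
    rw [zpow_sub_one, Units.val_mul, ← mul_assoc, ih, add_mul, mul_assoc, h2]
    push_cast
    rw [mul_sub, sub_smul, one_smul, smul_mul_assoc, mul_assoc]
    abel

lemma td_zpow_apply {l : ℂ} {w : M} (hw : (σ (Weyl.t 0) * σ (Weyl.d 0)) w = l • w) (m : ℤ) :
    (σ (Weyl.t 0) * σ (Weyl.d 0)) (((T ^ m : (Module.End ℂ M)ˣ) : Module.End ℂ M) w) =
      (l + m) • ((T ^ m : (Module.End ℂ M)ˣ) : Module.End ℂ M) w := by
  rw [← Module.End.mul_apply, td_zpow hT, LinearMap.add_apply, Module.End.mul_apply, hw, map_smul,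
    LinearMap.smul_apply, add_smul]

/-- Multiplying by the invertible `t` replaces `∂` by `t ∂`, whose effect on `Tᵐ w` is known. -/
lemma d_zpow_apply {l : ℂ} {w : M} (hw : (σ (Weyl.t 0) * σ (Weyl.d 0)) w = l • w) (m : ℤ) :
    σ (Weyl.d 0) (((T ^ m : (Module.End ℂ M)ˣ) : Module.End ℂ M) w) =
      (l + m) • ((T ^ (m - 1) : (Module.End ℂ M)ˣ) : Module.End ℂ M) w := by
  rw [← sub_eq_zero]
  refine unit_apply_injective T ?_
  have h := td_zpow_apply hT hw m
  rw [Module.End.mul_apply, ← hT] at h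
  rw [map_sub, h, map_smul, ← Module.End.mul_apply, ← Units.val_mul, ← zpow_one_add,
    add_sub_cancel, sub_self]

lemma laurentEv_equivariant {l : ℂ} (a : Weyl 1) (p : (Fin 1 → ℤ) →₀ ℂ) :
    ∀ w ∈ (σ (Weyl.t 0) * σ (Weyl.d 0)).eigenspace l,
      σ a (laurentEv T p w) = laurentEv T (laurentRep 1 (fun _ => l) a p) w := by
  intro w hw
  rw [Module.End.mem_eigenspace_iff] at hw
  refine equivariant_of_generators σ (laurentRep 1 fun _ => l) (laurentEv T) w
    (fun i p => ?_) (fun i p => ?_) a p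
  · rw [Subsingleton.elim i 0, laurentRep, Weyl.lift_t]
    induction p using Finsupp.induction_linear with
    | zero => simp
    | add p q hp hq => simp only [map_add, LinearMap.add_apply, hp, hq]
    | single m c =>
      rw [laurentT_single, laurentEv_single, laurentEv_single, LinearMap.smul_apply, map_smul,
        LinearMap.smul_apply, Pi.add_apply, Pi.single_eq_same, add_comm, zpow_one_add, ← hT,
        Units.val_mul, Module.End.mul_apply]
  · rw [Subsingleton.elim i 0, laurentRep, Weyl.lift_d]
    induction p using Finsupp.induction_linear with
    | zero => simp
    | add p q hp hq => simp only [map_add, LinearMap.add_apply, hp, hq]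
    | single m c =>
      rw [laurentD_single, laurentEv_single, laurentEv_single, LinearMap.smul_apply, map_smul,
        LinearMap.smul_apply, Pi.sub_apply, Pi.single_eq_same, d_zpow_apply hT hw, smul_smul,
        mul_comm]

lemma laurentEv_injective (l : ℂ) : Function.Injective
    (evTensor ((σ (Weyl.t 0) * σ (Weyl.d 0)).eigenspace l) (laurentEv T)) := by
  refine evTensor_injective _ _ (Finsupp.basisSingleOne (R := ℂ) (ι := Fin 1 → ℤ))
    (fun _ : Unit => σ (Weyl.t 0) * σ (Weyl.d 0)) (fun m _ => l + m 0) ?_ ?_ ?_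
  · intro m m' h
    have h' := congrFun h ()
    simp only [add_right_inj, Int.cast_inj] at h'
    ext i
    rw [Subsingleton.elim i 0, h']
  · intro m _ w hw
    rw [Finsupp.coe_basisSingleOne, laurentEv_single, one_smul]
    exact td_zpow_apply hT (Module.End.mem_eigenspace_iff.1 hw) (m 0)
  · intro m w _ h
    rw [Finsupp.coe_basisSingleOne, laurentEv_single, one_smul] at h
    exact unit_apply_injective _ h

end Laurent

/-! ### The tensor decomposition in rank one -/

section RankOne
variable {M : Type*} [AddCommGroup M] [Module ℂ M]

/-- Assembling an equivalence with a tensor product from its components. -/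
lemma nonempty_equiv_tensor₂ {n : ℕ} [LieRingModule (Sch n) M]
    [LieModule ℂ (Sch n) M] {r : ℂ} (hr : r ≠ 0) (hz : ∀ v : M, ⁅zS n, v⁆ = r ^ 2 • v)
    {N L : Type*} [AddCommGroup N] [Module ℂ N]
    [LieRingModule Sl2 N] [LieModule ℂ Sl2 N] [AddCommGroup L] [Module ℂ L]
    (ρ : Weyl n →ₐ[ℂ] Module.End ℂ L) (Ψ : (N ⊗[ℂ] L) ≃ₗ[ℂ] M)
    (h₁ : ∀ X y p, Ψ (⁅X, y⁆ ⊗ₜ p) = sl2Res hr hz X (Ψ (y ⊗ₜ p)))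
    (h₂ : ∀ B, soRes hr hz (M := M) B = 0)
    (h₃ : ∀ a y p, Ψ (y ⊗ₜ ρ a p) = weylOn hr hz a (Ψ (y ⊗ₜ p))) :
    Nonempty (M ≃ₗ⁅ℂ, Sch n⁆ Tensor₂ r N ρ) := by
  let Ψ' : Tensor₂ r N ρ ≃ₗ[ℂ] M :=
    TensorProduct.congr (Restr.equiv (toSl2 n) N)
      (Restr.equiv ((ρ : Weyl n →ₗ⁅ℂ⁆ Module.End ℂ L).comp (theta n r)) L) ≪≫ₗ Ψ
  have hΨ : ∀ (X : Sch n) (x : Tensor₂ r N ρ), Ψ' ⁅X, x⁆ = ⁅X, Ψ' x⁆ := by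
    intro X x
    induction x using TensorProduct.induction_on with
    | zero => simp
    | add x y hx hy => simp only [lie_add, map_add, hx, hy]
    | tmul y p =>
      have h := LinearMap.congr_fun (op_eq' hr hz (M := M) X) (Ψ' (y ⊗ₜ p))
      rw [h₂, add_zero] at h
      refine Eq.trans ?_ h.symm
      rw [TensorProduct.LieModule.lie_tmul_right, map_add, LinearMap.add_apply]
      congr 1
      · exact h₁ _ _ _
      · exact h₃ _ _ _
  exact ⟨LieModuleEquiv.symm { Ψ' with map_lie' := fun {X x} => hΨ X x }⟩

variable [LieRingModule (Sch 1) M] [LieModule ℂ (Sch 1) M] {r : ℂ} (hr : r ≠ 0)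
  (hz : ∀ v : M, ⁅zS 1, v⁆ = r ^ 2 • v)

lemma soRes_eq_zero (B : So 1) : soRes hr hz (M := M) B = 0 := by
  have : B = 0 := by
    refine Subtype.ext (Matrix.ext fun i j => ?_)
    have h := so_apply_swap B i j
    rw [Subsingleton.elim j i] at h ⊢
    simpa [self_eq_neg] using h
  rw [this, map_zero]

lemma op_sl2Res_comm {X : Sl2} {c : ℂ} (h : ⁅h₂, X⁆ = c • X) :
    op 1 M (hS 1) * sl2Res hr hz X - sl2Res hr hz X * op 1 M (hS 1) = c • sl2Res hr hz X := by
  rw [op_hS_eq hr hz, add_mul, mul_add, sl2Res_weylOn, add_sub_add_right_eq_sub, ← Ring.lie_def,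
    ← LieHom.map_lie, h, map_smul]

/-- On each finite-dimensional weight space `t ∂` is injective, hence surjective, so the image of
`t` contains every weight space. -/
lemma weylOn_t_bijective (hHC : IsHarishChandra 1 M)
    (hd : ∀ w, weylOn hr hz (M := M) (Weyl.d 0) w = 0 → w = 0)
    (ht : ∀ w, weylOn hr hz (M := M) (Weyl.t 0) w = 0 → w = 0) :
    Function.Bijective (weylOn hr hz (M := M) (Weyl.t 0)) := by
  refine ⟨(injective_iff_map_eq_zero _).2 ht, LinearMap.range_eq_top.1 ?_⟩
  rw [eq_top_iff, ← iSup_weightSpace hHC, iSup_le_iff]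
  intro μ w hw
  have := hHC.finite μ
  have h1 : Function.Injective ((weylOn hr hz (Weyl.t 0) * weylOn hr hz (Weyl.d 0)).restrict
      (p := weightSpace 1 M μ) (q := weightSpace 1 M μ)
      fun w hw => weylOn_td_mem hr hz 0 0 hw) := by
    rw [injective_iff_map_eq_zero]
    intro u hu
    exact Subtype.ext (hd _ (ht _ (congrArg Subtype.val hu)))
  obtain ⟨u, hu⟩ := LinearMap.injective_iff_surjective.1 h1 ⟨w, hw⟩
  exact ⟨_, congrArg Subtype.val hu⟩

include hr hz in
theorem tensor_of_injective (hirr : LieModule.IsIrreducible ℂ (Sch 1) M)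
    (hHC : IsHarishChandra 1 M) (he : ActsInj M (eS 1)) (hf : ActsInj M (fS 1)) :
    ∃ (k : ℕ) (l : ℂ), (∀ m : ℤ, l ≠ m) ∧
      Nonempty (M ≃ₗ⁅ℂ, Sch 1⁆ Tensor₂ r (LSl2 k) (laurentRep 1 fun _ => l)) := by
  have : Nontrivial M := (LieSubmodule.nontrivial_iff ℂ (Sch 1) M).1 hirr.toNontrivial
  have hd := weylOn_d_injective hr hz hirr hHC he 0
  have ht := weylOn_t_injective hr hz hirr hHC hf 0
  have hdt := algHom_dt (weylOn hr hz (M := M)) 0 0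
  rw [if_pos rfl] at hdt
  obtain ⟨μ, l, v, hv, hv0, hl⟩ := exists_eigenvector_td hr hz hHC 0
  obtain ⟨T, hT⟩ := (Module.End.isUnit_iff _).2 (weylOn_t_bijective hr hz hHC hd ht)
  have hdW := weight_weylOn_d hr hz (M := M) 0
  have htW := weight_weylOn_t hr hz (M := M) 0
  have hE := op_sl2Res_comm hr hz (M := M) (X := e₂) (c := 2) (by
    refine Subtype.ext ?_
    ext i j
    fin_cases i <;> fin_cases j <;> simp [h₂, e₂, Ring.lie_def]; norm_num)
  have hF := op_sl2Res_comm hr hz (M := M) (X := f₂) (c := -2) (by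
    refine Subtype.ext ?_
    ext i j
    fin_cases i <;> fin_cases j <;> simp [h₂, f₂, Ring.lie_def]; norm_num)
  have hh := op_hS_eq hr hz (M := M)
  set σ := weylOn hr hz (M := M) with hσ
  have hSt : (σ (Weyl.t 0) * σ (Weyl.d 0)) * σ (Weyl.t 0) -
      σ (Weyl.t 0) * (σ (Weyl.t 0) * σ (Weyl.d 0)) = (1 : ℂ) • σ (Weyl.t 0) := by
    rw [mul_assoc, hdt, one_smul]
    noncomm_ring
  have hSd : (σ (Weyl.t 0) * σ (Weyl.d 0)) * σ (Weyl.d 0) -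
      σ (Weyl.d 0) * (σ (Weyl.t 0) * σ (Weyl.d 0)) = (-1 : ℂ) • σ (Weyl.d 0) := by
    rw [← mul_assoc (σ (Weyl.d 0)), hdt, neg_one_smul]
    noncomm_ring
  -- For `l = m` the vector `t⁻ᵐ v` would be killed by the injective operator `t ∂`.
  have hint : ∀ m : ℤ, l ≠ m := by
    rintro m rfl
    have h1 := td_zpow_apply hT hl (-m)
    rw [Int.cast_neg, add_neg_cancel, zero_smul] at h1
    exact hv0 (unit_apply_injective _ (hd _ (ht _ h1)))
  have hS : IsSplitting σ (laurentRep 1 fun _ => l) (sl2Res hr hz) (soRes hr hz (M := M))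
      ((σ (Weyl.t 0) * σ (Weyl.d 0)).eigenspace l) (laurentEv T)
      (Finsupp.basisSingleOne (R := ℂ) (ι := Fin 1 → ℤ)) 0 :=
    { comm := sl2Res_soRes hr hz
      irr := jointlyIrreducible hr hz hirr
      stable_left := fun X w hw => by
        rw [Module.End.mem_eigenspace_iff] at hw ⊢
        rw [← map_mul, ← Module.End.mul_apply, ← sl2Res_weylOn, map_mul, Module.End.mul_apply, hw,
          map_smul]
      stable_right := fun B w hw => by simp [soRes_eq_zero]
      comm_left := fun X p => commute_laurentEv (by rw [hT]; exact sl2Res_weylOn hr hz X _) p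
      comm_right := fun B p => by simp [soRes_eq_zero]
      equivariant := laurentEv_equivariant hT
      faithful := fun w hw h => by
        rw [Finsupp.coe_basisSingleOne, laurentEv_single, one_smul] at h
        exact unit_apply_injective _ h
      injective := laurentEv_injective hT l }
  have hpowW : ∀ X k, ∀ w ∈ (σ (Weyl.t 0) * σ (Weyl.d 0)).eigenspace l,
      (sl2Res hr hz X ^ k) w ∈ (σ (Weyl.t 0) * σ (Weyl.d 0)).eigenspace l := by
    intro X k
    induction k with
    | zero => exact fun w hw => hw
    | succ k ih =>
      intro w hw
      rw [pow_succ, Module.End.mul_apply]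
      exact ih _ (hS.stable_left X w hw)
  have hvW : v ∈ (σ (Weyl.t 0) * σ (Weyl.d 0)).eigenspace l :=
    Module.End.mem_eigenspace_iff.2 hl
  -- The residual `e` raises the weight by two and preserves eigenvalues of `t ∂`; `t²ᵏ` restores
  -- the weight but shifts the eigenvalue to `l + 2k`. Finitely many eigenvalues fit into the weight
  -- space of weight `μ`.
  have hEnil : ∃ k : ℕ, (sl2Res hr hz e₂ ^ k) v = 0 := by
    have := hHC.finite μ
    obtain ⟨k, hk⟩ := exists_eq_zero_of_eigenvalues (σ (Weyl.t 0) * σ (Weyl.d 0))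
      (weightSpace 1 M μ) (fun k => l + (2 * k : ℕ) * 1) (fun a b hab => by simpa using hab)
      (fun k => (σ (Weyl.t 0) ^ (2 * k)) ((sl2Res hr hz e₂ ^ k) v)) (fun k => by
        convert pow_map_mem_weightSpace htW (2 * k) (pow_map_mem_weightSpace hE k hv) using 2
        push_cast
        ring) (fun k => apply_pow_of_commutator hSt
          (Module.End.mem_eigenspace_iff.1 (hpowW _ k v hvW)) (2 * k))
    exact ⟨k, pow_apply_eq_zero ht _ _ hk⟩
  obtain ⟨k₁, hk₁, hk₁'⟩ := Nat.exists_not_and_succ_of_not_zero_of_exists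
    (p := fun k => (sl2Res hr hz e₂ ^ k) v = 0) (by simpa using hv0) hEnil
  set w := (sl2Res hr hz e₂ ^ k₁) v with hw
  have hwW := hpowW e₂ k₁ v hvW
  have hwμ := pow_map_mem_weightSpace hE k₁ hv
  rw [← hw] at hwW hwμ
  set ν := μ + k₁ * 2
  have hew : sl2Res hr hz e₂ w = 0 := by
    rw [hw, ← Module.End.mul_apply, ← pow_succ']
    exact hk₁'
  -- The Weyl part of `h` acts on this eigenspace as `-l - 1/2`.
  have hhw : sl2Res hr hz h₂ w = (ν + l + 1 / 2) • w := by
    have h1 := mem_weightSpace.1 hwμ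
    have h2 : σ (hW 1) w = (-l - 1 / 2) • w := by
      rw [hW_eq]
      simp only [Fin.sum_univ_one, map_sub, map_neg, map_mul, map_smul, map_one,
        LinearMap.sub_apply, LinearMap.neg_apply, LinearMap.smul_apply, Module.End.one_apply,
        Module.End.mem_eigenspace_iff.1 hwW, Nat.cast_one]
      module
    rw [hh, LinearMap.add_apply, h2] at h1
    rw [eq_sub_of_add_eq h1]
    module
  -- The same count, with `∂²ᵏ` restoring the weight.
  have hFnil : ∃ k : ℕ, (sl2Res hr hz f₂ ^ k) w = 0 := by
    have := hHC.finite ν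
    obtain ⟨k, hk⟩ := exists_eq_zero_of_eigenvalues (σ (Weyl.t 0) * σ (Weyl.d 0))
      (weightSpace 1 M ν) (fun k => l + (2 * k : ℕ) * -1) (fun a b hab => by simpa using hab)
      (fun k => (σ (Weyl.d 0) ^ (2 * k)) ((sl2Res hr hz f₂ ^ k) w)) (fun k => by
        convert pow_map_mem_weightSpace hdW (2 * k) (pow_map_mem_weightSpace hF k hwμ) using 2
        push_cast
        ring) (fun k => apply_pow_of_commutator hSd
          (Module.End.mem_eigenspace_iff.1 (hpowW _ k w hwW)) (2 * k))
    exact ⟨k, pow_apply_eq_zero hd _ _ hk⟩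
  obtain ⟨k, hk, hk'⟩ := Nat.exists_not_and_succ_of_not_zero_of_exists
    (p := fun k => (sl2Res hr hz f₂ ^ k) w = 0) (by simpa using hk₁) hFnil
  -- Here `Fᵏ w ≠ 0 = Fᵏ⁺¹ w`; applying `E` to the latter gives `(k + 1)(weight - k) Fᵏ w = 0`.
  have hwt : ν + l + 1 / 2 = k := by
    have h1 := (isSl2Ops_of_lieHom (sl2Res hr hz)).e_f_pow_succ hhw hew k
    rw [hk', map_zero] at h1
    have h2 := (mul_eq_zero.1 ((smul_eq_zero.1 h1.symm).resolve_right hk)).resolve_left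
      (by exact_mod_cast Nat.succ_ne_zero k)
    exact sub_eq_zero.1 h2
  rw [hwt] at hhw
  have hwU : w ∈ (σ (Weyl.t 0) * σ (Weyl.d 0)).eigenspace l ⊓ hwSpace (sl2Res hr hz) (k : ℂ) :=
    ⟨hwW, mem_hwSpace.2 ⟨hew, hhw⟩⟩
  -- As `so₁ = 0`, any line in the highest weight space is invariant, so irreducibility makes that
  -- space one-dimensional and `ℂ` can serve as the multiplicity factor.
  have hrange : LinearMap.range (LinearMap.toSpanSingleton ℂ M w) =
      (σ (Weyl.t 0) * σ (Weyl.d 0)).eigenspace l ⊓ hwSpace (sl2Res hr hz) (k : ℂ) := by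
    rw [LinearMap.range_toSpanSingleton]
    refine (hS.hw_irreducible k _ ((Submodule.span_singleton_le_iff_mem _ _).2 hwU)
      fun B u _ => by simp [soRes_eq_zero]).resolve_left ?_
    rw [Submodule.span_singleton_eq_bot]
    exact hk₁
  obtain ⟨Ψ, h1, -, h3⟩ := hS.exists_equiv (LinearMap.toSpanSingleton ℂ M w)
    (LinearMap.ker_eq_bot.1 (LinearMap.ker_toSpanSingleton ℂ hk₁)) hrange
    ((Submodule.ne_bot_iff _).2 ⟨w, hwU, hk₁⟩)
  exact ⟨k, l, hint, nonempty_equiv_tensor₂ hr hz _ ((TensorProduct.lid ℂ _).symm ≪≫ₗ Ψ)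
    (fun X y p => h1 X 1 y p) (soRes_eq_zero hr hz) (fun a y p => h3 a 1 y p)⟩

end RankOne

end Schrodinger

end

/-! ### The classification theorem -/

theorem mainTheorem1 (n : ℕ) (hn : 0 < n) (zdot r : ℂ) (hz : zdot ≠ 0) (hr : r ^ 2 = zdot)
    (M : Type*) [AddCommGroup M] [Module ℂ M] [LieRingModule (Sch n) M]
    [LieModule ℂ (Sch n) M]
    (hirr : LieModule.IsIrreducible ℂ (Sch n) M) (hHC : IsHarishChandra n M)
    (hcen : ∀ v : M, ⁅zS n, v⁆ = zdot • v) :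
    -- (a)
    (ActsLocNilp M (eS n) →
      IsHighestWeight n M ∧
      ∃ (V : Type) (_ : AddCommGroup V) (_ : Module ℂ V) (_ : LieRingModule (So n) V)
        (_ : LieModule ℂ (So n) V) (l : ℂ),
        FiniteDimensional ℂ V ∧ LieModule.IsIrreducible ℂ (So n) V ∧
        Nonempty (M ≃ₗ⁅ℂ, Sch n⁆ Tensor₃ r V (LSl2 l) (polyRep n))) ∧
    -- (b)
    (ActsLocNilp M (fS n) →
      IsLowestWeight n M ∧
      ∃ (V : Type) (_ : AddCommGroup V) (_ : Module ℂ V) (_ : LieRingModule (So n) V)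
        (_ : LieModule ℂ (So n) V) (l : ℂ),
        FiniteDimensional ℂ V ∧ LieModule.IsIrreducible ℂ (So n) V ∧
        Nonempty (Restr (tau n : Sch n →ₗ⁅ℂ⁆ Sch n) M ≃ₗ⁅ℂ, Sch n⁆
          Tensor₃ r V (LSl2 l) (polyRep n))) ∧
    -- (c)
    (ActsInj M (eS n) → ActsInj M (fS n) →
      n = 1 ∧
      ∃ (k : ℕ) (l : ℂ), (∀ m : ℤ, l ≠ m) ∧
        Nonempty (M ≃ₗ⁅ℂ, Sch n⁆ Tensor₂ r (LSl2 k) (laurentRep n fun _ => l))) := by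
  subst hr
  have hr : r ≠ 0 := fun h => hz (by simp [h])
  refine ⟨fun he => ⟨highestWeight_of_locNilp hirr hHC he,
    tensor_of_locNilp hr hcen hirr hHC he⟩, fun hf => ?_, fun he hf => ?_⟩
  -- The twist by `τ` exchanges `e` with `-f` and fixes `z`, so (b) is (a) for the twisted module.
  · have hirr' := twist_isIrreducible hirr
    have hHC' := twist_isHarishChandra hHC
    have he := twist_locNilp hf
    exact ⟨lowestWeight_of_twist (highestWeight_of_locNilp hirr' hHC' he) hirr,
      tensor_of_locNilp hr (twist_zS hcen) hirr' hHC' he⟩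
  · obtain rfl : n = 1 := le_antisymm (rank_le_one_of_injective hr hcen hirr hHC he hf) hn
    exact ⟨rfl, tensor_of_injective hr hcen hirr hHC he hf⟩
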